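/- Let $p$ be a prime and $K$ a complete discrete valuation field of mixed characteristic $(0,p)$ whose residue field $k$ satisfies $[k:k^p]=p^d<\infty$. Let $t_1,\dots,t_d\in\mathcal O_K$ be lifts of a $p$-basis of $k$, let $\overline K$ be an algebraic closure of $K$, $K_\infty=K(\mu_{p^\infty},t_1^{p^{-\infty}},\dots,t_d^{p^{-\infty}})\subset\overline K$ and $\Gamma=\mathrm{Gal}(K_\infty/K)$. Let $\chi:\Gamma\to\mathbb Z_p^\times$ be the cyclotomic character. Fix compatible systems $(\zeta_{p^n})_n$ of primitive $p^n$-th roots of unity and $(t_j^{p^{-n}})_n$ of $p$-power roots of the $t_j$, and define $s_j:\Gamma\to\mathbb Z_p$ by $\gamma(t_j^{p^{-n}})=\zeta_{p^n}^{s_j(\gamma)}t_j^{p^{-n}}$ for all $n$. Identify $\gamma\in\Gamma$ with the matrix in $GL_{d+1}(\mathbb Q_p)$ whose first row is $(\chi(\gamma),s_1(\gamma),\dots,s_d(\gamma))$ and whose other rows are those of the identity, and identify $\mathfrak g=\mathrm{Lie}(\Gamma)$ with the Lie algebra of matrices in $\mathfrak{gl}_{d+1}(\mathbb Q_p)$ all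 of whose rows except the first vanish. Its basis is $\mathfrak X_0,\dots,\mathfrak X_d$, the matrix units of the first row, with $[\mathfrak X_0,\mathfrak X_j]=\mathfrak X_j$ and $[\mathfrak X_j,\mathfrak X_k]=0$ for $j,k\ge 1$. Put $\mathfrak g_K=K\otimes_{\mathbb Q_p}\mathfrak g$. Let $\mathrm{Rep}^{\mathbb Z}_K\Gamma$ be the category of finite dimensional $K$-vector spaces with a continuous $K$-linear action of $\Gamma$ whose Jordan–Hölder factors are all of the form $\chi^n$, $n\in\mathbb Z$. Let $\mathrm{Rep}^{\mathbb Z}\mathfrak g_K$ be the category of finite dimensional $K$-linear representations of $\mathfrak g_K$ whose Jordan–Hölder factors are all of the form $K[\mathfrak X_0]/(\mathfrak X_0-n)$, $n\in\mathbb Z$ (one-dimensional, $\mathfrak X_0$ acts as $n$ and $\mathfrak X_1,\dots,\mathfrak X_d$ as $0$). For $V\in\mathrm{Rep}^{\mathbb Z}_K\Gamma$ let $\partial V$ be the vector space $V$ on which $\mathfrak X\in\mathfrak g$ acts by $$\mathfrak X(v)=\lim_{a\to 0}\frac{\exp(a\mathfrak X)v-v}{a},\qquad a\in\mathbb Z_p\setminus\{0\},$$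 where $\exp(a\mathfrak X)\in\Gamma$ for $a$ close to $0$. Then $\partial$ is a well-defined functor $\mathrm{Rep}^{\mathbb Z}_K\Gamma\to\mathrm{Rep}^{\mathbb Z}\mathfrak g_K$ and an equivalence of Tannakian categories over $K$ (a $K$-linear, exact, symmetric monoidal equivalence commuting with duals). It has a quasi-inverse $\mathbb V$, again a functor of Tannakian categories, such that $\mathbb V(D)$ has underlying vector space $D$ and every $\gamma$ in the open subgroup $\Gamma^0=\{\gamma\in\Gamma:\chi(\gamma)\in 1+2p\mathbb Z_p\}$ acts on $\mathbb V(D)$ by $$\gamma(v)=\exp(\log\gamma)(v)=\sum_{n\ge 0}\frac{(\log\gamma)^n}{n!}(v),$$ where $\log\gamma=\sum_{n\ge 1}(-1)^{n-1}(\gamma-1)^n/n\in\mathfrak g$ is the matrix logarithm; in particular this series converges for all $D\in\mathrm{Rep}^{\mathbb Z}\mathfrak g_K$, $v\in D$ and $\gamma\in\Gamma^0$. -/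

import Mathlib

open CategoryTheory MonoidalCategory TensorProduct Filter Topology
universe u v w
noncomputable section
attribute [local instance] LieRing.ofAssociativeRing
namespace SenTheory

section LieRep
variable (K : Type u) [Field K] (L : Type w) [LieRing L] [LieAlgebra K L]

/-- Finite dimensional linear representations of the Lie algebra `L` over `K`. -/
structure LieRep where
  V : FGModuleCat.{u} K
  φ : L →ₗ⁅K⁆ Module.End K V

namespace LieRep
variable {K L}

/-- Morphisms: `K`-linear maps commuting with the action of `L`. -/
@[ext]
structure Hom (D E : LieRep K L) where
  hom : D.V ⟶ E.V
  comm : ∀ (x : L) (v : D.V), hom.hom.hom (D.φ x v) = E.φ x (hom.hom.hom v)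

instance : Category (LieRep K L) where
  Hom D E := Hom D E
  id D := ⟨𝟙 D.V, fun _ _ => rfl⟩
  comp f g := ⟨f.hom ≫ g.hom, fun x v => by
    change g.hom.hom.hom (f.hom.hom.hom _) = _
    rw [f.comm, g.comm]; rfl⟩

@[ext]
theorem hom_ext {D E : LieRep K L} {f g : D ⟶ E} (h : f.hom = g.hom) : f = g := Hom.ext h

variable (K L) in
/-- The underlying vector space. -/
def forget : LieRep K L ⥤ FGModuleCat.{u} K where
  obj D := D.V
  map f := f.hom

instance : (forget K L).Faithful where
  map_injective h := hom_ext h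

/-- An isomorphism of vector spaces compatible with the actions. -/
def mkIso {D E : LieRep K L} (i : D.V ≅ E.V)
    (h : ∀ (x : L) (v : D.V), i.hom.hom.hom (D.φ x v) = E.φ x (i.hom.hom.hom v)) : D ≅ E where
  hom := ⟨i.hom, h⟩
  inv := ⟨i.inv, fun x v => by
    have e1 : ∀ a : D.V, i.inv.hom.hom (i.hom.hom.hom a) = a := fun a =>
      congrArg (fun f : D.V ⟶ D.V => f.hom.hom a) i.hom_inv_id
    have e2 : ∀ a : E.V, i.hom.hom.hom (i.inv.hom.hom a) = a := fun a =>
      congrArg (fun f : E.V ⟶ E.V => f.hom.hom a) i.inv_hom_id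
    rw [← e1 (D.φ x _), h, e2]⟩
  hom_inv_id := hom_ext i.hom_inv_id
  inv_hom_id := hom_ext i.inv_hom_id

instance (D E : LieRep K L) : Add (D ⟶ E) :=
  ⟨fun f g => ⟨f.hom + g.hom, fun x v => by
    change f.hom.hom.hom _ + g.hom.hom.hom _ = E.φ x (f.hom.hom.hom _ + g.hom.hom.hom _)
    rw [f.comm, g.comm, map_add]⟩⟩
instance (D E : LieRep K L) : Zero (D ⟶ E) :=
  ⟨⟨0, fun x v => by
    change (0 : E.V) = E.φ x (0 : E.V)
    rw [map_zero]⟩⟩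
instance (D E : LieRep K L) : Neg (D ⟶ E) :=
  ⟨fun f => ⟨-f.hom, fun x v => by
    change -f.hom.hom.hom _ = E.φ x (-f.hom.hom.hom _)
    rw [f.comm, map_neg]⟩⟩
instance (D E : LieRep K L) : Sub (D ⟶ E) :=
  ⟨fun f g => ⟨f.hom - g.hom, fun x v => by
    change f.hom.hom.hom _ - g.hom.hom.hom _ = E.φ x (f.hom.hom.hom _ - g.hom.hom.hom _)
    rw [f.comm, g.comm, map_sub]⟩⟩
instance (D E : LieRep K L) : SMul K (D ⟶ E) :=
  ⟨fun c f => ⟨c • f.hom, fun x v => by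
    change c • f.hom.hom.hom _ = E.φ x (c • f.hom.hom.hom _)
    rw [f.comm, map_smul]⟩⟩
instance (D E : LieRep K L) : SMul ℕ (D ⟶ E) :=
  ⟨fun c f => ⟨c • f.hom, fun x v => by
    change c • f.hom.hom.hom _ = E.φ x (c • f.hom.hom.hom _)
    rw [f.comm, map_nsmul]⟩⟩
instance (D E : LieRep K L) : SMul ℤ (D ⟶ E) :=
  ⟨fun c f => ⟨c • f.hom, fun x v => by
    change c • f.hom.hom.hom _ = E.φ x (c • f.hom.hom.hom _)
    rw [f.comm, map_zsmul]⟩⟩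

theorem hom_injective (D E : LieRep K L) :
    Function.Injective (fun f : D ⟶ E => (f.hom : D.V ⟶ E.V)) := fun _ _ h => hom_ext h

instance (D E : LieRep K L) : AddCommGroup (D ⟶ E) :=
  (hom_injective D E).addCommGroup _ rfl (fun _ _ => rfl) (fun _ => rfl) (fun _ _ => rfl)
    (fun _ _ => rfl) (fun _ _ => rfl)

instance : Preadditive (LieRep K L) where
  add_comp _ _ _ f f' g := hom_ext (Preadditive.add_comp _ _ _ f.hom f'.hom g.hom)
  comp_add _ _ _ f g g' := hom_ext (Preadditive.comp_add _ _ _ f.hom g.hom g'.hom)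

/-- Taking underlying linear maps is additive. -/
def homAddHom (D E : LieRep K L) : (D ⟶ E) →+ (D.V ⟶ E.V) where
  toFun f := f.hom
  map_zero' := rfl
  map_add' _ _ := rfl

instance (D E : LieRep K L) : Module K (D ⟶ E) :=
  (hom_injective D E).module K (homAddHom D E) (fun _ _ => rfl)

instance : Linear K (LieRep K L) where
  smul_comp _ _ _ c f g := hom_ext (Linear.smul_comp _ _ _ c f.hom g.hom)
  comp_smul _ _ _ f c g := hom_ext (Linear.comp_smul _ _ _ f.hom c g.hom)

/-- The Leibniz action of `L` on a tensor product. -/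
def tensorAction {V W : Type u} [AddCommGroup V] [Module K V] [AddCommGroup W] [Module K W]
    (φ : L →ₗ⁅K⁆ Module.End K V) (ψ : L →ₗ⁅K⁆ Module.End K W) :
    L →ₗ⁅K⁆ Module.End K (V ⊗[K] W) where
  toFun x := (φ x).rTensor W + (ψ x).lTensor V
  map_add' x y := by
    simp only [map_add, LinearMap.rTensor_add, LinearMap.lTensor_add]; abel
  map_smul' c x := by
    simp only [map_smul, LinearMap.rTensor_smul, LinearMap.lTensor_smul, RingHom.id_apply, smul_add]
  map_lie' {x y} := by
    refine TensorProduct.ext' fun a b => ?_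
    simp only [LieHom.map_lie, LinearMap.add_apply,
      LinearMap.rTensor_tmul, LinearMap.lTensor_tmul, Ring.lie_def, Module.End.mul_apply,
      LinearMap.sub_apply, map_add, TensorProduct.sub_tmul, TensorProduct.tmul_sub]
    abel

theorem tensorAction_tmul {V W : Type u} [AddCommGroup V] [Module K V] [AddCommGroup W] [Module K W]
    (φ : L →ₗ⁅K⁆ Module.End K V) (ψ : L →ₗ⁅K⁆ Module.End K W) (x : L) (a : V) (b : W) :
    tensorAction φ ψ x (a ⊗ₜ b) = φ x a ⊗ₜ b + a ⊗ₜ ψ x b := rfl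

theorem tensorHom_comm {D D' E E' : LieRep K L} (f : D ⟶ D') (g : E ⟶ E') (x : L)
    (v : D.V ⊗[K] E.V) :
    TensorProduct.map f.hom.hom.hom g.hom.hom.hom (tensorAction D.φ E.φ x v) =
      tensorAction D'.φ E'.φ x (TensorProduct.map f.hom.hom.hom g.hom.hom.hom v) := by
  induction v using TensorProduct.induction_on with
  | zero => simp only [map_zero]
  | add a b ha hb => simp only [map_add, ha, hb]
  | tmul a b =>
    rw [tensorAction_tmul, map_add, TensorProduct.map_tmul, TensorProduct.map_tmul,
      TensorProduct.map_tmul, tensorAction_tmul, f.comm, g.comm]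

theorem assoc_comm {V W U : Type u} [AddCommGroup V] [Module K V] [AddCommGroup W] [Module K W]
    [AddCommGroup U] [Module K U] (φ : L →ₗ⁅K⁆ Module.End K V) (ψ : L →ₗ⁅K⁆ Module.End K W)
    (θ : L →ₗ⁅K⁆ Module.End K U) (x : L) (v : (V ⊗[K] W) ⊗[K] U) :
    TensorProduct.assoc K V W U (tensorAction (tensorAction φ ψ) θ x v) =
      tensorAction φ (tensorAction ψ θ) x (TensorProduct.assoc K V W U v) := by
  have h : (TensorProduct.assoc K V W U).toLinearMap ∘ₗ tensorAction (tensorAction φ ψ) θ x =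
      tensorAction φ (tensorAction ψ θ) x ∘ₗ (TensorProduct.assoc K V W U).toLinearMap := by
    refine TensorProduct.ext_threefold fun a b c => ?_
    simp only [LinearMap.comp_apply, LinearEquiv.coe_coe, tensorAction_tmul,
      TensorProduct.add_tmul, TensorProduct.tmul_add, map_add, TensorProduct.assoc_tmul]
    abel
  exact LinearMap.congr_fun h v

theorem lid_comm {V : Type u} [AddCommGroup V] [Module K V] (φ : L →ₗ⁅K⁆ Module.End K V) (x : L)
    (v : K ⊗[K] V) :
    TensorProduct.lid K V (tensorAction 0 φ x v) = φ x (TensorProduct.lid K V v) := by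
  induction v using TensorProduct.induction_on with
  | zero => simp only [map_zero]
  | add a b ha hb => simp only [map_add, ha, hb]
  | tmul a b => simp [tensorAction_tmul]

theorem rid_comm {V : Type u} [AddCommGroup V] [Module K V] (φ : L →ₗ⁅K⁆ Module.End K V) (x : L)
    (v : V ⊗[K] K) :
    TensorProduct.rid K V (tensorAction φ 0 x v) = φ x (TensorProduct.rid K V v) := by
  induction v using TensorProduct.induction_on with
  | zero => simp only [map_zero]
  | add a b ha hb => simp only [map_add, ha, hb]
  | tmul a b => simp [tensorAction_tmul]

theorem comm_comm {V W : Type u} [AddCommGroup V] [Module K V] [AddCommGroup W] [Module K W]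
    (φ : L →ₗ⁅K⁆ Module.End K V) (ψ : L →ₗ⁅K⁆ Module.End K W) (x : L) (v : V ⊗[K] W) :
    TensorProduct.comm K V W (tensorAction φ ψ x v) =
      tensorAction ψ φ x (TensorProduct.comm K V W v) := by
  induction v using TensorProduct.induction_on with
  | zero => simp only [map_zero]
  | add a b ha hb => simp only [map_add, ha, hb]
  | tmul a b => simp [tensorAction_tmul, add_comm]

instance : MonoidalCategoryStruct (LieRep K L) where
  tensorObj D E := ⟨D.V ⊗ E.V, tensorAction D.φ E.φ⟩
  tensorUnit := ⟨𝟙_ _, 0⟩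
  whiskerLeft D _ _ f := ⟨D.V ◁ f.hom, tensorHom_comm (𝟙 D) f⟩
  whiskerRight f E := ⟨f.hom ▷ E.V, tensorHom_comm f (𝟙 E)⟩
  tensorHom f g := ⟨f.hom ⊗ₘ g.hom, tensorHom_comm f g⟩
  associator D E F := mkIso (α_ D.V E.V F.V) (assoc_comm D.φ E.φ F.φ)
  leftUnitor D := mkIso (λ_ D.V) (lid_comm D.φ)
  rightUnitor D := mkIso (ρ_ D.V) (rid_comm D.φ)

/-- The tensor structure is that of the underlying vector spaces. -/
def inducingData : Monoidal.InducingFunctorData (forget K L) where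
  μIso _ _ := Iso.refl _
  εIso := Iso.refl _
  whiskerLeft_eq _ _ _ _ := rfl
  whiskerRight_eq _ _ := rfl
  tensorHom_eq _ _ := rfl
  associator_eq D E F := by
    change (α_ D.V E.V F.V).hom = _
    exact FGModuleCat.hom_ext (TensorProduct.ext_threefold fun a b c => rfl)
  leftUnitor_eq D := by
    change (λ_ D.V).hom = _
    exact FGModuleCat.hom_ext (TensorProduct.ext' fun a b => rfl)
  rightUnitor_eq D := by
    change (ρ_ D.V).hom = _
    exact FGModuleCat.hom_ext (TensorProduct.ext' fun a b => rfl)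

instance : MonoidalCategory (LieRep K L) := Monoidal.induced (forget K L) inducingData

instance : (forget K L).Monoidal :=
  (Monoidal.fromInducedCoreMonoidal (forget K L) inducingData).toMonoidal

instance : BraidedCategory (LieRep K L) :=
  .ofFaithful (forget K L) (fun D E => mkIso (β_ D.V E.V) (comm_comm D.φ E.φ)) (fun D E => by
    rfl)

instance : (forget K L).Braided where
  braided D E := by rfl

instance : SymmetricCategory (LieRep K L) := .ofFaithful (forget K L)

end LieRep
end LieRep
section Factors
variable {K : Type u} [Field K] {V : Type v} [AddCommGroup V] [Module K V] {S : Type w}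

/-- Let `act s` (`s : S`) be operators on `V` and let `c n : S → K` (`n : ℤ`) be a family of
one-dimensional systems of eigenvalues. `IsIteratedExtension act c A` says that `A` is reached from
`0` by finitely many steps `A ⊆ B`, where on `B / A` every `act s` is multiplication by `c n s`,
for some `n` depending on the step. In other words, `A` is a stable subspace which is a successive
extension of one-dimensional objects of the form `c n`. -/
inductive IsIteratedExtension (act : S → Module.End K V) (c : ℤ → S → K) : Submodule K V → Prop
  | bot : IsIteratedExtension act c ⊥
  | step {A B : Submodule K V} (n : ℤ) (hA : IsIteratedExtension act c A) (hAB : A ≤ B)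
      (h : ∀ s, ∀ v ∈ B, act s v - c n s • v ∈ A) : IsIteratedExtension act c B

theorem IsIteratedExtension.stable {act : S → Module.End K V} {c : ℤ → S → K} {A : Submodule K V}
    (h : IsIteratedExtension act c A) (s : S) : ∀ v ∈ A, act s v ∈ A := by
  cases h with
  | bot => intro v hv; rw [(Submodule.mem_bot K).1 hv, map_zero]; exact Submodule.zero_mem _
  | step n hA hAB h =>
    intro v hv
    have := A.add_mem (hAB (h s v hv)) (A.smul_mem (c n s) hv)
    rwa [sub_add_cancel] at this

theorem IsIteratedExtension.tensor {W : Type v} [AddCommGroup W] [Module K W]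
    {act : S → Module.End K V} {act' : S → Module.End K W} {T : S → Module.End K (V ⊗[K] W)}
    {c : ℤ → S → K}
    (hT : ∀ (s : S) (n m : ℤ) (a : V) (b : W), ∃ (f : W) (k : K),
      T s (a ⊗ₜ b) - c (n + m) s • (a ⊗ₜ[K] b) =
        (act s a - c n s • a) ⊗ₜ f + k • (a ⊗ₜ (act' s b - c m s • b)))
    (hV : IsIteratedExtension act c ⊤) (hW : IsIteratedExtension act' c ⊤) :
    IsIteratedExtension T c ⊤ := by
  have key : ∀ A : Submodule K V, IsIteratedExtension act c A →
      IsIteratedExtension T c (Submodule.map₂ (TensorProduct.mk K V W) A ⊤) := by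
    intro A hA
    induction hA with
    | bot => rw [Submodule.map₂_bot_left]; exact .bot
    | @step A A' n hA hAA' hn ih =>
      have inner : ∀ B : Submodule K W, IsIteratedExtension act' c B →
          IsIteratedExtension T c (Submodule.map₂ (TensorProduct.mk K V W) A ⊤ ⊔
            Submodule.map₂ (TensorProduct.mk K V W) A' B) := by
        intro B hB
        induction hB with
        | bot => rw [Submodule.map₂_bot_right, sup_bot_eq]; exact ih
        | @step B B' m hB hBB' hm ih' =>
          refine .step (n + m) ih' (sup_le_sup_left (Submodule.map₂_le_map₂_right hBB') _) ?_
          intro s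
          suffices H : Submodule.map₂ (TensorProduct.mk K V W) A ⊤ ⊔
              Submodule.map₂ (TensorProduct.mk K V W) A' B' ≤
              (Submodule.map₂ (TensorProduct.mk K V W) A ⊤ ⊔
                Submodule.map₂ (TensorProduct.mk K V W) A' B).comap
                (T s - c (n + m) s • LinearMap.id) from fun v hv => H hv
          refine sup_le (Submodule.map₂_le.2 fun a ha b _ => ?_)
            (Submodule.map₂_le.2 fun a ha b hb => ?_)
          · obtain ⟨f, k, hfk⟩ := hT s n m a b
            rw [Submodule.mem_comap, TensorProduct.mk_apply, LinearMap.sub_apply,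
              LinearMap.smul_apply, LinearMap.id_apply, hfk]
            refine Submodule.mem_sup_left (Submodule.add_mem _ ?_ (Submodule.smul_mem _ _ ?_))
            · exact Submodule.apply_mem_map₂ _
                (A.sub_mem (hA.stable s a ha) (A.smul_mem _ ha)) Submodule.mem_top
            · exact Submodule.apply_mem_map₂ _ ha Submodule.mem_top
          · obtain ⟨f, k, hfk⟩ := hT s n m a b
            rw [Submodule.mem_comap, TensorProduct.mk_apply, LinearMap.sub_apply,
              LinearMap.smul_apply, LinearMap.id_apply, hfk]
            refine Submodule.add_mem _ (Submodule.mem_sup_left ?_)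
              (Submodule.smul_mem _ _ (Submodule.mem_sup_right ?_))
            · exact Submodule.apply_mem_map₂ _ (hn s a ha) Submodule.mem_top
            · exact Submodule.apply_mem_map₂ _ ha (hm s b hb)
      have h := inner ⊤ hW
      rwa [sup_eq_right.2 (Submodule.map₂_le_map₂_left hAA')] at h
  have h := key ⊤ hV
  rwa [TensorProduct.map₂_mk_top_top_eq_top] at h

theorem IsIteratedExtension.of_scalar {act : S → Module.End K V} {c : ℤ → S → K} (n : ℤ)
    (h : ∀ s v, act s v = c n s • v) : IsIteratedExtension act c ⊤ :=
  .step n .bot bot_le fun s v _ => by rw [h, sub_self]; exact Submodule.zero_mem _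

end Factors

section Continuity
variable (K : Type u) [Field K] [TopologicalSpace K]

/-- The action `G × V → V` is continuous, where the finite dimensional space `V` carries its
canonical topology (that of `K ^ n`). -/
def IsContinuousAction {G : Type w} [TopologicalSpace G] {V : Type v} [AddCommGroup V]
    [Module K V] (ρ : G → Module.End K V) : Prop :=
  letI : TopologicalSpace V := moduleTopology K V
  Continuous fun x : G × V => ρ x.1 x.2

/-- Convergence of a series in a finite dimensional space with its canonical topology. -/
def HasSumFD {V : Type v} [AddCommGroup V] [Module K V] (f : ℕ → V) (a : V) : Prop :=
  letI : TopologicalSpace V := moduleTopology K V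
  HasSum f a

/-- Convergence in a finite dimensional space with its canonical topology. -/
def TendstoFD {α : Type w} {V : Type v} [AddCommGroup V] [Module K V] (f : α → V) (l : Filter α)
    (a : V) : Prop :=
  letI : TopologicalSpace V := moduleTopology K V
  Tendsto f l (𝓝 a)

variable {K} in
theorem IsContinuousAction.tensor [IsTopologicalRing K] {G : Type w} [TopologicalSpace G]
    {V W : Type v} [AddCommGroup V] [Module K V] [Module.Finite K V] [AddCommGroup W] [Module K W]
    [Module.Finite K W] {ρ : G → Module.End K V} {σ : G → Module.End K W}
    (hρ : IsContinuousAction K ρ) (hσ : IsContinuousAction K σ) :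
    IsContinuousAction K (fun g => TensorProduct.map (ρ g) (σ g)) := by
  unfold IsContinuousAction at *
  let _ : TopologicalSpace V := moduleTopology K V
  let _ : TopologicalSpace W := moduleTopology K W
  let _ : TopologicalSpace (V ⊗[K] W) := moduleTopology K (V ⊗[K] W)
  have : IsModuleTopology K V := ⟨rfl⟩
  have : IsModuleTopology K W := ⟨rfl⟩
  have : IsModuleTopology K (V ⊗[K] W) := ⟨rfl⟩
  have := IsModuleTopology.toContinuousAdd K (V ⊗[K] W)
  let b := Module.finBasis K V
  let c := Module.finBasis K W
  let bc := b.tensorProduct c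
  have hmk : Continuous fun x : V × W => x.1 ⊗ₜ[K] x.2 :=
    IsModuleTopology.continuous_bilinear_of_finite_left (TensorProduct.mk K V W)
  have e : (fun x : G × (V ⊗[K] W) => TensorProduct.map (ρ x.1) (σ x.1) x.2) =
      fun x => ∑ i, bc.coord i x.2 • (ρ x.1 (b i.1) ⊗ₜ[K] σ x.1 (c i.2)) := by
    funext x
    conv_lhs => rw [← bc.sum_repr x.2, map_sum]
    refine Finset.sum_congr rfl fun i _ => ?_
    rw [map_smul, Module.Basis.tensorProduct_apply', TensorProduct.map_tmul]; rfl
  rw [e]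
  refine continuous_finsetSum _ fun i _ => Continuous.smul
    (f := fun x : G × (V ⊗[K] W) => bc.coord i x.2)
    (g := fun x : G × (V ⊗[K] W) => ρ x.1 (b i.1) ⊗ₜ[K] σ x.1 (c i.2)) ?_ ?_
  · exact (IsModuleTopology.continuous_of_linearMap (bc.coord i)).comp continuous_snd
  · refine hmk.comp (Continuous.prodMk ?_ ?_)
    · exact hρ.comp (continuous_fst.prodMk continuous_const)
    · exact hσ.comp (continuous_fst.prodMk continuous_const)

theorem isContinuousAction_one {G : Type w} [TopologicalSpace G] {V : Type v} [AddCommGroup V]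
    [Module K V] : IsContinuousAction K (fun _ : G => (1 : Module.End K V)) := by
  let _ : TopologicalSpace V := moduleTopology K V
  exact continuous_snd

end Continuity

section Categories
variable {K : Type u} [Field K]

/-- The continuous representations of `G` over `K` all of whose Jordan–Hölder factors
are among the one-dimensional representations `χ ^ n`, `n : ℤ`. -/
def repZ [TopologicalSpace K] {G : Type w} [Group G] [TopologicalSpace G] (χ : G →* Kˣ) :
    ObjectProperty (FDRep K G) :=
  fun V => IsContinuousAction K (fun g => V.ρ g) ∧
    IsIteratedExtension (fun g => V.ρ g) (fun n g => ((χ g ^ n : Kˣ) : K)) ⊤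

instance [TopologicalSpace K] [IsTopologicalRing K] {G : Type w} [Group G] [TopologicalSpace G]
    (χ : G →* Kˣ) : (repZ χ).IsMonoidal where
  prop_unit := by
    refine ⟨isContinuousAction_one K, .of_scalar 0 fun g v => ?_⟩
    rw [zpow_zero, Units.val_one, one_smul]; rfl
  prop_tensor V W hV hW := by
    refine ⟨hV.1.tensor hW.1,
      hV.2.tensor (T := fun g => TensorProduct.map (V.ρ g) (W.ρ g)) (fun g n m a b => ?_) hW.2⟩
    refine ⟨W.ρ g b, ((χ g ^ n : Kˣ) : K), ?_⟩
    rw [TensorProduct.map_tmul, zpow_add, Units.val_mul, TensorProduct.sub_tmul,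
      TensorProduct.tmul_sub, smul_sub, ← TensorProduct.smul_tmul', TensorProduct.tmul_smul,
      smul_smul]
    abel

/-- The representations of the Lie algebra `L` all of whose Jordan–Hölder factors are
among the one-dimensional representations `x ↦ n * δ x`, `n : ℤ`. -/
def lieRepZ {L : Type w} [LieRing L] [LieAlgebra K L] (δ : L →ₗ[K] K) :
    ObjectProperty (LieRep K L) :=
  fun D => IsIteratedExtension (fun x => D.φ x) (fun n x => (n : K) * δ x) ⊤

instance {L : Type w} [LieRing L] [LieAlgebra K L] (δ : L →ₗ[K] K) : (lieRepZ δ).IsMonoidal where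
  prop_unit := .of_scalar 0 fun x v => by
    rw [Int.cast_zero, zero_mul, zero_smul]; rfl
  prop_tensor D E hD hE := by
    refine hD.tensor (T := fun x => LieRep.tensorAction D.φ E.φ x) (fun x n m a b => ?_) hE
    refine ⟨b, 1, ?_⟩
    rw [LieRep.tensorAction_tmul, Int.cast_add, add_mul, TensorProduct.sub_tmul,
      TensorProduct.tmul_sub, one_smul, add_smul, ← TensorProduct.smul_tmul',
      TensorProduct.tmul_smul]
    abel

/-- The underlying vector space of an object of `repZ χ`. -/
abbrev repZ.forget [TopologicalSpace K] {G : Type w} [Group G] [TopologicalSpace G]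
    (χ : G →* Kˣ) : (repZ χ).FullSubcategory ⥤ FGModuleCat.{u} K :=
  (repZ χ).ι ⋙ Action.forget (FGModuleCat.{u} K) G

/-- The underlying vector space of an object of `lieRepZ δ`. -/
abbrev lieRepZ.forget {L : Type w} [LieRing L] [LieAlgebra K L] (δ : L →ₗ[K] K) :
    (lieRepZ δ).FullSubcategory ⥤ FGModuleCat.{u} K :=
  (lieRepZ δ).ι ⋙ LieRep.forget K L

/-- Functors of Tannakian categories over `K`: `K`-linear exact symmetric monoidal functors that
commute with duals. -/
structure IsTannakianFunctor (K : Type u) [Field K] {C : Type v} {D : Type w} [Category.{u} C]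
    [Category.{u} D] [Preadditive C] [Preadditive D] [Linear K C] [Linear K D]
    [MonoidalCategory C] [MonoidalCategory D] [SymmetricCategory C] [SymmetricCategory D]
    (F : C ⥤ D) [F.Braided] : Prop where
  additive : F.Additive
  linear : F.Linear K
  exact_left : Limits.PreservesFiniteLimits F
  exact_right : Limits.PreservesFiniteColimits F
  /-- Every object `X` has a dual `Y`, and `F.obj Y` is a dual of `F.obj X`. -/
  dual : ∀ X : C, ∃ Y : C, Nonempty (ExactPairing X Y) ∧
    Nonempty (ExactPairing (F.obj X) (F.obj Y))

end Categories
section Arithmetic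

/-- A `p`-basis with `d` elements of a field `k` of characteristic `p`: the monomials with exponents
`0 ≤ a i < p` form a basis of `k` over `k ^ p`; in particular `[k : k ^ p] = p ^ d`. -/
def IsPBasis (p : ℕ) [Fact p.Prime] {k : Type u} [Field k] [CharP k p] {d : ℕ} (b : Fin d → k) :
    Prop :=
  LinearIndependent (frobenius k p).fieldRange (fun a : Fin d → Fin p => ∏ i, b i ^ (a i : ℕ)) ∧
    Submodule.span (frobenius k p).fieldRange
      (Set.range fun a : Fin d → Fin p => ∏ i, b i ^ (a i : ℕ)) = ⊤

variable (p : ℕ) [Fact p.Prime] {K : Type u} [Field K] (Kbar : Type v) [Field Kbar] [Algebra K Kbar]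
  {d : ℕ} (t : Fin d → K)

/-- `K_∞ = K(μ_{p^∞}, t_1^{p^{-∞}}, …, t_d^{p^{-∞}})`. -/
def KInf : IntermediateField K Kbar :=
  IntermediateField.adjoin K ({x | ∃ n : ℕ, x ^ p ^ n = 1} ∪
    {x | ∃ (n : ℕ) (j : Fin d), x ^ p ^ n = algebraMap K Kbar (t j)})

/-- `Γ = Gal(K_∞ / K)`, with the Krull topology. -/
abbrev Gam : Type v := KInf p Kbar t ≃ₐ[K] KInf p Kbar t

/-- The cyclotomic character `Γ → ℤ_p^×`. -/
def chi : Gam p Kbar t →* ℤ_[p]ˣ :=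
  (cyclotomicCharacter (KInf p Kbar t) p).comp
    (MulSemiringAction.toRingAut (Gam p Kbar t) (KInf p Kbar t))

/-- A generator `(ζ_{p^n})_n` of `ℤ_p(1)` and compatible systems `t_j^{p^{-n}}` of `p`-power roots
of the `t_j`, in `K_∞`. -/
structure RootSystem where
  ζ : ℕ → KInf p Kbar t
  ζ_prim : ∀ n, IsPrimitiveRoot (ζ n) (p ^ n)
  ζ_succ : ∀ n, ζ (n + 1) ^ p = ζ n
  root : Fin d → ℕ → KInf p Kbar t
  root_zero : ∀ j, root j 0 = algebraMap K (KInf p Kbar t) (t j)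
  root_succ : ∀ j n, root j (n + 1) ^ p = root j n

variable {p Kbar t}

theorem RootSystem.exists_kummer (R : RootSystem p Kbar t) (j : Fin d) (γ : Gam p Kbar t) :
    ∃ s : ℤ_[p], ∀ n, γ (R.root j n) = R.ζ n ^ (PadicInt.toZModPow n s).val * R.root j n := by
  have hp : p ≠ 0 := (Fact.out : p.Prime).ne_zero
  have hpow : ∀ n, R.root j n ^ p ^ n = algebraMap K (KInf p Kbar t) (t j) := by
    intro n
    induction n with
    | zero => rw [pow_zero, pow_one, R.root_zero]
    | succ n ih => rw [pow_succ', pow_mul, R.root_succ, ih]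
  by_cases h0 : t j = 0
  · refine ⟨0, fun n => ?_⟩
    have : R.root j n = 0 := by
      have := hpow n
      rw [h0, map_zero] at this
      exact pow_eq_zero_iff (pow_ne_zero n hp) |>.1 this
    rw [this, map_zero, mul_zero]
  have hne : ∀ n, R.root j n ≠ 0 := by
    intro n h
    have := hpow n
    rw [h, zero_pow (pow_ne_zero n hp)] at this
    exact h0 ((map_eq_zero (algebraMap K (KInf p Kbar t))).1 this.symm)
  have hex : ∀ n, ∃ k : ℕ, γ (R.root j n) = R.ζ n ^ k * R.root j n := by
    intro n
    have h1 : (γ (R.root j n) / R.root j n) ^ p ^ n = 1 := by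
      rw [div_pow, ← map_pow, hpow, AlgEquiv.commutes, div_self]
      rw [← hpow n]; exact pow_ne_zero _ (hne n)
    have : NeZero (p ^ n) := ⟨pow_ne_zero n hp⟩
    obtain ⟨k, _, hk⟩ := (R.ζ_prim n).eq_pow_of_pow_eq_one h1
    exact ⟨k, by rw [hk, div_mul_cancel₀ _ (hne n)]⟩
  choose k hk using hex
  have hc : ∀ n, ((p : ℤ) ^ n) ∣ (k (n + 1) : ℤ) - k n := by
    intro n
    have h1 : R.ζ n ^ k (n + 1) = R.ζ n ^ k n := by
      have h2 := congrArg (· ^ p) (hk (n + 1))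
      have h3 : (R.ζ (n + 1) ^ k (n + 1)) ^ p = R.ζ n ^ k (n + 1) := by
        rw [← pow_mul, mul_comm, pow_mul, R.ζ_succ]
      simp only [← map_pow, mul_pow, R.root_succ] at h2
      rw [h3, hk n] at h2
      exact (mul_right_cancel₀ (hne n) h2).symm
    have hz : R.ζ n ≠ 0 := (R.ζ_prim n).ne_zero (pow_ne_zero n hp)
    have h4 : R.ζ n ^ ((k (n + 1) : ℤ) - k n) = 1 := by
      rw [zpow_sub₀ hz, zpow_natCast, zpow_natCast, h1, div_self (pow_ne_zero _ hz)]
    exact_mod_cast ((R.ζ_prim n).zpow_eq_one_iff_dvd _).1 h4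
  refine ⟨PadicInt.ofIntSeq _
    (PadicInt.isCauSeq_padicNorm_of_pow_dvd_sub (fun n => (k n : ℤ)) p hc), fun n => ?_⟩
  rw [PadicInt.toZModPow_ofIntSeq_of_pow_dvd_sub (fun n => (k n : ℤ)) p hc n, Int.cast_natCast,
    ZMod.val_natCast, hk n]
  congr 1
  conv_lhs => rw [← Nat.mod_add_div (k n) (p ^ n), pow_add, pow_mul, (R.ζ_prim n).pow_eq_one,
    one_pow, mul_one]

/-- The function `s_j : Γ → ℤ_p` with `γ (t_j^{p^{-n}}) = ζ_{p^n} ^ (s_j γ) * t_j^{p^{-n}}`. -/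
def RootSystem.s (R : RootSystem p Kbar t) (j : Fin d) (γ : Gam p Kbar t) : ℤ_[p] :=
  Classical.choose (R.exists_kummer j γ)

/-- The embedding `Γ → ℤ_p^× ⋉ ℤ_p^d ⊆ GL_{d+1}(ℚ_p)`, with first row `(χ γ, s_1 γ, …, s_d γ)` and
the remaining rows those of the identity matrix. -/
def RootSystem.toMatrix (R : RootSystem p Kbar t) (γ : Gam p Kbar t) :
    Matrix (Unit ⊕ Fin d) (Unit ⊕ Fin d) ℚ_[p] :=
  Matrix.fromBlocks (fun _ _ => ((chi p Kbar t γ : ℤ_[p]) : ℚ_[p]))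
    (fun _ j => (R.s j γ : ℚ_[p])) 0 1

variable (p d) in
/-- `𝔤 = Lie Γ ≅ ℚ_p ⋉ ℚ_p^d`: the matrices all of whose rows other than the first vanish. -/
def gLie : LieSubalgebra ℚ_[p] (Matrix (Unit ⊕ Fin d) (Unit ⊕ Fin d) ℚ_[p]) where
  carrier := {A | ∀ i j, A (Sum.inr i) j = 0}
  add_mem' := by
    intro A B hA hB i j
    rw [Matrix.add_apply, hA, hB, add_zero]
  zero_mem' := fun i j => rfl
  smul_mem' := by
    intro c A hA i j
    rw [Matrix.smul_apply, hA, smul_zero]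
  lie_mem' := by
    intro A B hA hB i j
    rw [Ring.lie_def, Matrix.sub_apply, Matrix.mul_apply, Matrix.mul_apply]
    rw [Finset.sum_eq_zero fun a _ => by rw [hA i a, zero_mul],
      Finset.sum_eq_zero fun a _ => by rw [hB i a, zero_mul], sub_zero]

theorem RootSystem.log_term_mem (R : RootSystem p Kbar t) (γ : Gam p Kbar t) (n : ℕ) :
    (R.toMatrix γ - 1) ^ (n + 1) ∈ gLie p d := by
  intro i j
  rw [pow_succ', Matrix.mul_apply]
  refine Finset.sum_eq_zero fun a _ => ?_
  have : (R.toMatrix γ - 1) (Sum.inr i) a = 0 := by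
    rw [← Matrix.fromBlocks_one, RootSystem.toMatrix, Matrix.sub_apply]
    cases a with
    | inl a => exact sub_self (0 : ℚ_[p])
    | inr a => exact sub_self ((1 : Matrix (Fin d) (Fin d) ℚ_[p]) i a)
  rw [this, zero_mul]

/-- The logarithm of (the matrix of) `γ`, as the `p`-adic series
`∑ (-1)^n (γ - 1)^(n+1) / (n+1)`. It converges for `χ γ ∈ 1 + p ℤ_p`. -/
def RootSystem.log (R : RootSystem p Kbar t) (γ : Gam p Kbar t) : gLie p d :=
  ⟨∑' n : ℕ, ((-1 : ℚ_[p]) ^ n / (n + 1 : ℚ_[p])) • (R.toMatrix γ - 1) ^ (n + 1), by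
    refine tsum_mem (s := gLie p d) ?_ fun n => (gLie p d).smul_mem _ (R.log_term_mem γ n)
    have : ((gLie p d : LieSubalgebra ℚ_[p] _) : Set (Matrix (Unit ⊕ Fin d) (Unit ⊕ Fin d) ℚ_[p])) =
        ⋂ i, ⋂ j, {A | A (Sum.inr i) j = 0} := by
      ext A; simp only [Set.mem_iInter]; rfl
    rw [this]
    exact isClosed_iInter fun i => isClosed_iInter fun j =>
      isClosed_eq (continuous_id.matrix_elem _ _) continuous_const⟩

variable [Algebra ℚ_[p] K]

variable (p K d) in
/-- `𝔤_K`. -/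
abbrev gK : Type u := K ⊗[ℚ_[p]] gLie p d

variable (p K d) in
/-- The `K`-linear form on `𝔤_K` with `X_0 ↦ 1` and `X_j ↦ 0` for `1 ≤ j ≤ d`. -/
def delta0 : gK p K d →ₗ[K] K :=
  (TensorProduct.AlgebraTensorModule.rid ℚ_[p] K K).toLinearMap ∘ₗ
    LinearMap.baseChange K
      ({ toFun := fun X => (X : Matrix (Unit ⊕ Fin d) (Unit ⊕ Fin d) ℚ_[p]) (Sum.inl ()) (Sum.inl ())
         map_add' := fun _ _ => rfl
         map_smul' := fun _ _ => rfl } : gLie p d →ₗ[ℚ_[p]] ℚ_[p])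

variable (p Kbar t) in
/-- The character `χ`, with values in `K^×`. -/
def chiK : Gam p Kbar t →* Kˣ :=
  (Units.map ((algebraMap ℚ_[p] K).comp (PadicInt.Coe.ringHom (p := p))).toMonoidHom).comp
    (chi p Kbar t)

end Arithmetic

section Functors
variable {p : ℕ} [Fact p.Prime] {K : Type u} [NormedField K] [NormedAlgebra ℚ_[p] K]
  {Kbar : Type v} [Field Kbar] [Algebra K Kbar] {d : ℕ} {t : Fin d → K}

variable (p Kbar t) in
/-- `Rep^ℤ_K Γ`: continuous finite dimensional `K`-linear representations of `Γ` with
Jordan–Hölder factors among the powers `χ ^ n`, `n : ℤ`, of the cyclotomic character. -/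
abbrev RepZGam := (repZ (chiK p Kbar t)).FullSubcategory

variable (p K d) in
/-- `Rep^ℤ 𝔤_K`: finite dimensional representations of `𝔤_K` with Jordan–Hölder factors among the
one-dimensional representations on which `X_0` is an integer `n` and `X_1, …, X_d` are zero. -/
abbrev RepZg := (lieRepZ (delta0 p K d)).FullSubcategory

/-- `F` is the differentiation functor `∂`: up to a monoidal natural isomorphism `e` it keeps the
underlying vector space, and `X : 𝔤` acts by `X v = lim_{a → 0} (exp (a X) v - v) / a`, where
`a : ℤ_p` and where `exp (a X) : Γ` exists for `a` close to `0`. -/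
def IsDifferentiation (R : RootSystem p Kbar t) (F : RepZGam p Kbar t ⥤ RepZg p K d)
    [F.Monoidal] : Prop :=
  ∃ e : F ⋙ lieRepZ.forget (delta0 p K d) ≅ repZ.forget (chiK p Kbar t),
    NatTrans.IsMonoidal e.hom ∧
    ∀ X : gLie p d, ∃ γ : ℤ_[p] → Gam p Kbar t,
      (∀ᶠ a in 𝓝 (0 : ℤ_[p]), R.toMatrix (γ a) =
        NormedSpace.exp ((a : ℚ_[p]) • (X : Matrix (Unit ⊕ Fin d) (Unit ⊕ Fin d) ℚ_[p]))) ∧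
      ∀ V : RepZGam p Kbar t,
        let i : (F.obj V).obj.V ≃ₗ[K] V.obj.V := FGModuleCat.isoToLinearEquiv (e.app V)
        ∀ v : V.obj.V,
          TendstoFD K (fun a : ℤ_[p] => (algebraMap ℚ_[p] K a)⁻¹ • (V.obj.ρ (γ a) v - v)) (𝓝[≠] 0)
            (i ((F.obj V).obj.φ (1 ⊗ₜ X) (i.symm v)))

/-- `F` is the functor `𝕍`: up to a monoidal natural isomorphism `e` it keeps the underlying vector
space, and `γ` acts by the convergent series `exp (log γ) = ∑ (log γ)^n / n!` for all `γ` in the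
open subgroup `χ γ ∈ 1 + 2 p ℤ_p` of `Γ`. -/
def IsExponentiation (R : RootSystem p Kbar t) (F : RepZg p K d ⥤ RepZGam p Kbar t)
    [F.Monoidal] : Prop :=
  ∃ e : F ⋙ repZ.forget (chiK p Kbar t) ≅ lieRepZ.forget (delta0 p K d),
    NatTrans.IsMonoidal e.hom ∧
    ∀ γ : Gam p Kbar t, (2 * p : ℤ_[p]) ∣ (chi p Kbar t γ : ℤ_[p]) - 1 →
      ∀ D : RepZg p K d,
        let i : (F.obj D).obj.V ≃ₗ[K] D.obj.V := FGModuleCat.isoToLinearEquiv (e.app D)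
        ∀ v : D.obj.V,
          HasSumFD K
            (fun n : ℕ => (n.factorial : K)⁻¹ • ((D.obj.φ (1 ⊗ₜ R.log γ)) ^ n) v)
            (i ((F.obj D).obj.ρ γ (i.symm v)))

end Functors
end SenTheory
end
open SenTheory

/-! Both categories are described by the same linear algebra, recorded in `SplitData`: an operator
`S` diagonalizable with integer eigenvalues, a nilpotent `N` and commuting nilpotents `y j`, with
`N` commuting with everything and `[S, y j] = y j`. On the Lie side `X_0` acts as `S + N` and `X_j`
as `y j`. On the group side `(x, r)` in `ℤ_p^× ⋉ ℤ_p^d` acts as `exp (∑ r_j y_j) * x ^ S * exp (log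
x * N)`. Since the weights are integers, `x ^ S` makes sense for every `p`-adic unit `x`, not only
near `1`, and the exponentials of nilpotents are finite sums.

Three inputs are needed.

The group `Γ` must be open in `ℤ_p^× ⋉ ℤ_p^d` (`RootSystem.isAffineGroup`). The cyclotomic character
has infinite image because the valuation of `K` is discrete (`exists_chi_pow_ne_one`), and the
Kummer cocycles are independent modulo coboundaries because the `t_j` reduce to a `p`-basis
(`not_exists_kummer_relation`). Compactness turns these two facts into openness
(`isAffineGroup_of_independent`).

A representation of `𝔤_K` yields data by the Jordan decomposition of `X_0`
(`exists_splitData_of_lie`).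

A representation of `Γ` yields data too (`exists_splitData_of_rep`). A small open subgroup is
topologically generated by one element `g0` with `χ = 1 + p ^ M` and translations `τ j`. The
operator of `g0` has generalized eigenvalues `χ(g0) ^ n`, which are distinct, so its Jordan
decomposition gives `S` and `N`, and the logarithms of the unipotent operators of `τ j` give `y j`.
Agreement on the open subgroup spreads to `Γ` because roots of unipotent operators are unique
(`SplitData.eq_rep_of_eq_on`).

Both functors keep the vector space. A linear map commuting with `Γ` commutes with `𝔤` by passing to
limits along one-parameter subgroups, and conversely because `S` is a polynomial in `S + N`. So the
choice of data is immaterial and all comparison isomorphisms are identities of vector spaces. The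
limit formula is the product rule for the three factors (`SplitData.tendsto_opZ`). The exponential
series is summed by conjugating `(x, r)` to `(x, 0)` by a translation (`SplitData.hasSumFD_opZ`).
Duals are built for `𝔤_K` and transported through the equivalence. -/

noncomputable section
attribute [local instance] LieRing.ofAssociativeRing
namespace SenTheory

/-! ### Exponentials and logarithms in algebras with nilpotent elements. -/

section NilpotentExp
variable (K : Type*) [Field K] {A : Type*} [Ring A] [Algebra K A]

/-- The exponential of a nilpotent element of a `K`-algebra. -/
def nexp (a : A) : A := ∑ i ∈ Finset.range (nilpotencyClass a), ((i.factorial : K)⁻¹) • a ^ i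

/-- Any exponent killing `a` may serve as the cutoff, so several nilpotents can be handled with one
common bound. -/
theorem nexp_eq_sum {a : A} {k : ℕ} (h : a ^ k = 0) :
    nexp K a = ∑ i ∈ Finset.range k, ((i.factorial : K)⁻¹) • a ^ i := by
  have h1 := Finset.sum_range_add_sum_Ico (fun i => ((i.factorial : K)⁻¹) • a ^ i)
    (show nilpotencyClass a ≤ k from csInf_le' h)
  rw [nexp, ← h1, Finset.sum_eq_zero (s := Finset.Ico _ _), add_zero]
  intro i hi
  rw [pow_eq_zero_of_le (Finset.mem_Ico.1 hi).1 (pow_nilpotencyClass ⟨k, h⟩), smul_zero]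

@[simp] theorem nexp_zero : nexp K (0 : A) = 1 := by
  rw [nexp_eq_sum K (pow_one 0)]; simp

variable {K} in
theorem nexp_map {B : Type*} [Ring B] [Algebra K B] (f : A →ₐ[K] B) {a : A} (ha : IsNilpotent a) :
    f (nexp K a) = nexp K (f a) := by
  obtain ⟨k, hk⟩ := ha
  rw [nexp_eq_sum K hk, nexp_eq_sum K (show f a ^ k = 0 by rw [← map_pow, hk, map_zero])]
  simp only [map_sum, map_smul, map_pow]

/-- The exponential of `IsNilpotent.exp` uses rational scalars; these are borrowed from `K`, which
makes its addition formula available. -/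
theorem nexp_eq_exp [CharZero K] (a : A) :
    nexp K a = @IsNilpotent.exp A _ (Module.compHom A (algebraMap ℚ K)) a := by
  unfold nexp IsNilpotent.exp
  refine Finset.sum_congr rfl fun i _ => ?_
  change _ = (algebraMap ℚ K ((i.factorial : ℚ)⁻¹)) • a ^ i
  rw [map_inv₀, map_natCast]

theorem nexp_add [CharZero K] {a b : A} (h : Commute a b) (ha : IsNilpotent a) (hb : IsNilpotent b) :
    nexp K (a + b) = nexp K a * nexp K b := by
  let : Module ℚ A := Module.compHom A (algebraMap ℚ K)
  simp only [nexp_eq_exp]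
  exact IsNilpotent.exp_add_of_commute h ha hb

theorem nexp_mul_neg [CharZero K] {a : A} (ha : IsNilpotent a) : nexp K a * nexp K (-a) = 1 := by
  rw [← nexp_add K (Commute.neg_right rfl) ha ha.neg, add_neg_cancel, nexp_zero]

theorem nexp_neg_mul [CharZero K] {a : A} (ha : IsNilpotent a) : nexp K (-a) * nexp K a = 1 := by
  rw [← nexp_add K (Commute.neg_left rfl) ha.neg ha, neg_add_cancel, nexp_zero]

/-- Exponentials of intertwined nilpotent operators are intertwined. -/
theorem nexp_intertwine {V W : Type*} [AddCommGroup V] [Module K V] [AddCommGroup W] [Module K W]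
    {a : Module.End K V} {b : Module.End K W} (ha : IsNilpotent a) (hb : IsNilpotent b)
    {f : V →ₗ[K] W} (h : b ∘ₗ f = f ∘ₗ a) : nexp K b ∘ₗ f = f ∘ₗ nexp K a := by
  obtain ⟨k, hk⟩ := ha
  obtain ⟨l, hl⟩ := hb
  rw [nexp_eq_sum K (pow_eq_zero_of_le (le_max_left k l) hk),
    nexp_eq_sum K (pow_eq_zero_of_le (le_max_right k l) hl)]
  ext v
  simp only [LinearMap.comp_apply, LinearMap.sum_apply, LinearMap.smul_apply, map_sum, map_smul]
  refine Finset.sum_congr rfl fun i _ => ?_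
  congr 1
  exact LinearMap.congr_fun (Module.End.commute_pow_left_of_commute h i) v

theorem nexp_mul_of_mul_eq {a b x : A} (ha : IsNilpotent a) (hb : IsNilpotent b)
    (h : x * a = b * x) : x * nexp K a = nexp K b * x := by
  obtain ⟨k, hk⟩ := ha
  obtain ⟨l, hl⟩ := hb
  rw [nexp_eq_sum K (pow_eq_zero_of_le (le_max_left k l) hk),
    nexp_eq_sum K (pow_eq_zero_of_le (le_max_right k l) hl), Finset.mul_sum, Finset.sum_mul]
  refine Finset.sum_congr rfl fun i _ => ?_
  rw [mul_smul_comm, smul_mul_assoc]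
  congr 1
  exact (SemiconjBy.pow_right (show SemiconjBy x a b from h) i)

theorem nexp_commute {a x : A} (ha : IsNilpotent a) (h : Commute x a) : Commute x (nexp K a) :=
  nexp_mul_of_mul_eq K ha ha h

/-- The factor `q` is `(exp a - 1) / a = 1 + a / 2 + ...`, which is unipotent and hence a unit.
Injectivity of the exponential rests on this. -/
theorem exists_nexp_sub_one (a : A) (ha : IsNilpotent a) :
    ∃ q ∈ Algebra.adjoin K {a}, nexp K a = 1 + a * q ∧ IsNilpotent (q - 1) := by
  obtain ⟨k, hk⟩ := ha
  have hk' : a ^ (k + 2) = 0 := pow_eq_zero_of_le (by omega) hk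
  have ha' : a ∈ Algebra.adjoin K {a} := Algebra.subset_adjoin rfl
  refine ⟨∑ i ∈ Finset.range (k + 1), ((i + 1).factorial : K)⁻¹ • a ^ i, ?_, ?_, ?_⟩
  · exact Subalgebra.sum_mem _ fun i _ => Subalgebra.smul_mem _ (Subalgebra.pow_mem _ ha' i) _
  · rw [nexp_eq_sum K hk', Finset.sum_range_succ', Finset.mul_sum, add_comm]
    simp [pow_succ']
  · rw [Finset.sum_range_succ']
    simp only [zero_add, Nat.factorial_one, Nat.cast_one, inv_one, pow_zero, one_smul,
      add_sub_cancel_right]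
    have : (∑ x ∈ Finset.range k, ((x + 1 + 1).factorial : K)⁻¹ • a ^ (x + 1)) =
        a * ∑ x ∈ Finset.range k, ((x + 1 + 1).factorial : K)⁻¹ • a ^ x := by
      rw [Finset.mul_sum]
      simp [pow_succ']
    rw [this]
    refine Commute.isNilpotent_mul_right ?_ ⟨k, hk⟩
    exact Commute.sum_right _ _ _ fun i _ => (Commute.pow_right rfl i).smul_right _

variable {K} in
theorem commute_of_mem_adjoin_singleton {a x y : A} (hx : x ∈ Algebra.adjoin K {a})
    (hy : y ∈ Algebra.adjoin K {a}) : Commute x y :=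
  Algebra.commute_of_mem_adjoin_singleton_of_commute hy
    (Algebra.commute_of_mem_adjoin_self hx).symm

theorem nexp_eq_one {a : A} (ha : IsNilpotent a) (h : nexp K a = 1) : a = 0 := by
  obtain ⟨q, _, hq, hn⟩ := exists_nexp_sub_one K a ha
  have hu : IsUnit q := by simpa using hn.isUnit_add_one
  rw [h] at hq
  have : a * q = 0 := by simpa using hq.symm
  exact (hu.mul_left_eq_zero).1 this

theorem nexp_injective_of_commute [CharZero K] {a b : A} (hab : Commute a b) (ha : IsNilpotent a)
    (hb : IsNilpotent b) (h : nexp K a = nexp K b) : a = b := by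
  have h1 : nexp K (a - b) = 1 := by
    rw [sub_eq_add_neg, nexp_add K hab.neg_right ha hb.neg, h, nexp_mul_neg K hb]
  exact sub_eq_zero.1 (nexp_eq_one K (hab.isNilpotent_sub ha hb) h1)

/-- Every unipotent element `1 + n` is the exponential of a nilpotent element of the ideal
generated by `n` in `K[n]`. -/
theorem exists_nexp_eq_one_add [CharZero K] {n : A} (hn : IsNilpotent n) :
    ∃ q ∈ Algebra.adjoin K {n}, nexp K (n * q) = 1 + n := by
  obtain ⟨k, hk⟩ := hn
  -- Induction on the nilpotency exponent `k` of `n * m`: multiplying `1 + n * m` by `exp (-(n *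
  -- m))` leaves `1 + (n * m) ^ 2 * r`, whose nilpotent part has exponent at most `k - 1` once `k ≥
  -- 2`.
  suffices H : ∀ k : ℕ, ∀ m ∈ Algebra.adjoin K {n}, (n * m) ^ k = 0 →
      ∃ q ∈ Algebra.adjoin K {n}, nexp K (n * q) = 1 + n * m by
    simpa using H k 1 (Subalgebra.one_mem _) (by simpa using hk)
  have hn' : n ∈ Algebra.adjoin K {n} := Algebra.subset_adjoin rfl
  have hnil : IsNilpotent n := ⟨k, hk⟩
  have hcomm : ∀ x ∈ Algebra.adjoin K {n}, ∀ y ∈ Algebra.adjoin K {n}, Commute x y :=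
    fun x hx y hy => commute_of_mem_adjoin_singleton hx hy
  have hnm : ∀ m ∈ Algebra.adjoin K {n}, IsNilpotent (n * m) := fun m hm =>
    (hcomm n hn' m hm).isNilpotent_mul_right hnil
  intro k
  induction k using Nat.strong_induction_on with
  | _ k ih =>
    intro m hm hk
    have hnm' : n * m ∈ Algebra.adjoin K {n} := Subalgebra.mul_mem _ hn' hm
    by_cases hk1 : k ≤ 1
    · have h0 : n * m = 0 := by simpa using pow_eq_zero_of_le hk1 hk
      exact ⟨0, Subalgebra.zero_mem _, by rw [mul_zero, nexp_zero, h0, add_zero]⟩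
    -- `(1 + x) exp (-x) = 1 + x ^ 2 r`
    obtain ⟨r, hr, hxr⟩ : ∃ r ∈ Algebra.adjoin K {n},
        (1 + n * m) * nexp K (-(n * m)) = 1 + n * (m * (n * m) * r) := by
      set x := n * m with hx
      obtain ⟨k', hk'⟩ := (hnm m hm).neg
      have hk2 : (-x) ^ (k' + 2) = 0 := pow_eq_zero_of_le (by omega) hk'
      have hs : ∃ t ∈ Algebra.adjoin K {n}, nexp K (-x) = 1 - x + x * x * t := by
        refine ⟨∑ i ∈ Finset.range k', ((i + 2).factorial : K)⁻¹ • (-x) ^ i, ?_, ?_⟩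
        · exact Subalgebra.sum_mem _ fun i _ => Subalgebra.smul_mem _
            (Subalgebra.pow_mem _ (Subalgebra.neg_mem _ hnm') i) _
        · rw [nexp_eq_sum K hk2, Finset.sum_range_succ', Finset.sum_range_succ', Finset.mul_sum]
          have : ∀ i, (-x) ^ (i + 1 + 1) = x * x * (-x) ^ i := fun i => by
            rw [pow_succ', pow_succ', ← mul_assoc, neg_mul_neg]
          simp only [this, mul_smul_comm]
          simp
          abel
      obtain ⟨t, ht, hs⟩ := hs
      -- From `(1 + x) * (1 - x + x² t) = 1 + x² (t + x t - 1)`.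
      refine ⟨t + x * t - 1, ?_, ?_⟩
      · exact Subalgebra.sub_mem _ (Subalgebra.add_mem _ ht (Subalgebra.mul_mem _ hnm' ht))
          (Subalgebra.one_mem _)
      · rw [hs]
        calc _ = 1 + x * (x * (t + x * t - 1)) := by noncomm_ring
          _ = _ := by rw [hx]; noncomm_ring
    have hmem : m * (n * m) * r ∈ Algebra.adjoin K {n} :=
      Subalgebra.mul_mem _ (Subalgebra.mul_mem _ hm hnm') hr
    have hpow : (n * (m * (n * m) * r)) ^ (k - 1) = 0 := by
      have e : n * (m * (n * m) * r) = (n * m) ^ 2 * r := by rw [pow_two]; noncomm_ring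
      have hc : Commute ((n * m) ^ 2) r := (hcomm _ hnm' _ hr).pow_left 2
      rw [e, hc.mul_pow, ← pow_mul, pow_eq_zero_of_le (by omega) hk, zero_mul]
    obtain ⟨q, hq, hq'⟩ := ih (k - 1) (by omega) _ hmem hpow
    refine ⟨m + q, Subalgebra.add_mem _ hm hq, ?_⟩
    have hc1 : Commute (n * m) (n * q) := hcomm _ hnm' _ (Subalgebra.mul_mem _ hn' hq)
    rw [mul_add, add_comm (n * m), nexp_add K hc1.symm (hnm q hq) (hnm m hm), hq', ← hxr,
      mul_assoc, nexp_neg_mul K (hnm m hm), mul_one]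

end NilpotentExp

/-! ### Operators diagonalizable with integer eigenvalues and their functional calculus. -/

section IntDiag
variable {K : Type*} [Field K] {V W : Type*} [AddCommGroup V] [Module K V] [AddCommGroup W]
  [Module K W]

/-- `S` is diagonalizable with integral eigenvalues. -/
def IsIntDiag (S : Module.End K V) : Prop :=
  Submodule.span K {v | ∃ n : ℤ, S v = (n : K) • v} = ⊤

theorem IsIntDiag.ext {S : Module.End K V} (hS : IsIntDiag S) {f g : V →ₗ[K] W}
    (h : ∀ (n : ℤ) (v : V), S v = (n : K) • v → f v = g v) : f = g :=
  LinearMap.ext_on hS fun v ⟨n, hn⟩ => h n v hn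

theorem IsIntDiag.zero : IsIntDiag (0 : Module.End K V) := by
  rw [IsIntDiag, eq_top_iff]
  exact fun v _ => Submodule.subset_span ⟨0, by simp⟩

theorem IsIntDiag.tensor {S : Module.End K V} {S' : Module.End K W} (hS : IsIntDiag S)
    (hS' : IsIntDiag S') : IsIntDiag (S.rTensor W + S'.lTensor V) := by
  rw [IsIntDiag, eq_top_iff, ← TensorProduct.map₂_mk_top_top_eq_top, ← hS, ← hS',
    Submodule.map₂_span_span, Submodule.span_le]
  rintro _ ⟨a, ⟨n, hn⟩, b, ⟨m, hm⟩, rfl⟩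
  refine Submodule.subset_span ⟨n + m, ?_⟩
  simp [hn, hm, TensorProduct.smul_tmul', add_smul]

theorem aeval_apply_of_eigen (S : Module.End K V) {c : K} {v : V} (h : S v = c • v)
    (P : Polynomial K) : Polynomial.aeval S P v = P.eval c • v := by
  by_cases hv : v = 0
  · simp [hv]
  · exact Module.End.aeval_apply_of_hasEigenvector ⟨Module.End.mem_eigenspace_iff.2 h, hv⟩

variable [FiniteDimensional K V] [CharZero K]

theorem finite_intWeights (S : Module.End K V) : {n : ℤ | S.HasEigenvalue (n : K)}.Finite :=
  (Module.End.finite_hasEigenvalue S).preimage (Int.cast_injective.injOn)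

/-- The integers that are eigenvalues of `S`. -/
def intWeights (S : Module.End K V) : Finset ℤ := (finite_intWeights S).toFinset

theorem mem_intWeights {S : Module.End K V} {n : ℤ} {v : V} (h : S v = (n : K) • v) (hv : v ≠ 0) :
    n ∈ intWeights S :=
  (finite_intWeights S).mem_toFinset.2
    (Module.End.hasEigenvalue_of_hasEigenvector ⟨Module.End.mem_eigenspace_iff.2 h, hv⟩)

/-- The projection to the eigenspace of the integer `n`. -/
def intProj (S : Module.End K V) (n : ℤ) : Module.End K V :=
  Polynomial.aeval S (Lagrange.basis (intWeights S) (fun m : ℤ => (m : K)) n)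

/-- The operator which is multiplication by `g n` on the eigenspace of the integer `n`. -/
def intFun (S : Module.End K V) (g : ℤ → K) : Module.End K V :=
  ∑ n ∈ intWeights S, g n • intProj S n

theorem intFun_apply {S : Module.End K V} {n : ℤ} {v : V} (h : S v = (n : K) • v) (g : ℤ → K) :
    intFun S g v = g n • v := by
  by_cases hv : v = 0
  · simp [hv]
  have hn := mem_intWeights h hv
  have hinj : Set.InjOn (fun m : ℤ => (m : K)) (intWeights S) := Int.cast_injective.injOn
  rw [intFun, LinearMap.sum_apply, Finset.sum_eq_single n]
  · rw [LinearMap.smul_apply, intProj, aeval_apply_of_eigen S h,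
      Lagrange.eval_basis_self hinj hn, one_smul]
  · intro m _ hmn
    rw [LinearMap.smul_apply, intProj, aeval_apply_of_eigen S h,
      Lagrange.eval_basis_of_ne hmn hn, zero_smul, smul_zero]
  · exact fun h => absurd hn h

/-- Being a polynomial in `S`, the operator commutes with whatever commutes with `S` and acts in a
controlled way on every stable subquotient. -/
theorem intFun_eq_aeval (S : Module.End K V) (g : ℤ → K) :
    ∃ P : Polynomial K, intFun S g = Polynomial.aeval S P :=
  ⟨∑ n ∈ intWeights S, Polynomial.C (g n) * Lagrange.basis (intWeights S) (fun m : ℤ => (m : K)) n,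
    by simp only [intFun, intProj, map_sum, map_mul, Polynomial.aeval_C, Algebra.smul_def]⟩

theorem intFun_commute {S T : Module.End K V} (h : Commute S T) (g : ℤ → K) :
    Commute (intFun S g) T := by
  obtain ⟨P, hP⟩ := intFun_eq_aeval S g
  rw [hP]
  exact (Algebra.commute_of_mem_adjoin_singleton_of_commute
    (Polynomial.aeval_mem_adjoin_singleton K S) h.symm).symm

theorem IsIntDiag.intFun_mul {S : Module.End K V} (hS : IsIntDiag S) (g h : ℤ → K) :
    intFun S (fun n => g n * h n) = intFun S g * intFun S h :=
  hS.ext fun n v hv => by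
    rw [Module.End.mul_apply, intFun_apply hv, intFun_apply hv, map_smul, intFun_apply hv,
      smul_smul, mul_comm]

theorem IsIntDiag.intFun_one {S : Module.End K V} (hS : IsIntDiag S) :
    intFun S (fun _ => 1) = 1 :=
  hS.ext fun n v hv => by rw [intFun_apply hv, one_smul]; rfl

theorem IsIntDiag.intFun_cast {S : Module.End K V} (hS : IsIntDiag S) :
    intFun S (fun n => (n : K)) = S :=
  hS.ext fun n v hv => by rw [intFun_apply hv, hv]

/-- The map `f` raises the weight by `k`. The case `k = 0` is that of morphisms, `k = 1` that of the
nilpotents `y j`. -/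
theorem IsIntDiag.intFun_intertwine [FiniteDimensional K W] {S : Module.End K V}
    {S' : Module.End K W} (hS : IsIntDiag S) {f : V →ₗ[K] W} (k : ℤ)
    (h : S' ∘ₗ f = f ∘ₗ S + (k : K) • f) (g : ℤ → K) :
    intFun S' g ∘ₗ f = f ∘ₗ intFun S (fun n => g (n + k)) :=
  hS.ext fun n v hv => by
    have h1 : S' (f v) = ((n + k : ℤ) : K) • f v := by
      have := LinearMap.congr_fun h v
      simp only [LinearMap.comp_apply, LinearMap.add_apply, LinearMap.smul_apply, hv,
        map_smul] at this
      rw [this, Int.cast_add, add_smul]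
    rw [LinearMap.comp_apply, LinearMap.comp_apply, intFun_apply h1, intFun_apply hv, map_smul]

/-- A generalized eigenvector of a diagonalizable operator is an eigenvector: `S - n` is invertible
off its kernel, so `(S - n) ^ k v = 0` forces the component of `v` outside the kernel to vanish. -/
theorem IsIntDiag.apply_eq_of_pow {S : Module.End K V} (hS : IsIntDiag S) {n : ℤ} {k : ℕ} {v : V}
    (h : ((S - (n : K) • 1) ^ k) v = 0) : S v = (n : K) • v := by
  -- an inverse of `S - n` on the complement of the eigenspace of `n`
  set e := intFun S (fun m => if m = n then 1 else 0)
  set r := intFun S (fun m => ((m : K) - n)⁻¹)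
  have he : (S - (n : K) • 1) * e = 0 := hS.ext fun m v hv => by
    rw [Module.End.mul_apply, intFun_apply hv]
    split_ifs with hm
    · simp [hv, hm]
    · simp
  have hr : r * (S - (n : K) • 1) = 1 - e := hS.ext fun m v hv => by
    rw [Module.End.mul_apply, LinearMap.sub_apply, LinearMap.sub_apply, intFun_apply hv,
      LinearMap.smul_apply, hv, Module.End.one_apply, ← sub_smul, map_smul, intFun_apply hv,
      smul_smul]
    split_ifs with hm
    · simp [hm]
    · rw [mul_inv_cancel₀ (sub_ne_zero.2 (by exact_mod_cast hm))]; simp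
  have hcomm : Commute r (S - (n : K) • 1) :=
    intFun_commute ((Commute.refl S).sub_right ((Commute.one_right S).smul_right _)) _
  have h1 : ((1 - e) ^ k) v = 0 := by
    rw [← hr, hcomm.mul_pow, Module.End.mul_apply, h, map_zero]
  have he2 : e * e = e := by
    rw [← hS.intFun_mul]
    congr 1; funext m; split_ifs <;> simp
  have h2 : (1 - e) v = 0 := by
    cases k with
    | zero => rw [pow_zero, Module.End.one_apply] at h1; rw [h1, map_zero]
    | succ k =>
      have : IsIdempotentElem (1 - e) := IsIdempotentElem.one_sub (show e * e = e from he2)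
      rwa [this.pow_succ_eq] at h1
  have h3 : v = e v := sub_eq_zero.1 h2
  have h4 : (S - (n : K) • 1) v = 0 := by
    rw [h3, ← Module.End.mul_apply, he]; rfl
  simpa [sub_eq_zero] using h4

end IntDiag

/-! ### The semisimple part as a polynomial. -/

section JordanDecomposition
variable {K : Type*} [Field K] {V : Type*} [AddCommGroup V] [Module K V] [FiniteDimensional K V]

/-- If `V` is the sum of the generalized eigenspaces of `A` for the values `c n`, some polynomial in
`A` is multiplication by `n` on that of `c n`. -/
theorem exists_mem_adjoin_smul_on_maxGenEigenspace (A : Module.End K V) {c : ℤ → K}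
    (hc : Function.Injective c) :
    ∃ P : Polynomial K, ∀ (n : ℤ), ∀ v ∈ A.maxGenEigenspace (c n),
      Polynomial.aeval A P v = (n : K) • v := by
  have hfin : {n : ℤ | A.HasEigenvalue (c n)}.Finite :=
    (Module.End.finite_hasEigenvalue A).preimage hc.injOn
  set r := Module.finrank K V
  -- Chinese remainder theorem: `P` is congruent to the constant `n` modulo `(X - c n) ^ r`, for the
  -- finitely many `n` that occur. The exponent `r = dim V` is large enough to annihilate the
  -- generalized eigenspaces.
  obtain ⟨P, hP⟩ := Ideal.exists_forall_sub_mem_ideal (ι := hfin.toFinset)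
    (I := fun n => Ideal.span {(Polynomial.X - Polynomial.C (c n)) ^ r})
    (fun i j hij => by
      rw [Function.onFun, Ideal.isCoprime_span_singleton_iff]
      exact (Polynomial.pairwise_coprime_X_sub_C hc (Subtype.coe_injective.ne hij)).pow)
    (fun n => Polynomial.C ((n : ℤ) : K))
  refine ⟨P, fun n v hv => ?_⟩
  by_cases hv0 : v = 0
  · simp [hv0]
  have hev : A.HasEigenvalue (c n) := by
    refine Module.End.hasEigenvalue_of_hasGenEigenvalue (k := r) ?_
    rw [Module.End.maxGenEigenspace_eq_genEigenspace_finrank] at hv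
    rw [Module.End.hasGenEigenvalue_iff]
    exact fun h => hv0 (by rwa [h, Submodule.mem_bot] at hv)
  obtain ⟨Q, hQ⟩ := Ideal.mem_span_singleton'.1 (hP ⟨n, hfin.mem_toFinset.2 hev⟩)
  have h1 : ((A - c n • 1) ^ r) v = 0 := by
    rw [Module.End.maxGenEigenspace_eq_genEigenspace_finrank] at hv
    simpa [Module.End.mem_genEigenspace_nat] using hv
  have h2 : Polynomial.aeval A (P - Polynomial.C (n : K)) v = 0 := by
    rw [← hQ, map_mul, Module.End.mul_apply, map_pow, map_sub, Polynomial.aeval_X,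
      Polynomial.aeval_C, Algebra.algebraMap_eq_smul_one, h1, map_zero]
  rwa [map_sub, LinearMap.sub_apply, sub_eq_zero, Polynomial.aeval_C,
    Module.algebraMap_end_apply] at h2

end JordanDecomposition

/-! ### Operators acting by scalars on the steps of a flag. -/

section Flags
variable {K : Type*} [Field K] {V : Type*} [AddCommGroup V] [Module K V] {S S' : Type*}

/-- The condition on Jordan–Hölder factors passes between the group and the Lie algebra in this way:
one flag serves both actions. -/
theorem IsIteratedExtension.transfer {act : S → Module.End K V} {c : ℤ → S → K}
    {act' : S' → Module.End K V} {c' : ℤ → S' → K}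
    (H : ∀ (A B : Submodule K V) (n : ℤ), A ≤ B → (∀ s, ∀ v ∈ A, act s v ∈ A) →
      (∀ s, ∀ v ∈ B, act s v ∈ B) → (∀ s, ∀ v ∈ B, act s v - c n s • v ∈ A) →
      ∀ s, ∀ v ∈ B, act' s v - c' n s • v ∈ A) {A : Submodule K V}
    (h : IsIteratedExtension act c A) : IsIteratedExtension act' c' A := by
  induction h with
  | bot => exact .bot
  | @step A B n hA hAB h ih =>
    exact .step n ih hAB (H A B n hAB hA.stable (IsIteratedExtension.step n hA hAB h).stable h)

/-- An operator that pushes every step of a flag into the preceding one dies after as many powers as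
there are steps. -/
theorem IsIteratedExtension.isNilpotent {act : S → Module.End K V} {c : ℤ → S → K}
    {T : Module.End K V}
    (H : ∀ (A B : Submodule K V) (n : ℤ), A ≤ B → (∀ s, ∀ v ∈ A, act s v ∈ A) →
      (∀ s, ∀ v ∈ B, act s v ∈ B) → (∀ s, ∀ v ∈ B, act s v - c n s • v ∈ A) →
      ∀ v ∈ B, T v ∈ A) (h : IsIteratedExtension act c ⊤) : IsNilpotent T := by
  suffices key : ∀ A : Submodule K V, IsIteratedExtension act c A →
      ∃ k : ℕ, ∀ v ∈ A, (T ^ k) v = 0 by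
    obtain ⟨k, hk⟩ := key ⊤ h
    exact ⟨k, LinearMap.ext fun v => hk v trivial⟩
  intro A hA
  induction hA with
  | bot => exact ⟨0, fun v hv => by simpa using hv⟩
  | @step A B n hA hAB h ih =>
    obtain ⟨k, hk⟩ := ih
    refine ⟨k + 1, fun v hv => ?_⟩
    rw [pow_succ, Module.End.mul_apply]
    exact hk _ (H A B n hAB hA.stable (IsIteratedExtension.step n hA hAB h).stable h v hv)

theorem mem_maxGenEigenspace_of_sub_mem {T : Module.End K V} {μ : K} {v : V}
    (h : T v - μ • v ∈ T.maxGenEigenspace μ) : v ∈ T.maxGenEigenspace μ := by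
  rw [Module.End.mem_maxGenEigenspace] at h ⊢
  obtain ⟨k, hk⟩ := h
  exact ⟨k + 1, by rw [pow_succ, Module.End.mul_apply]; simpa using hk⟩

/-- For `v` in a step of weight `n`, the vector `(T - c n) v` lies in the sum of generalized
eigenspaces already treated. Off the eigenvalue `c n` the operator `T - c n` is invertible there, so
after subtracting a suitable `g` only the component at `c n` remains, and `v - g` is a generalized
eigenvector. -/
theorem IsIteratedExtension.iSup_maxGenEigenspace {act : S → Module.End K V} {c : ℤ → S → K}
    {A : Submodule K V} (h : IsIteratedExtension act c A) (s : S)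
    (hc : Function.Injective fun n => c n s) :
    A ≤ ⨆ n, (act s).maxGenEigenspace (c n s) := by
  induction h with
  | bot => exact bot_le
  | @step A B n hA hAB h ih =>
    intro v hv
    set T := act s
    have key : ∀ w ∈ ⨆ n, T.maxGenEigenspace (c n s), ∃ g ∈ ⨆ n, T.maxGenEigenspace (c n s),
        w - (T g - c n s • g) ∈ T.maxGenEigenspace (c n s) := by
      intro w hw
      induction hw using Submodule.iSup_induction' with
      | zero => exact ⟨0, Submodule.zero_mem _, by simp⟩
      | add x y _ _ hx hy =>
        obtain ⟨g, hg, hg'⟩ := hx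
        obtain ⟨g', hg2, hg2'⟩ := hy
        refine ⟨g + g', Submodule.add_mem _ hg hg2, ?_⟩
        convert Submodule.add_mem _ hg' hg2' using 1
        rw [map_add, smul_add]; abel
      | mem m x hx =>
        by_cases hmn : m = n
        · exact ⟨0, Submodule.zero_mem _, by simpa [hmn] using hx⟩
        obtain ⟨k, hk⟩ := (Module.End.mem_maxGenEigenspace _ _ _).1 hx
        -- The Bézout coefficient `a` of `X - c n` gives the inverse `a(T)` of `T - c n` on vectors
        -- killed by `(T - c m) ^ k`.
        have hco : IsCoprime (Polynomial.X - Polynomial.C (c n s))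
            ((Polynomial.X - Polynomial.C (c m s)) ^ k) :=
          (Polynomial.pairwise_coprime_X_sub_C hc (Ne.symm hmn)).pow_right
        obtain ⟨a, b, hab⟩ := hco
        have h1 := LinearMap.congr_fun (congrArg (Polynomial.aeval T) hab) x
        simp only [map_add, map_mul, map_sub, map_pow, Polynomial.aeval_X, Polynomial.aeval_C,
          Algebra.algebraMap_eq_smul_one, LinearMap.add_apply, Module.End.mul_apply, hk, map_zero,
          add_zero, map_one, Module.End.one_apply] at h1
        refine ⟨Polynomial.aeval T a x, Submodule.mem_iSup_of_mem m ?_, ?_⟩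
        · exact Module.End.mapsTo_maxGenEigenspace_of_comm
            (Algebra.commute_of_mem_adjoin_self
              (Polynomial.aeval_mem_adjoin_singleton K T)) _ hx
        · have h2 : Commute (Polynomial.aeval T a) (T - c n s • 1) :=
            ((Algebra.commute_of_mem_adjoin_self
              (Polynomial.aeval_mem_adjoin_singleton K T)).symm).sub_right
                ((Commute.one_right _).smul_right _)
          have h3 := LinearMap.congr_fun h2.eq x
          rw [Module.End.mul_apply, h1, Module.End.mul_apply] at h3
          have h4 : x - (T (Polynomial.aeval T a x) - c n s • Polynomial.aeval T a x) = 0 := by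
            rw [sub_eq_zero]; simpa using h3
          rw [h4]; exact Submodule.zero_mem _
    obtain ⟨g, hg, hg'⟩ := key _ (ih (h s v hv))
    have h5 : v - g ∈ T.maxGenEigenspace (c n s) := by
      refine mem_maxGenEigenspace_of_sub_mem ?_
      convert hg' using 1
      rw [map_sub, smul_sub]; abel
    have := Submodule.add_mem _ (Submodule.mem_iSup_of_mem n h5) hg
    rwa [sub_add_cancel] at this

/-- Polynomials in an operator that is a scalar on `B / A`. -/
theorem aeval_sub_mem {T : Module.End K V} {A B : Submodule K V} {μ : K} (hAB : A ≤ B)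
    (h : ∀ v ∈ B, T v - μ • v ∈ A) (P : Polynomial K) :
    ∀ v ∈ B, Polynomial.aeval T P v - P.eval μ • v ∈ A := by
  have hB : ∀ v ∈ B, T v ∈ B := fun v hv => by
    have := B.add_mem (hAB (h v hv)) (B.smul_mem μ hv)
    rwa [sub_add_cancel] at this
  intro v hv
  induction P using Polynomial.induction_on' with
  | add p q hp hq =>
    convert A.add_mem hp hq using 1
    rw [map_add, Polynomial.eval_add, add_smul, LinearMap.add_apply]; abel
  | monomial n a =>
    rw [Polynomial.aeval_monomial, Polynomial.eval_monomial, Module.End.mul_apply,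
      Module.algebraMap_end_apply, mul_smul, ← smul_sub]
    refine A.smul_mem a ?_
    clear a
    suffices H : (T ^ n) v ∈ B ∧ (T ^ n) v - μ ^ n • v ∈ A from H.2
    induction n with
    | zero => simpa using hv
    | succ n ih =>
      rw [pow_succ', Module.End.mul_apply]
      refine ⟨hB _ ih.1, ?_⟩
      have := A.add_mem (h _ ih.1) (A.smul_mem μ ih.2)
      convert this using 1
      rw [pow_succ', mul_smul, smul_sub]; abel

/-- Here `T - μ` is injective and sends `B` into `A ≤ B`, so its image has the dimension of `B` and
fills `B`. This disposes of degenerate steps with `A = B`, whose label need not be an eigenvalue. -/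
theorem le_of_not_hasEigenvalue [FiniteDimensional K V] {T : Module.End K V}
    {A B : Submodule K V} {μ : K} (hAB : A ≤ B) (h : ∀ v ∈ B, T v - μ • v ∈ A)
    (hμ : ¬ T.HasEigenvalue μ) : B ≤ A := by
  have hinj : Function.Injective (T - μ • (1 : Module.End K V)) := by
    rw [← LinearMap.ker_eq_bot]
    rw [Module.End.hasEigenvalue_iff, not_not, Module.End.eigenspace_def] at hμ
    rwa [← Algebra.algebraMap_eq_smul_one]
  have hle : B.map (T - μ • (1 : Module.End K V)) ≤ A := by
    rintro _ ⟨v, hv, rfl⟩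
    simpa using h v hv
  have hr : Module.finrank K (B.map (T - μ • (1 : Module.End K V))) = Module.finrank K B :=
    (Submodule.equivMapOfInjective _ hinj B).finrank_eq.symm
  have := Submodule.eq_of_le_of_finrank_le (hle.trans hAB) hr.ge
  exact this ▸ hle

/-- If `P(T)` is multiplication by `n` on the generalized eigenspace of `T` for `μ`, it is
multiplication by `n` on `B / A` when `T` is multiplication by `μ` there. -/
theorem aeval_sub_mem_of_maxGenEigenspace [FiniteDimensional K V] {T : Module.End K V}
    {A B : Submodule K V} {μ n : K} (hAB : A ≤ B)
    (h : ∀ v ∈ B, T v - μ • v ∈ A) {P : Polynomial K}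
    (hP : ∀ v ∈ T.maxGenEigenspace μ, Polynomial.aeval T P v = n • v) :
    ∀ v ∈ B, Polynomial.aeval T P v - n • v ∈ A := by
  -- If `μ` is an eigenvalue, an eigenvector forces `n = P(μ)`. Otherwise `B ≤ A` and the scalar is
  -- irrelevant.
  by_cases hμ : T.HasEigenvalue μ
  · obtain ⟨v, hv⟩ := hμ.exists_hasEigenvector
    have h1 := aeval_apply_of_eigen T hv.apply_eq_smul P
    have h2 : v ∈ T.maxGenEigenspace μ :=
      mem_maxGenEigenspace_of_sub_mem (by rw [hv.apply_eq_smul, sub_self]; exact zero_mem _)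
    rw [hP v h2] at h1
    have h3 : n = P.eval μ := by
      have : (n - P.eval μ) • v = 0 := by rw [sub_smul, h1, sub_self]
      exact sub_eq_zero.1 ((smul_eq_zero.1 this).resolve_right hv.2)
    rw [h3]
    exact aeval_sub_mem hAB h P
  · have hBA := le_of_not_hasEigenvalue hAB h hμ
    intro v hv
    have := aeval_sub_mem hAB h P v hv
    have h4 := A.add_mem this (A.smul_mem (P.eval μ - n) (hBA hv))
    convert h4 using 1
    rw [sub_smul]; abel

end Flags

/-! ### The p-adic exponential and logarithm on the disc `|z| ≤ |2p|`. -/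

section PadicExpLog
variable {p : ℕ} [hp : Fact p.Prime]

/-- This radius treats all primes at once: `1 / p` is inside the disc of convergence of the
exponential for odd `p`, but `1 / 2` is not for `p = 2`, where `1 / 4` is needed. -/
theorem norm_two_mul_p_eq : ‖(2 * p : ℚ_[p])‖ = if p = 2 then (4 : ℝ)⁻¹ else (p : ℝ)⁻¹ := by
  split_ifs with h
  · subst h
    rw [show (2 * (2 : ℕ) : ℚ_[2]) = ((2 : ℕ) : ℚ_[2]) * ((2 : ℕ) : ℚ_[2]) by norm_num, norm_mul,
      Padic.norm_p]
    norm_num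
  · rw [norm_mul, Padic.norm_p]
    have : ‖((2 : ℕ) : ℚ_[p])‖ = 1 := by
      rw [Padic.norm_natCast_eq_one_iff]
      exact (Nat.coprime_primes hp.out Nat.prime_two).2 h
    rw [show (2 : ℚ_[p]) = ((2 : ℕ) : ℚ_[p]) by norm_num, this, one_mul]

theorem three_le_of_ne_two (h : p ≠ 2) : 3 ≤ p := by
  have := hp.out.two_le
  omega

theorem norm_two_mul_p_le : ‖(2 * p : ℚ_[p])‖ ≤ 3⁻¹ := by
  rw [norm_two_mul_p_eq]
  split_ifs with h
  · norm_num
  · have : (3 : ℝ) ≤ p := by exact_mod_cast three_le_of_ne_two h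
    gcongr

theorem norm_two_mul_p_pos : 0 < ‖(2 * p : ℚ_[p])‖ := by
  rw [norm_pos_iff]
  exact mul_ne_zero two_ne_zero (by exact_mod_cast hp.out.ne_zero)

theorem inv_norm_natCast_le {n : ℕ} (hn : n ≠ 0) : ‖(n : ℚ_[p])‖⁻¹ ≤ n := by
  have h0 : (n : ℚ_[p]) ≠ 0 := by exact_mod_cast hn
  rw [Padic.norm_eq_zpow_neg_valuation h0, Padic.valuation_natCast, zpow_neg, inv_inv, zpow_natCast]
  exact_mod_cast Nat.le_of_dvd (Nat.pos_of_ne_zero hn) pow_padicValNat_dvd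

theorem norm_factorial (n : ℕ) :
    ‖(n.factorial : ℚ_[p])‖⁻¹ = (p : ℝ) ^ padicValNat p n.factorial := by
  have h0 : (n.factorial : ℚ_[p]) ≠ 0 := by exact_mod_cast n.factorial_ne_zero
  rw [Padic.norm_eq_zpow_neg_valuation h0, Padic.valuation_natCast, zpow_neg, inv_inv, zpow_natCast]

/-- The terms of the exponential series are dominated by a geometric series. -/
theorem norm_expTerm_le {z : ℚ_[p]} (hz : ‖z‖ ≤ ‖(2 * p : ℚ_[p])‖) (n : ℕ) :
    ‖(n.factorial : ℚ_[p])⁻¹ * z ^ n‖ ≤ Real.sqrt 2⁻¹ ^ n := by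
  have hp1 : (1 : ℝ) ≤ p := by exact_mod_cast hp.out.one_le
  have hp2 : (2 : ℝ) ≤ p := by exact_mod_cast hp.out.two_le
  -- The squares are compared: for odd `p` Legendre's formula gives `2 v_p(n!) ≤ n`, so squaring
  -- avoids half-integral exponents.
  refine (abs_le_of_sq_le_sq' ?_ (by positivity)).2
  rw [← pow_mul, mul_comm n 2, pow_mul, Real.sq_sqrt (by norm_num), norm_mul, norm_inv,
    norm_factorial, norm_pow]
  have h1 : ((p : ℝ) ^ padicValNat p n.factorial * ‖z‖ ^ n) ^ 2 ≤
      ((p : ℝ) ^ padicValNat p n.factorial * ‖(2 * p : ℚ_[p])‖ ^ n) ^ 2 := by gcongr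
  refine h1.trans ?_
  rw [norm_two_mul_p_eq]
  have hleg := sub_one_mul_padicValNat_factorial (p := p) n
  set v := padicValNat p n.factorial
  split_ifs with h
  · subst h
    have hv : v ≤ n := by norm_num at hleg; omega
    have : ((2 : ℕ) : ℝ) ^ v ≤ 2 ^ n := by
      push_cast; exact pow_le_pow_right₀ (by norm_num) hv
    calc _ ≤ ((2 : ℝ) ^ n * (4 : ℝ)⁻¹ ^ n) ^ 2 := by gcongr
      _ = ((4 : ℝ)⁻¹) ^ n := by
        rw [← mul_pow, ← pow_mul, mul_comm n 2, pow_mul]; norm_num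
      _ ≤ _ := by gcongr; norm_num
  · have h3 := three_le_of_ne_two h
    have hv : v * 2 ≤ n := by
      have : 2 * v ≤ (p - 1) * v := Nat.mul_le_mul_right v (by omega)
      omega
    rw [mul_pow, ← pow_mul]
    calc (p : ℝ) ^ (v * 2) * ((p : ℝ)⁻¹ ^ n) ^ 2 ≤ (p : ℝ) ^ n * ((p : ℝ)⁻¹ ^ n) ^ 2 := by
          gcongr
      _ = (p : ℝ)⁻¹ ^ n := by
          have : (p : ℝ) ≠ 0 := by positivity
          rw [pow_two, ← mul_assoc, ← mul_pow, mul_inv_cancel₀ this, one_pow, one_mul]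
      _ ≤ _ := by gcongr

/-- Since `v_p((n + 1)!) ≤ n` and `p |2p| ≤ 1`, each factor of `z` beyond the first pays for one
factor `p` of the denominator. Hence the exponential maps the disc to `1 + 2p ℤ_p`. -/
theorem norm_expTerm_succ_le {z : ℚ_[p]} (hz : ‖z‖ ≤ ‖(2 * p : ℚ_[p])‖) (n : ℕ) :
    ‖((n + 1).factorial : ℚ_[p])⁻¹ * z ^ (n + 1)‖ ≤ ‖(2 * p : ℚ_[p])‖ := by
  have hp1 : (1 : ℝ) ≤ p := by exact_mod_cast hp.out.one_le
  have hv : padicValNat p (n + 1).factorial ≤ n :=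
    Nat.lt_succ_iff.1 (padicValNat_factorial_lt_of_ne_zero p n.succ_ne_zero)
  have hle : (p : ℝ) * ‖(2 * p : ℚ_[p])‖ ≤ 1 := by
    rw [norm_two_mul_p_eq]
    split_ifs with h
    · subst h; norm_num
    · rw [mul_inv_cancel₀ (by positivity)]
  rw [norm_mul, norm_inv, norm_factorial, norm_pow]
  calc _ ≤ (p : ℝ) ^ n * ‖(2 * p : ℚ_[p])‖ ^ (n + 1) := by gcongr
    _ = ((p : ℝ) * ‖(2 * p : ℚ_[p])‖) ^ n * ‖(2 * p : ℚ_[p])‖ := by rw [mul_pow]; ring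
    _ ≤ 1 * ‖(2 * p : ℚ_[p])‖ := by
        gcongr
        exact pow_le_one₀ (by positivity) hle
    _ = _ := one_mul _

theorem sqrt_half_lt_one : Real.sqrt 2⁻¹ < 1 := by
  rw [Real.sqrt_lt' one_pos]; norm_num

theorem summable_norm_expTerm {z : ℚ_[p]} (hz : ‖z‖ ≤ ‖(2 * p : ℚ_[p])‖) :
    Summable fun n : ℕ => ‖(n.factorial : ℚ_[p])⁻¹ * z ^ n‖ :=
  Summable.of_nonneg_of_le (fun _ => norm_nonneg _) (norm_expTerm_le hz)
    (summable_geometric_of_lt_one (Real.sqrt_nonneg _) sqrt_half_lt_one)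

/-- The `p`-adic exponential. -/
def pexp (z : ℚ_[p]) : ℚ_[p] := ∑' n : ℕ, (n.factorial : ℚ_[p])⁻¹ * z ^ n

theorem hasSum_pexp {z : ℚ_[p]} (hz : ‖z‖ ≤ ‖(2 * p : ℚ_[p])‖) :
    HasSum (fun n : ℕ => (n.factorial : ℚ_[p])⁻¹ * z ^ n) (pexp z) :=
  (summable_norm_expTerm hz).of_norm.hasSum

theorem pexp_zero : pexp (0 : ℚ_[p]) = 1 := by
  rw [pexp, tsum_eq_single 0 fun n hn => by simp [hn]]; simp

theorem pexp_add {x y : ℚ_[p]} (hx : ‖x‖ ≤ ‖(2 * p : ℚ_[p])‖) (hy : ‖y‖ ≤ ‖(2 * p : ℚ_[p])‖) :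
    pexp (x + y) = pexp x * pexp y := by
  rw [pexp, pexp, pexp, tsum_mul_tsum_eq_tsum_sum_antidiagonal_of_summable_norm
    (summable_norm_expTerm hx) (summable_norm_expTerm hy)]
  refine tsum_congr fun n => ?_
  rw [(Commute.all x y).add_pow', Finset.mul_sum]
  refine Finset.sum_congr rfl fun kl hkl => ?_
  rw [← Finset.HasAntidiagonal.mem_antidiagonal.1 hkl, nsmul_eq_mul, Nat.cast_add_choose]
  have := (kl.1 + kl.2).factorial_ne_zero
  have h1 := kl.1.factorial_ne_zero
  have h2 := kl.2.factorial_ne_zero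
  field_simp

theorem pexp_natCast_mul {z : ℚ_[p]} (hz : ‖z‖ ≤ ‖(2 * p : ℚ_[p])‖) (n : ℕ) :
    pexp ((n : ℚ_[p]) * z) = pexp z ^ n := by
  induction n with
  | zero => simp [pexp_zero]
  | succ n ih =>
    have : ‖(n : ℚ_[p]) * z‖ ≤ ‖(2 * p : ℚ_[p])‖ := by
      rw [norm_mul]
      exact (mul_le_of_le_one_left (norm_nonneg _) (by simpa using Padic.norm_int_le_one n)).trans hz
    rw [Nat.cast_succ, add_mul, one_mul, pexp_add this hz, ih, pow_succ]

theorem norm_pexp_sub_one_le {z : ℚ_[p]} (hz : ‖z‖ ≤ ‖(2 * p : ℚ_[p])‖) :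
    ‖pexp z - 1‖ ≤ ‖(2 * p : ℚ_[p])‖ := by
  have h := (hasSum_nat_add_iff' 1).2 (hasSum_pexp hz)
  simp only [Finset.range_one, Finset.sum_singleton, Nat.factorial_zero, Nat.cast_one, inv_one,
    pow_zero, one_mul] at h
  rw [← h.tsum_eq]
  exact IsUltrametricDist.norm_tsum_le_of_forall_le_of_nonneg (norm_nonneg _)
    (norm_expTerm_succ_le hz)

/-- The factorials are absorbed by the powers of `z`, which leaves at least two factors `t` in every
remaining term. -/
theorem norm_pexp_sub_one_sub_le {z t : ℚ_[p]} (hz : ‖z‖ ≤ ‖(2 * p : ℚ_[p])‖) (ht : ‖t‖ ≤ 1) :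
    ‖pexp (t * z) - 1 - t * z‖ ≤ ‖t‖ ^ 2 := by
  have htz : ‖t * z‖ ≤ ‖(2 * p : ℚ_[p])‖ := by
    rw [norm_mul]; exact (mul_le_of_le_one_left (norm_nonneg _) ht).trans hz
  have h := (hasSum_nat_add_iff' 2).2 (hasSum_pexp htz)
  simp only [Finset.sum_range_succ, Finset.range_zero, Finset.sum_empty, zero_add,
    Nat.factorial_zero, Nat.factorial_one, Nat.cast_one, inv_one, pow_zero, pow_one, one_mul] at h
  rw [sub_sub, ← h.tsum_eq]
  refine IsUltrametricDist.norm_tsum_le_of_forall_le_of_nonneg (by positivity) fun n => ?_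
  rw [mul_pow, mul_left_comm, norm_mul, norm_pow]
  have h1 := (norm_expTerm_le hz (n + 2)).trans (pow_le_one₀ (Real.sqrt_nonneg _)
    sqrt_half_lt_one.le)
  calc _ ≤ ‖t‖ ^ (n + 2) * 1 := by gcongr
    _ ≤ ‖t‖ ^ 2 := by
      rw [mul_one]
      exact pow_le_pow_of_le_one (norm_nonneg _) ht (by omega)

/-- The exponential has derivative `1` at `0`. -/
theorem tendsto_pexp_sub_one_div {α : Type*} {l : Filter α} {t : α → ℚ_[p]} (ht : Tendsto t l (𝓝 0))
    (z : ℚ_[p]) (h0 : ∀ᶠ i in l, t i ≠ 0) :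
    Tendsto (fun i => (t i)⁻¹ * (pexp (t i * z) - 1)) l (𝓝 z) := by
  -- rescale `z` into the disc of convergence
  obtain ⟨c, hc0, hc⟩ : ∃ c : ℚ_[p], c ≠ 0 ∧ ‖c * z‖ ≤ ‖(2 * p : ℚ_[p])‖ := by
    by_cases hz : z = 0
    · exact ⟨1, one_ne_zero, by simp [hz]⟩
    · refine ⟨2 * p * z⁻¹, mul_ne_zero (norm_pos_iff.1 norm_two_mul_p_pos) (inv_ne_zero hz), ?_⟩
      rw [inv_mul_cancel_right₀ hz]
  have ht' : Tendsto (fun i => c⁻¹ * t i) l (𝓝 0) := by simpa using ht.const_mul c⁻¹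
  have hsmall : ∀ᶠ i in l, ‖c⁻¹ * t i‖ ≤ 1 := by
    have := ht'.norm
    rw [norm_zero] at this
    exact this.eventually (eventually_le_nhds one_pos)
  rw [tendsto_iff_norm_sub_tendsto_zero]
  have hlim : Tendsto (fun i => ‖c‖⁻¹ * ‖c⁻¹ * t i‖) l (𝓝 0) := by simpa using ht'.norm.const_mul ‖c‖⁻¹
  refine squeeze_zero' (Eventually.of_forall fun _ => norm_nonneg _) ?_ hlim
  filter_upwards [hsmall, h0] with i hi hi0
  have h1 := norm_pexp_sub_one_sub_le hc hi
  rw [show c⁻¹ * t i * (c * z) = t i * z by field_simp] at h1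
  have h2 : (t i)⁻¹ * (pexp (t i * z) - 1) - z = (t i)⁻¹ * (pexp (t i * z) - 1 - t i * z) := by
    field_simp
  rw [h2, norm_mul]
  calc _ ≤ ‖(t i)⁻¹‖ * ‖c⁻¹ * t i‖ ^ 2 := by gcongr
    _ = _ := by
      have : ‖t i‖ ≠ 0 := norm_ne_zero_iff.2 hi0
      rw [norm_mul, norm_inv, norm_inv]
      field_simp

/-- The `p`-adic logarithm on `1 + 2 p ℤ_p`. -/
def plog (x : ℚ_[p]) : ℚ_[p] := ∑' n : ℕ, (-1) ^ n / (n + 1 : ℚ_[p]) * (x - 1) ^ (n + 1)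

theorem norm_logTerm_le {z : ℚ_[p]} (n : ℕ) :
    ‖(n + 1 : ℚ_[p])‖⁻¹ * ‖z‖ ^ (n + 1) ≤ (n + 1 : ℝ) * ‖z‖ ^ (n + 1) := by
  gcongr
  exact_mod_cast inv_norm_natCast_le (p := p) n.succ_ne_zero

theorem summable_logBound {r : ℝ} (h0 : 0 ≤ r) (h : r < 1) :
    Summable fun n : ℕ => (n + 1 : ℝ) * r ^ (n + 1) := by
  have := summable_pow_mul_geometric_of_norm_lt_one (R := ℝ) 1 (r := r)
    (by rwa [Real.norm_of_nonneg h0])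
  simpa using (summable_nat_add_iff 1).2 this

theorem lt_one_of_le {z : ℚ_[p]} (hz : ‖z‖ ≤ ‖(2 * p : ℚ_[p])‖) : ‖z‖ < 1 :=
  (hz.trans norm_two_mul_p_le).trans_lt (by norm_num)

theorem hasSum_plog {x : ℚ_[p]} (hx : ‖x - 1‖ ≤ ‖(2 * p : ℚ_[p])‖) :
    HasSum (fun n : ℕ => (-1) ^ n / (n + 1 : ℚ_[p]) * (x - 1) ^ (n + 1)) (plog x) := by
  refine Summable.hasSum (Summable.of_norm_bounded
    (summable_logBound (norm_nonneg (x - 1)) (lt_one_of_le hx)) fun n => ?_)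
  refine le_trans (le_of_eq ?_) (norm_logTerm_le n)
  simp [div_eq_mul_inv]

/-- The value group is discrete. A strict bound on each term thus becomes a uniform one and survives
an infinite sum. -/
theorem norm_le_inv_p_of_lt_one {z : ℚ_[p]} (h : ‖z‖ < 1) : ‖z‖ ≤ (p : ℝ)⁻¹ := by
  have := (Padic.norm_lt_pow_iff_norm_le_pow_sub_one z 0).1 (by simpa using h)
  simpa using this

/-- The logarithm is isometric. -/
theorem norm_plog {x : ℚ_[p]} (hx : ‖x - 1‖ ≤ ‖(2 * p : ℚ_[p])‖) : ‖plog x‖ = ‖x - 1‖ := by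
  by_cases h0 : x - 1 = 0
  · simp [plog, h0]
  have h := (hasSum_nat_add_iff' 1).2 (hasSum_plog hx)
  simp only [Finset.range_one, Finset.sum_singleton, pow_zero, Nat.cast_zero, zero_add, div_one,
    pow_one, one_mul] at h
  have hp1 : (p : ℝ)⁻¹ < 1 := inv_lt_one_of_one_lt₀ (by exact_mod_cast hp.out.one_lt)
  have hpos : 0 < ‖x - 1‖ := norm_pos_iff.2 h0
  -- By the ultrametric inequality it is enough that the terms of degree at least two are strictly
  -- dominated by the linear one.
  have hlt : ‖plog x - (x - 1)‖ < ‖x - 1‖ := by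
    refine lt_of_le_of_lt ?_ (mul_lt_of_lt_one_left hpos hp1)
    rw [← h.tsum_eq]
    refine IsUltrametricDist.norm_tsum_le_of_forall_le_of_nonneg (by positivity) fun n => ?_
    have e : ((-1) ^ (n + 1) / (((n + 1 : ℕ) : ℚ_[p]) + 1) * (x - 1) ^ (n + 1 + 1) : ℚ_[p]) =
        ((-1) ^ (n + 1) / (((n + 1 : ℕ) : ℚ_[p]) + 1) * (x - 1) ^ (n + 1)) * (x - 1) := by
      rw [pow_succ (x - 1) (n + 1)]; ring
    rw [e, norm_mul]
    refine mul_le_mul_of_nonneg_right (norm_le_inv_p_of_lt_one ?_) (norm_nonneg _)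
    have h1 : ‖((n + 1 : ℕ) : ℚ_[p]) + 1‖⁻¹ ≤ ((n + 2 : ℕ) : ℝ) := by
      have := inv_norm_natCast_le (p := p) (n + 1).succ_ne_zero
      rwa [Nat.cast_succ] at this
    -- The bound `1 / 3` is valid for every `p`, and `n + 2 < 3 ^ (n + 1)` beats the denominators.
    have h2 : ‖x - 1‖ ≤ 3⁻¹ := hx.trans norm_two_mul_p_le
    rw [norm_mul, norm_div, norm_pow, norm_neg, norm_one, one_pow, one_div, norm_pow]
    calc _ ≤ ((n + 2 : ℕ) : ℝ) * 3⁻¹ ^ (n + 1) := by gcongr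
      _ < 1 := by
        rw [inv_pow, ← div_eq_mul_inv, div_lt_one (by positivity)]
        have : ∀ n : ℕ, n + 2 < 3 ^ (n + 1) := fun n => by
          induction n with
          | zero => norm_num
          | succ n ih => rw [pow_succ]; omega
        exact_mod_cast this n
  have := IsUltrametricDist.norm_add_eq_max_of_norm_ne_norm (x := plog x - (x - 1)) (y := x - 1)
    hlt.ne
  rw [sub_add_cancel, max_eq_right hlt.le] at this
  exact this

theorem tendsto_p_pow : Tendsto (fun n : ℕ => (p : ℚ_[p]) ^ n) atTop (𝓝 0) :=
  tendsto_pow_atTop_nhds_zero_of_norm_lt_one Padic.norm_p_lt_one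

/-- The binomial polynomial is evaluated at `q - 1` with `q = p ^ n` tending to `0` in `ℚ_p`; the
limit is its value at `-1`. -/
theorem tendsto_choose_p_pow_sub_one (k : ℕ) :
    Tendsto (fun n : ℕ => ((p ^ n - 1).choose k : ℚ_[p])) atTop (𝓝 ((-1) ^ k)) := by
  induction k with
  | zero => simp
  | succ k ih =>
    have h1 : Tendsto (fun n : ℕ => ((p ^ n).choose (k + 1) : ℚ_[p])) atTop (𝓝 0) := by
      have h2 := (tendsto_p_pow (p := p)).mul ih |>.div_const (k + 1 : ℚ_[p])
      rw [zero_mul, zero_div] at h2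
      refine h2.congr fun n => ?_
      have h3 := Nat.add_one_mul_choose_eq (p ^ n - 1) k
      rw [Nat.sub_add_cancel (Nat.one_le_pow _ _ hp.out.pos)] at h3
      have h4 : ((p : ℚ_[p]) ^ n) * ((p ^ n - 1).choose k : ℚ_[p]) =
          ((p ^ n).choose (k + 1) : ℚ_[p]) * (k + 1) := by exact_mod_cast h3
      rw [h4, mul_div_cancel_right₀]
      exact_mod_cast k.succ_ne_zero
    have h2 := h1.sub ih
    rw [zero_sub, ← neg_one_mul, ← pow_succ'] at h2
    refine h2.congr fun n => ?_
    have h3 := Nat.succ_sub_one (p ^ n - 1)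
    have h4 : (p ^ n).choose (k + 1) = (p ^ n - 1).choose k + (p ^ n - 1).choose (k + 1) := by
      conv_lhs => rw [← Nat.sub_add_cancel (Nat.one_le_pow n p hp.out.pos)]
      exact Nat.choose_succ_succ _ _
    rw [h4]; push_cast; ring

/-- The logarithm as the derivative of `q ↦ x ^ q` at `q = 0`. -/
theorem tendsto_plog {x : ℚ_[p]} (hx : ‖x - 1‖ ≤ ‖(2 * p : ℚ_[p])‖) :
    Tendsto (fun n : ℕ => ((p : ℚ_[p]) ^ n)⁻¹ * (x ^ p ^ n - 1)) atTop (𝓝 (plog x)) := by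
  -- In the expansion of `(x ^ q - 1) / q` in powers of `x - 1` the coefficients are `choose (q - 1)
  -- k / (k + 1)`, because `choose q (k + 1) = q / (k + 1) * choose (q - 1) k`. Dominated
  -- convergence lets `q → 0` term by term.
  have key : Tendsto (fun n : ℕ => ∑' k : ℕ, ((p ^ n - 1).choose k : ℚ_[p]) / (k + 1) *
      (x - 1) ^ (k + 1)) atTop (𝓝 (plog x)) := by
    refine tendsto_tsum_of_dominated_convergence
      (summable_logBound (norm_nonneg (x - 1)) (lt_one_of_le hx)) (fun k => ?_)
      (Eventually.of_forall fun n k => ?_)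
    · exact ((tendsto_choose_p_pow_sub_one k).div_const _).mul_const _
    · refine le_trans ?_ (norm_logTerm_le k)
      rw [norm_mul, norm_div, norm_pow, div_eq_mul_inv, mul_assoc]
      exact mul_le_of_le_one_left (by positivity)
        (by simpa using Padic.norm_int_le_one ((p ^ n - 1).choose k))
  refine key.congr fun n => ?_
  set q := p ^ n with hq
  have hq1 : q - 1 + 1 = q := Nat.sub_add_cancel (Nat.one_le_pow _ _ hp.out.pos)
  rw [tsum_eq_sum (s := Finset.range q)]
  · have h1 : x ^ q - 1 = ∑ k ∈ Finset.range q, (x - 1) ^ (k + 1) * (q.choose (k + 1) : ℚ_[p]) := by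
      have := add_pow (x - 1) 1 q
      simp only [sub_add_cancel, one_pow, mul_one] at this
      rw [this, Finset.sum_range_succ']
      simp
    have hq0 : ((p : ℚ_[p]) ^ n) ≠ 0 := pow_ne_zero _ (by exact_mod_cast hp.out.ne_zero)
    rw [h1, Finset.mul_sum]
    refine Finset.sum_congr rfl fun k _ => ?_
    have h3 := Nat.add_one_mul_choose_eq (q - 1) k
    rw [hq1] at h3
    have h4 : ((p : ℚ_[p]) ^ n) * ((q - 1).choose k : ℚ_[p]) =
        (q.choose (k + 1) : ℚ_[p]) * (k + 1) := by
      have : ((q : ℕ) : ℚ_[p]) = (p : ℚ_[p]) ^ n := by rw [hq]; push_cast; rfl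
      rw [← this]; exact_mod_cast h3
    have h5 : (k + 1 : ℚ_[p]) ≠ 0 := by exact_mod_cast k.succ_ne_zero
    field_simp
    linear_combination (x - 1) ^ (k + 1) * h4
  · intro k hk
    rw [Finset.mem_range, not_lt] at hk
    rw [Nat.choose_eq_zero_of_lt (by omega)]; simp

theorem norm_mul_sub_one_le {x y : ℚ_[p]} (hx : ‖x - 1‖ ≤ ‖(2 * p : ℚ_[p])‖)
    (hy : ‖y - 1‖ ≤ ‖(2 * p : ℚ_[p])‖) : ‖x * y - 1‖ ≤ ‖(2 * p : ℚ_[p])‖ := by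
  have e : x * y - 1 = (x - 1) * (y - 1) + ((x - 1) + (y - 1)) := by ring
  rw [e]
  refine (IsUltrametricDist.norm_add_le_max _ _).trans (max_le ?_
    ((IsUltrametricDist.norm_add_le_max _ _).trans (max_le hx hy)))
  rw [norm_mul]
  exact (mul_le_of_le_one_left (norm_nonneg _) (lt_one_of_le hx).le).trans hy

/-- With the logarithm as the derivative of `q ↦ x ^ q`, this is the product rule applied to `(x y)
^ q - 1 = (x ^ q - 1) y ^ q + (y ^ q - 1)`. -/
theorem plog_mul {x y : ℚ_[p]} (hx : ‖x - 1‖ ≤ ‖(2 * p : ℚ_[p])‖)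
    (hy : ‖y - 1‖ ≤ ‖(2 * p : ℚ_[p])‖) : plog (x * y) = plog x + plog y := by
  have hq0 : ∀ n, ((p : ℚ_[p]) ^ n) ≠ 0 :=
    fun n => pow_ne_zero _ (by exact_mod_cast hp.out.ne_zero)
  have h1 : Tendsto (fun n : ℕ => y ^ p ^ n) atTop (𝓝 1) := by
    have := ((tendsto_p_pow (p := p)).mul (tendsto_plog hy)).add_const 1
    rw [zero_mul, zero_add] at this
    refine this.congr fun n => ?_
    rw [mul_inv_cancel_left₀ (hq0 n), sub_add_cancel]
  have h2 := ((tendsto_plog hx).mul h1).add (tendsto_plog hy)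
  rw [mul_one] at h2
  refine tendsto_nhds_unique (tendsto_plog (norm_mul_sub_one_le hx hy)) (h2.congr fun n => ?_)
  rw [mul_pow]; ring

theorem plog_one : plog (1 : ℚ_[p]) = 0 := by simp [plog]

/-- The derivative at `q = 0` of `exp (z) ^ q = exp (q z)` is computed in two ways. -/
theorem plog_pexp {z : ℚ_[p]} (hz : ‖z‖ ≤ ‖(2 * p : ℚ_[p])‖) : plog (pexp z) = z := by
  refine tendsto_nhds_unique (tendsto_plog (norm_pexp_sub_one_le hz)) ?_
  have := tendsto_pexp_sub_one_div (tendsto_p_pow (p := p)) z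
    (Eventually.of_forall fun n => pow_ne_zero _ (by exact_mod_cast hp.out.ne_zero))
  refine this.congr fun n => ?_
  rw [← pexp_natCast_mul hz]; push_cast; rfl

theorem ne_zero_of_norm_sub_one {x : ℚ_[p]} (hx : ‖x - 1‖ ≤ ‖(2 * p : ℚ_[p])‖) : x ≠ 0 := by
  rintro rfl
  have := lt_one_of_le hx
  simp at this

theorem norm_inv_sub_one_le {x : ℚ_[p]} (hx : ‖x - 1‖ ≤ ‖(2 * p : ℚ_[p])‖) :
    ‖x⁻¹ - 1‖ ≤ ‖(2 * p : ℚ_[p])‖ := by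
  have h0 := ne_zero_of_norm_sub_one hx
  have h1 : ‖x‖ = 1 := by
    have := IsUltrametricDist.norm_add_eq_max_of_norm_ne_norm (x := x - 1) (y := (1 : ℚ_[p]))
      (by rw [norm_one]; exact (lt_one_of_le hx).ne)
    rw [sub_add_cancel, norm_one, max_eq_right (lt_one_of_le hx).le] at this
    exact this
  rw [show x⁻¹ - 1 = -(x⁻¹ * (x - 1)) by field_simp; ring, norm_neg, norm_mul, norm_inv, h1, inv_one,
    one_mul]
  exact hx

theorem plog_inv {x : ℚ_[p]} (hx : ‖x - 1‖ ≤ ‖(2 * p : ℚ_[p])‖) : plog x⁻¹ = -plog x := by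
  have := plog_mul hx (norm_inv_sub_one_le hx)
  rw [mul_inv_cancel₀ (ne_zero_of_norm_sub_one hx), plog_one] at this
  linear_combination -this

/-- The logarithm is isometric, second form. -/
theorem norm_plog_sub_plog {x y : ℚ_[p]} (hx : ‖x - 1‖ ≤ ‖(2 * p : ℚ_[p])‖)
    (hy : ‖y - 1‖ ≤ ‖(2 * p : ℚ_[p])‖) : ‖plog x - plog y‖ = ‖x * y⁻¹ - 1‖ := by
  rw [← norm_plog (norm_mul_sub_one_le hx (norm_inv_sub_one_le hy)),
    plog_mul hx (norm_inv_sub_one_le hy), plog_inv hy, sub_eq_add_neg]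

/-- The elements `exp (log x)` and `x` have the same logarithm, and an isometric homomorphism is
injective. -/
theorem pexp_plog {x : ℚ_[p]} (hx : ‖x - 1‖ ≤ ‖(2 * p : ℚ_[p])‖) : pexp (plog x) = x := by
  have h1 : ‖plog x‖ ≤ ‖(2 * p : ℚ_[p])‖ := by rwa [norm_plog hx]
  have h2 := norm_plog_sub_plog (norm_pexp_sub_one_le h1) hx
  rw [plog_pexp h1, sub_self, norm_zero] at h2
  have h3 := sub_eq_zero.1 (norm_eq_zero.1 h2.symm)
  exact (mul_inv_eq_one₀ (ne_zero_of_norm_sub_one hx)).1 h3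

end PadicExpLog

/-! ### The logarithm on all p-adic units. -/

section UnitLog
variable {p : ℕ} [hp : Fact p.Prime]

theorem norm_coe_sub_one_le_iff {x : ℤ_[p]} :
    ‖(x : ℚ_[p]) - 1‖ ≤ ‖(2 * p : ℚ_[p])‖ ↔ (2 * p : ℤ_[p]) ∣ x - 1 := by
  constructor
  · intro h
    have h0 : (2 * p : ℚ_[p]) ≠ 0 := norm_pos_iff.1 norm_two_mul_p_pos
    refine ⟨⟨((x : ℚ_[p]) - 1) / (2 * p), ?_⟩, ?_⟩
    · rw [norm_div, div_le_one norm_two_mul_p_pos]; exact h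
    · apply Subtype.coe_injective
      change (x : ℚ_[p]) - 1 = (2 * p) * (((x : ℚ_[p]) - 1) / (2 * p))
      rw [mul_div_cancel₀ _ h0]
  · rintro ⟨y, hy⟩
    have : (x : ℚ_[p]) - 1 = (2 * p) * y := by
      have := congrArg (fun z : ℤ_[p] => (z : ℚ_[p])) hy
      have h2 : ((2 : ℤ_[p]) : ℚ_[p]) = 2 := map_ofNat (PadicInt.Coe.ringHom (p := p)) 2
      simpa [h2] using this
    rw [this, norm_mul]
    exact mul_le_of_le_one_right (norm_nonneg _) y.2

/-- Factor `x ^ (2 (p - 1)) - 1` as `(x ^ (p - 1) + 1) (x ^ (p - 1) - 1)`. Fermat makes the second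
factor divisible by `p`, and `2` divides the first: for `p = 2` since `x` is odd, for odd `p` since
`2` is a unit. -/
theorem norm_unit_pow_sub_one_le (x : ℤ_[p]ˣ) :
    ‖((x ^ (2 * (p - 1)) : ℤ_[p]ˣ) : ℚ_[p]) - 1‖ ≤ ‖(2 * p : ℚ_[p])‖ := by
  rw [norm_coe_sub_one_le_iff]
  have h1 : ∀ y : ℤ_[p]ˣ, (p : ℤ_[p]) ∣ (y ^ (p - 1) : ℤ_[p]ˣ) - 1 := fun y => by
    rw [← Ideal.mem_span_singleton, ← PadicInt.maximalIdeal_eq_span_p, ← PadicInt.ker_toZMod,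
      RingHom.mem_ker, map_sub, Units.val_pow_eq_pow_val, map_pow, map_one,
      ZMod.pow_card_sub_one_eq_one ((y.isUnit.map PadicInt.toZMod).ne_zero), sub_self]
  have h2 : (2 : ℤ_[p]) ∣ (x ^ (p - 1) : ℤ_[p]ˣ) + 1 := by
    by_cases h : p = 2
    · subst h
      have := (h1 x).add (dvd_refl _)
      have h2 : ((2 : ℕ) : ℤ_[2]) = 2 := rfl
      rw [h2] at this
      convert this using 1
      ring
    · have hu : IsUnit ((2 : ℕ) : ℤ_[p]) := by
        rw [PadicInt.isUnit_iff]
        change ‖((2 : ℕ) : ℚ_[p])‖ = 1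
        rw [Padic.norm_natCast_eq_one_iff]
        exact (Nat.coprime_primes hp.out Nat.prime_two).2 h
      exact (by exact_mod_cast hu : IsUnit (2 : ℤ_[p])).dvd
  convert mul_dvd_mul h2 (h1 x) using 1
  rw [mul_comm 2, pow_mul]
  push_cast; ring

theorem two_mul_p_sub_one_ne_zero : (2 * (p - 1) : ℕ) ≠ 0 := by
  have := hp.out.two_le
  omega

/-- The logarithm `ℤ_p^× → ℚ_p`, trivial on roots of unity. -/
def ulog (x : ℤ_[p]ˣ) : ℚ_[p] :=
  (((2 * (p - 1) : ℕ) : ℚ_[p]))⁻¹ * plog ((x ^ (2 * (p - 1)) : ℤ_[p]ˣ) : ℚ_[p])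

theorem ulog_mul (x y : ℤ_[p]ˣ) : ulog (x * y) = ulog x + ulog y := by
  have := plog_mul (norm_unit_pow_sub_one_le x) (norm_unit_pow_sub_one_le y)
  rw [ulog, ulog, ulog, ← mul_add, ← this, mul_pow]
  push_cast; rfl

theorem ulog_one : ulog (1 : ℤ_[p]ˣ) = 0 := by simp [ulog, plog_one]

theorem plog_pow {x : ℚ_[p]} (hx : ‖x - 1‖ ≤ ‖(2 * p : ℚ_[p])‖) (n : ℕ) :
    ‖x ^ n - 1‖ ≤ ‖(2 * p : ℚ_[p])‖ ∧ plog (x ^ n) = n * plog x := by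
  induction n with
  | zero => simp [plog_one]
  | succ n ih =>
    rw [pow_succ]
    refine ⟨norm_mul_sub_one_le ih.1 hx, ?_⟩
    rw [plog_mul ih.1 hx, ih.2]; push_cast; ring

theorem ulog_eq_plog {x : ℤ_[p]ˣ} (hx : ‖((x : ℤ_[p]) : ℚ_[p]) - 1‖ ≤ ‖(2 * p : ℚ_[p])‖) :
    ulog x = plog ((x : ℤ_[p]) : ℚ_[p]) := by
  have h : (((x ^ (2 * (p - 1)) : ℤ_[p]ˣ) : ℤ_[p]) : ℚ_[p]) =
    ((x : ℤ_[p]) : ℚ_[p]) ^ (2 * (p - 1)) := by push_cast; rfl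
  rw [ulog, h, (plog_pow hx _).2, inv_mul_cancel_left₀]
  exact_mod_cast two_mul_p_sub_one_ne_zero

theorem tendsto_units_iff {α : Type*} {l : Filter α} {u : α → ℤ_[p]ˣ} {x : ℤ_[p]ˣ} :
    Tendsto u l (𝓝 x) ↔ Tendsto (fun i => ((u i : ℤ_[p]) : ℚ_[p])) l (𝓝 ((x : ℤ_[p]) : ℚ_[p])) := by
  rw [Units.isOpenEmbedding_val.isEmbedding.tendsto_nhds_iff]
  exact (Topology.IsEmbedding.subtypeVal (p := fun x : ℚ_[p] => ‖x‖ ≤ 1)).tendsto_nhds_iff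

theorem coe_unit_ne_zero (x : ℤ_[p]ˣ) : ((x : ℤ_[p]) : ℚ_[p]) ≠ 0 := by
  intro h
  have : (x : ℤ_[p]) = 0 := Subtype.coe_injective h
  exact x.ne_zero this

/-- Near `x` the distance `|ulog y - ulog x|` equals `|y / x - 1|`, the logarithm being isometric.
-/
theorem continuous_ulog : Continuous (ulog : ℤ_[p]ˣ → ℚ_[p]) := by
  rw [continuous_iff_continuousAt]
  intro x
  have h1 : Tendsto (fun y : ℤ_[p]ˣ => (((y * x⁻¹ : ℤ_[p]ˣ) : ℤ_[p]) : ℚ_[p]) - 1) (𝓝 x) (𝓝 0) := by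
    have : Tendsto (fun y : ℤ_[p]ˣ => y * x⁻¹) (𝓝 x) (𝓝 1) := by
      have := (continuous_mul_const x⁻¹).tendsto x
      rwa [mul_inv_cancel] at this
    have := (tendsto_units_iff.1 this).sub_const 1
    simpa using this
  have h2 := h1.norm
  rw [norm_zero] at h2
  rw [ContinuousAt, tendsto_iff_norm_sub_tendsto_zero]
  refine h2.congr' ?_
  filter_upwards [h2.eventually (eventually_le_nhds (norm_two_mul_p_pos (p := p)))] with y hy
  have : ulog y = ulog (y * x⁻¹) + ulog x := by rw [← ulog_mul, inv_mul_cancel_right]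
  rw [this, add_sub_cancel_right, ulog_eq_plog hy, norm_plog hy]

/-- `1 + x ℤ_p` is contained in the closure of the powers of `1 + x`. -/
theorem exists_tendsto_pow {x y : ℤ_[p]ˣ}
    (hx : ‖((x : ℤ_[p]) : ℚ_[p]) - 1‖ ≤ ‖(2 * p : ℚ_[p])‖)
    (hy : ‖((y : ℤ_[p]) : ℚ_[p]) - 1‖ ≤ ‖((x : ℤ_[p]) : ℚ_[p]) - 1‖) :
    ∃ a : ℕ → ℕ, Tendsto (fun n => x ^ a n) atTop (𝓝 y) := by
  by_cases hx1 : ((x : ℤ_[p]) : ℚ_[p]) - 1 = 0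
  · rw [hx1, norm_zero, norm_le_zero_iff, sub_eq_zero] at hy
    have : y = 1 := Units.ext (Subtype.coe_injective hy)
    exact ⟨fun _ => 0, by simp [this]⟩
  have hy' := hy.trans hx
  have hlx : plog ((x : ℤ_[p]) : ℚ_[p]) ≠ 0 := by
    rw [← norm_ne_zero_iff, norm_plog hx]; exact norm_ne_zero_iff.2 hx1
  -- Formally `y = x ^ a`. The hypothesis on norms puts `a` in `ℤ_p`, where natural numbers are
  -- dense.
  set a := plog ((y : ℤ_[p]) : ℚ_[p]) / plog ((x : ℤ_[p]) : ℚ_[p])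
  have ha : ‖a‖ ≤ 1 := by
    rw [norm_div, norm_plog hx, norm_plog hy']
    exact div_le_one_of_le₀ hy (norm_nonneg _)
  obtain ⟨b, hb⟩ : ∃ b : ℕ → ℕ, Tendsto (fun n => (b n : ℤ_[p])) atTop (𝓝 ⟨a, ha⟩) := by
    have := PadicInt.denseRange_natCast (p := p) ⟨a, ha⟩
    obtain ⟨u, hu, hu'⟩ := mem_closure_iff_seq_limit.1 this
    choose b hb using hu
    exact ⟨b, by simpa only [hb] using hu'⟩
  refine ⟨b, ?_⟩
  have hb' : Tendsto (fun n => (b n : ℚ_[p])) atTop (𝓝 a) := by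
    have := (continuous_subtype_val.tendsto _).comp hb
    exact this.congr fun n => PadicInt.coe_natCast (b n)
  rw [tendsto_units_iff, tendsto_iff_norm_sub_tendsto_zero]
  have hlim : Tendsto (fun n => ‖(b n : ℚ_[p]) - a‖ * ‖plog ((x : ℤ_[p]) : ℚ_[p])‖ *
      ‖((y : ℤ_[p]) : ℚ_[p])‖) atTop (𝓝 0) := by
    simpa using ((tendsto_iff_norm_sub_tendsto_zero.1 hb').mul_const
      ‖plog ((x : ℤ_[p]) : ℚ_[p])‖).mul_const ‖((y : ℤ_[p]) : ℚ_[p])‖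
  refine hlim.congr fun n => ?_
  have h1 := plog_pow hx (b n)
  have h2 := norm_plog_sub_plog h1.1 hy'
  have h3 : plog (((x : ℤ_[p]) : ℚ_[p]) ^ b n) - plog ((y : ℤ_[p]) : ℚ_[p]) =
      ((b n : ℚ_[p]) - a) * plog ((x : ℤ_[p]) : ℚ_[p]) := by
    rw [h1.2, sub_mul, div_mul_cancel₀ _ hlx]
  rw [← norm_mul, ← h3, h2, ← norm_mul]
  congr 1
  have := coe_unit_ne_zero y
  push_cast
  field_simp

end UnitLog

/-- `G` embeds as an open subgroup of `ℤ_p^× ⋉ ℤ_p^d` by means of `χ` and the cocycles `s j`. -/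
structure IsAffineGroup {p : ℕ} [Fact p.Prime] {G : Type*} [Group G] [TopologicalSpace G] {d : ℕ}
    (χ : G →* ℤ_[p]ˣ) (s : Fin d → G → ℤ_[p]) : Prop where
  continuous_chi : Continuous χ
  continuous_s : ∀ j, Continuous (s j)
  s_mul : ∀ j g h, s j (g * h) = s j g + (χ g : ℤ_[p]) * s j h
  injective : ∀ g h, χ g = χ h → (∀ j, s j g = s j h) → g = h
  exists_lift : ∃ M : ℕ, ∀ (x : ℤ_[p]ˣ) (r : Fin d → ℤ_[p]), (p : ℤ_[p]) ^ M ∣ (x : ℤ_[p]) - 1 →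
    (∀ j, (p : ℤ_[p]) ^ M ∣ r j) → ∃ g, χ g = x ∧ ∀ j, s j g = r j

/-! ### Roots of unity raised to p-adic exponents. -/

section RootPowers
variable {p : ℕ} [hp : Fact p.Prime] {L : Type*} [Field L]

/-- `z ^ a` for `a : ℤ_p` and `z ^ p ^ n = 1`. -/
def padicPow (n : ℕ) (z : L) (a : ℤ_[p]) : L := z ^ (PadicInt.toZModPow n a).val

theorem pow_mod_of_pow_eq_one {z : L} {q : ℕ} (hz : z ^ q = 1) (k : ℕ) : z ^ (k % q) = z ^ k := by
  conv_rhs => rw [← Nat.mod_add_div k q, pow_add, pow_mul, hz, one_pow, mul_one]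

theorem padicPow_add {n : ℕ} {z : L} (hz : z ^ p ^ n = 1) (a b : ℤ_[p]) :
    padicPow n z (a + b) = padicPow n z a * padicPow n z b := by
  have : NeZero (p ^ n) := ⟨pow_ne_zero n hp.out.ne_zero⟩
  rw [padicPow, map_add, ZMod.val_add, pow_mod_of_pow_eq_one hz, pow_add]; rfl

theorem padicPow_mul {n : ℕ} {z : L} (hz : z ^ p ^ n = 1) (a b : ℤ_[p]) :
    padicPow n z (a * b) = padicPow n (padicPow n z a) b := by
  rw [padicPow, map_mul, ZMod.val_mul, pow_mod_of_pow_eq_one hz, pow_mul]; rfl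

theorem padicPow_natCast {n : ℕ} {z : L} (hz : z ^ p ^ n = 1) (k : ℕ) :
    padicPow n z (k : ℤ_[p]) = z ^ k := by
  rw [padicPow, map_natCast, ZMod.val_natCast, pow_mod_of_pow_eq_one hz]

theorem padicPow_pow_eq_one {n : ℕ} {z : L} (hz : z ^ p ^ n = 1) (a : ℤ_[p]) :
    padicPow n z a ^ p ^ n = 1 := by
  rw [padicPow, ← pow_mul, mul_comm, pow_mul, hz, one_pow]

theorem toZModPow_eq_of_padicPow_eq {n : ℕ} {z : L} (hz : IsPrimitiveRoot z (p ^ n)) {a b : ℤ_[p]}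
    (h : padicPow n z a = padicPow n z b) : PadicInt.toZModPow n a = PadicInt.toZModPow n b := by
  have : NeZero (p ^ n) := ⟨pow_ne_zero n hp.out.ne_zero⟩
  exact ZMod.val_injective _ (hz.pow_inj (ZMod.val_lt _) (ZMod.val_lt _) h)

end RootPowers

/-! ### Kummer cocycles and the embedding of `Γ` into `ℤ_p^× ⋉ ℤ_p^d`. -/

section Kummer
variable {p : ℕ} {K : Type u} [Field K] {Kbar : Type v} [Field Kbar]
  [Algebra K Kbar] {d : ℕ} {t : Fin d → K} (R : RootSystem p Kbar t)

theorem RootSystem.root_pow (j : Fin d) (n : ℕ) :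
    R.root j n ^ p ^ n = algebraMap K (KInf p Kbar t) (t j) := by
  induction n with
  | zero => rw [pow_zero, pow_one, R.root_zero]
  | succ n ih => rw [pow_succ', pow_mul, R.root_succ, ih]

theorem RootSystem.ζ_pow (n : ℕ) : R.ζ n ^ p ^ n = 1 := (R.ζ_prim n).pow_eq_one

theorem KInf.normal [CharZero K] [IsAlgClosure K Kbar] : Normal K (KInf p Kbar t) := by
  have : Normal K Kbar := IsAlgClosure.normal K Kbar
  rw [IntermediateField.normal_iff_forall_map_le]
  intro σ
  rw [KInf, IntermediateField.adjoin_map]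
  refine IntermediateField.adjoin.mono _ _ _ ?_
  rintro _ ⟨x, hx | ⟨n, j, hx⟩, rfl⟩
  · obtain ⟨n, hx⟩ := hx
    exact Or.inl ⟨n, by rw [← map_pow, hx, map_one]⟩
  · exact Or.inr ⟨n, j, by rw [← map_pow, hx, AlgHom.commutes]⟩

theorem KInf.isGalois [CharZero K] [IsAlgClosure K Kbar] : IsGalois K (KInf p Kbar t) := by
  have : Normal K (KInf p Kbar t) := KInf.normal
  exact ⟨⟩

variable [hp : Fact p.Prime]

theorem RootSystem.root_ne_zero (ht : ∀ j, t j ≠ 0) (j : Fin d) (n : ℕ) : R.root j n ≠ 0 := by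
  intro h
  have := R.root_pow j n
  rw [h, zero_pow (pow_ne_zero n hp.out.ne_zero)] at this
  exact ht j ((map_eq_zero (algebraMap K (KInf p Kbar t))).1 this.symm)

theorem RootSystem.chi_spec (R : RootSystem p Kbar t) (γ : Gam p Kbar t) {n : ℕ}
    {z : KInf p Kbar t} (hz : z ^ p ^ n = 1) :
    γ z = padicPow n z (chi p Kbar t γ : ℤ_[p]) := by
  have _ (i : ℕ) : HasEnoughRootsOfUnity (KInf p Kbar t) (p ^ i) :=
    have : NeZero (p ^ i) := ⟨pow_ne_zero i hp.out.ne_zero⟩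
    ⟨⟨_, R.ζ_prim i⟩, rootsOfUnity.isCyclic _ _⟩
  exact cyclotomicCharacter.spec p (MulSemiringAction.toRingAut (Gam p Kbar t) (KInf p Kbar t) γ)
    z hz

theorem RootSystem.s_spec (γ : Gam p Kbar t) (j : Fin d) (n : ℕ) :
    γ (R.root j n) = padicPow n (R.ζ n) (R.s j γ) * R.root j n :=
  Classical.choose_spec (R.exists_kummer j γ) n

theorem RootSystem.toZModPow_s_eq (ht : ∀ j, t j ≠ 0) {γ γ' : Gam p Kbar t} {j : Fin d} {n : ℕ}
    (h : γ (R.root j n) = γ' (R.root j n)) :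
    PadicInt.toZModPow n (R.s j γ) = PadicInt.toZModPow n (R.s j γ') := by
  rw [R.s_spec, R.s_spec] at h
  exact toZModPow_eq_of_padicPow_eq (R.ζ_prim n) (mul_right_cancel₀ (R.root_ne_zero ht j n) h)

theorem RootSystem.s_unique (ht : ∀ j, t j ≠ 0) {γ : Gam p Kbar t} {j : Fin d} {a : ℤ_[p]}
    (h : ∀ n, γ (R.root j n) = padicPow n (R.ζ n) a * R.root j n) : R.s j γ = a := by
  refine PadicInt.ext_of_toZModPow.1 fun n => ?_
  have h1 := h n
  rw [R.s_spec] at h1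
  exact toZModPow_eq_of_padicPow_eq (R.ζ_prim n) (mul_right_cancel₀ (R.root_ne_zero ht j n) h1)

theorem RootSystem.apply_padicPow (R : RootSystem p Kbar t) (γ : Gam p Kbar t) {n : ℕ}
    {z : KInf p Kbar t}
    (hz : z ^ p ^ n = 1) (a : ℤ_[p]) :
    γ (padicPow n z a) = padicPow n z ((chi p Kbar t γ : ℤ_[p]) * a) := by
  rw [padicPow_mul hz, ← R.chi_spec γ hz]
  exact map_pow _ _ _

theorem RootSystem.s_mul (ht : ∀ j, t j ≠ 0) (j : Fin d) (γ γ' : Gam p Kbar t) :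
    R.s j (γ * γ') = R.s j γ + (chi p Kbar t γ : ℤ_[p]) * R.s j γ' := by
  refine R.s_unique ht fun n => ?_
  rw [AlgEquiv.mul_apply, R.s_spec γ', map_mul, R.apply_padicPow γ (R.ζ_pow n), R.s_spec γ,
    padicPow_add (R.ζ_pow n)]
  ring

theorem RootSystem.injective (ht : ∀ j, t j ≠ 0) {γ γ' : Gam p Kbar t}
    (h1 : chi p Kbar t γ = chi p Kbar t γ') (h2 : ∀ j, R.s j γ = R.s j γ') : γ = γ' := by
  have hz : ∀ (n : ℕ) (z : KInf p Kbar t), z ^ p ^ n = 1 → γ z = γ' z := fun n z hz => by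
    rw [R.chi_spec γ hz, R.chi_spec γ' hz, h1]
  suffices (γ : KInf p Kbar t →ₐ[K] KInf p Kbar t) = γ' from
    AlgEquiv.ext fun x => AlgHom.congr_fun this x
  refine IntermediateField.algHom_ext_of_eq_adjoin K rfl fun x hx => ?_
  rcases hx with ⟨n, hn⟩ | ⟨n, j, hn⟩
  · exact hz n _ (Subtype.coe_injective hn)
  · set y : KInf p Kbar t := ⟨x, _⟩
    have hy : y ^ p ^ n = algebraMap K _ (t j) := Subtype.coe_injective hn
    have h0 := R.root_ne_zero ht j n
    -- An arbitrary `p ^ n`-th root of `t j` differs from the chosen one by a root of unity, on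
    -- which `χ` determines the action.
    have h3 : (y / R.root j n) ^ p ^ n = 1 := by
      rw [div_pow, hy, R.root_pow, div_self]
      rw [← R.root_pow j n]; exact pow_ne_zero _ h0
    have h4 := hz n _ h3
    have h5 : γ (R.root j n) = γ' (R.root j n) := by rw [R.s_spec, R.s_spec, h2]
    have h6 : y = (y / R.root j n) * R.root j n := (div_mul_cancel₀ _ h0).symm
    change γ y = γ' y
    rw [h6, map_mul, map_mul, h4, h5]

/-- Modulo `p ^ n` the cocycle depends only on the image of `R.root j n`, whose stabilizer is open.
-/
theorem RootSystem.continuous_s [CharZero K] [IsAlgClosure K Kbar] (ht : ∀ j, t j ≠ 0)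
    (j : Fin d) : Continuous (R.s j) := by
  have : IsGalois K (KInf p Kbar t) := KInf.isGalois
  rw [continuous_iff_continuousAt]
  intro γ
  rw [ContinuousAt, Metric.tendsto_nhds]
  intro ε hε
  obtain ⟨n, hn⟩ := PadicInt.exists_pow_neg_lt p hε
  have hopen : IsOpen {γ' : Gam p Kbar t | γ' (R.root j n) = γ (R.root j n)} := by
    have h1 := (stabilizer_isOpen_of_isIntegral (K := K) (R.root j n)).preimage
      (continuous_const_mul γ⁻¹)
    convert h1 using 1
    ext γ'
    rw [Set.mem_ofPred_eq, Set.mem_preimage, SetLike.mem_coe, MulAction.mem_stabilizer_iff,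
      mul_smul, inv_smul_eq_iff]
    rfl
  filter_upwards [hopen.mem_nhds rfl] with γ' hγ'
  have h2 := R.toZModPow_s_eq ht hγ'
  rw [dist_eq_norm]
  refine lt_of_le_of_lt ?_ hn
  rw [PadicInt.norm_le_pow_iff_mem_span_pow, ← PadicInt.ker_toZModPow, RingHom.mem_ker, map_sub, h2,
    sub_self]

end Kummer

/-! ### Integrality and discreteness in a valued field. -/

section ValuationRing
variable {K : Type u} [NormedField K] [IsUltrametricDist K]

theorem mem_valuationSubring_iff {x : K} :
    x ∈ (NormedField.valuation (K := K)).valuationSubring ↔ ‖x‖ ≤ 1 := by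
  rw [Valuation.mem_valuationSubring_iff, NormedField.valuation_apply]
  exact Iff.rfl

theorem norm_le_one_of_isIntegral {x : K} (hx : IsIntegral ℤ x) : ‖x‖ ≤ 1 := by
  have h : IsIntegral (NormedField.valuation (K := K)).valuationSubring x := hx.tower_top
  obtain ⟨y, hy⟩ := IsIntegrallyClosed.isIntegral_iff.1 h
  rw [← mem_valuationSubring_iff, ← hy]
  exact y.2

theorem isUnit_iff_norm_eq_one (x : (NormedField.valuation (K := K)).valuationSubring) :
    IsUnit x ↔ ‖(x : K)‖ = 1 := by
  have hx := mem_valuationSubring_iff.1 x.2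
  constructor
  · rintro ⟨u, rfl⟩
    have h1 : ((u : (NormedField.valuation (K := K)).valuationSubring) : K) *
        ((u⁻¹ : _ˣ) : (NormedField.valuation (K := K)).valuationSubring) = 1 := by
      rw [← MulMemClass.coe_mul, u.mul_inv]; rfl
    have h2 := congrArg norm h1
    rw [norm_mul, norm_one] at h2
    have h3 := mem_valuationSubring_iff.1
      ((u⁻¹ : _ˣ) : (NormedField.valuation (K := K)).valuationSubring).2
    refine le_antisymm hx ?_
    calc (1 : ℝ) = _ := h2.symm
      _ ≤ _ := mul_le_of_le_one_right (norm_nonneg _) h3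
  · intro h
    have h0 : (x : K) ≠ 0 := by rw [← norm_ne_zero_iff, h]; exact one_ne_zero
    refine IsUnit.of_mul_eq_one ⟨(x : K)⁻¹, mem_valuationSubring_iff.2 ?_⟩ ?_
    · rw [norm_inv, h, inv_one]
    · exact Subtype.coe_injective (mul_inv_cancel₀ h0)

/-- Discreteness of the valuation enters here: `r` is the norm of a uniformizer. -/
theorem exists_norm_bound_of_lt_one
    [IsDiscreteValuationRing (NormedField.valuation (K := K)).valuationSubring] :
    ∃ r : ℝ, 0 ≤ r ∧ r < 1 ∧ ∀ x : K, ‖x‖ < 1 → ‖x‖ ≤ r := by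
  obtain ⟨π, hπ⟩ := IsDiscreteValuationRing.exists_irreducible
    (NormedField.valuation (K := K)).valuationSubring
  refine ⟨‖(π : K)‖, norm_nonneg _, lt_of_le_of_ne (mem_valuationSubring_iff.1 π.2) ?_, ?_⟩
  · exact fun h => hπ.not_isUnit ((isUnit_iff_norm_eq_one π).2 h)
  · intro x hx
    have h1 : (⟨x, mem_valuationSubring_iff.2 hx.le⟩ :
        (NormedField.valuation (K := K)).valuationSubring) ∈ IsLocalRing.maximalIdeal _ := by
      rw [IsLocalRing.mem_maximalIdeal, mem_nonunits_iff, isUnit_iff_norm_eq_one]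
      exact hx.ne
    rw [hπ.maximalIdeal_eq, Ideal.mem_span_singleton] at h1
    obtain ⟨y, hy⟩ := h1
    have h2 : x = π * y := congrArg Subtype.val hy
    rw [h2, norm_mul]
    exact mul_le_of_le_one_right (norm_nonneg _) (mem_valuationSubring_iff.1 y.2)

end ValuationRing

theorem charZero_of_normedAlgebra (p : ℕ) [Fact p.Prime] (K : Type*) [NormedField K]
    [NormedAlgebra ℚ_[p] K] : CharZero K :=
  charZero_of_injective_algebraMap (algebraMap ℚ_[p] K).injective

theorem norm_natCast_p {p : ℕ} [Fact p.Prime] {K : Type*} [NormedField K]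
    [NormedAlgebra ℚ_[p] K] : ‖(p : K)‖ = (p : ℝ)⁻¹ := by
  rw [← map_natCast (algebraMap ℚ_[p] K), norm_algebraMap', Padic.norm_p]

/-! ### The cyclotomic character has infinite image. -/

section Ramification
variable {p : ℕ} [hp : Fact p.Prime] {K : Type u} [NormedField K] [IsUltrametricDist K]
  [NormedAlgebra ℚ_[p] K] {Kbar : Type v} [Field Kbar] [Algebra K Kbar] {d : ℕ} {t : Fin d → K}

theorem padicPow_isPrimitiveRoot {L : Type*} [Field L] {n : ℕ} {z : L}
    (hz : IsPrimitiveRoot z (p ^ n)) (w : ℤ_[p]ˣ) :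
    IsPrimitiveRoot (padicPow n z (w : ℤ_[p])) (p ^ n) := by
  have h1 : padicPow n (padicPow n z (w : ℤ_[p])) ((w⁻¹ : ℤ_[p]ˣ) : ℤ_[p]) = z := by
    rw [← padicPow_mul hz.pow_eq_one, Units.mul_inv]
    simpa using padicPow_natCast (p := p) hz.pow_eq_one 1
  have h2 : orderOf (padicPow n z (w : ℤ_[p])) = p ^ n := by
    rw [hz.eq_orderOf]
    refine Nat.dvd_antisymm ?_ ?_
    · exact orderOf_pow_dvd _
    · conv_lhs => rw [← h1]
      exact orderOf_pow_dvd _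
  rw [← h2]
  exact IsPrimitiveRoot.orderOf _

/-- Otherwise the image `W` of `χ` is finite. For a primitive `p ^ (n + 1)`-th root of unity `z`,
the product of `1 - z ^ w` over `w ∈ W` is fixed by `Γ`, so it lies in `K`. The product over all
such `z` is `p ^ |W|`, so `φ(p ^ (n + 1))` elements of `K` of equal norm less than `1` have product
`p ^ |W|`. As norms less than `1` are at most `r < 1`, this is impossible for large `n`. -/
theorem exists_chi_pow_ne_one [CharZero K] [IsAlgClosure K Kbar]
    [IsDiscreteValuationRing (NormedField.valuation (K := K)).valuationSubring]
    (R : RootSystem p Kbar t) {m : ℕ} (hm : m ≠ 0) :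
    ∃ γ : Gam p Kbar t, chi p Kbar t γ ^ m ≠ 1 := by
  have : IsGalois K (KInf p Kbar t) := KInf.isGalois
  by_contra! hall
  have : NeZero m := ⟨hm⟩
  have hfin : (Set.range (chi p Kbar t)).Finite := by
    refine Set.Finite.subset (s := (rootsOfUnity m ℤ_[p] : Set ℤ_[p]ˣ))
      (Set.finite_coe_iff.1 (inferInstanceAs (Finite (rootsOfUnity m ℤ_[p])))) ?_
    rintro _ ⟨γ, rfl⟩
    exact hall γ
  set W : Finset ℤ_[p]ˣ := hfin.toFinset
  have hW : ∀ w, w ∈ W ↔ ∃ γ, chi p Kbar t γ = w := fun w => hfin.mem_toFinset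
  have hWpos : W.card ≠ 0 := Finset.card_ne_zero.2 ⟨1, (hW 1).2 ⟨1, map_one _⟩⟩
  let y : ℕ → KInf p Kbar t → KInf p Kbar t := fun n z =>
    ∏ w ∈ W, (1 - padicPow n z (w : ℤ_[p]))
  -- An automorphism `γ` permutes the factors through multiplication by `χ γ` on the group `W`.
  have hfix : ∀ n z, z ^ p ^ n = 1 → ∃ x : K, algebraMap K (KInf p Kbar t) x = y n z := by
    intro n z hz
    refine (InfiniteGalois.mem_range_algebraMap_iff_fixed (y n z)).2 fun γ => ?_
    simp only [y, map_prod, map_sub, map_one]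
    refine Finset.prod_equiv (Equiv.mulLeft (chi p Kbar t γ)) (fun w => ?_) (fun w _ => ?_)
    · rw [hW, hW, Equiv.coe_mulLeft]
      constructor
      · rintro ⟨γ', rfl⟩; exact ⟨γ * γ', map_mul _ _ _⟩
      · rintro ⟨γ', h⟩; exact ⟨γ⁻¹ * γ', by rw [map_mul, h, map_inv, inv_mul_cancel_left]⟩
    · rw [R.apply_padicPow γ hz]; rfl
  have hint : ∀ n (z : KInf p Kbar t), z ^ p ^ n = 1 → IsIntegral ℤ z := fun n z hz =>
    IsIntegral.of_pow (pow_pos hp.out.pos n) (by rw [hz]; exact isIntegral_one)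
  have hnorm : ∀ x : K, IsIntegral ℤ (algebraMap K (KInf p Kbar t) x) → ‖x‖ ≤ 1 := fun x hx =>
    norm_le_one_of_isIntegral ((isIntegral_algebraMap_iff
      (algebraMap K (KInf p Kbar t)).injective).1 hx)
  obtain ⟨r, hr0, hr1, hr⟩ := exists_norm_bound_of_lt_one (K := K)
  have hp1 : (p : ℝ)⁻¹ < 1 := inv_lt_one_of_one_lt₀ (by exact_mod_cast hp.out.one_lt)
  have hp0 : 0 < (p : ℝ)⁻¹ := inv_pos.2 (by exact_mod_cast hp.out.pos)
  -- the key estimate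
  have key : ∀ n : ℕ, (p : ℝ)⁻¹ ^ W.card ≤ r ^ Nat.totient (p ^ (n + 1)) := by
    intro n
    set q := p ^ (n + 1) with hq
    have hqpos : 0 < q := pow_pos hp.out.pos _
    set Z := primitiveRoots q (KInf p Kbar t)
    have hZ : ∀ z, z ∈ Z ↔ IsPrimitiveRoot z q := fun z => mem_primitiveRoots hqpos
    choose! x hx using fun z hz => hfix (n + 1) z hz
    -- The value at `1` of the cyclotomic polynomial of a prime power is `p`.
    have hprod1 : ∏ z ∈ Z, (1 - z) = (p : KInf p Kbar t) := by
      have h := Polynomial.eval_one_cyclotomic_prime_pow (R := KInf p Kbar t) (p := p) n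
      rw [Polynomial.cyclotomic_eq_prod_X_sub_primitiveRoots (R.ζ_prim (n + 1)),
        Polynomial.eval_prod] at h
      simpa using h
    have hprodw : ∀ w : ℤ_[p]ˣ, ∏ z ∈ Z, (1 - padicPow (n + 1) z (w : ℤ_[p])) =
        (p : KInf p Kbar t) := by
      intro w
      rw [← hprod1]
      refine Finset.prod_bij' (fun z _ => padicPow (n + 1) z (w : ℤ_[p]))
        (fun z _ => padicPow (n + 1) z ((w⁻¹ : ℤ_[p]ˣ) : ℤ_[p])) ?_ ?_ ?_ ?_ ?_
      · exact fun z hz => (hZ _).2 (padicPow_isPrimitiveRoot ((hZ z).1 hz) w)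
      · exact fun z hz => (hZ _).2 (padicPow_isPrimitiveRoot ((hZ z).1 hz) w⁻¹)
      · intro z hz
        have h1 := ((hZ z).1 hz).pow_eq_one
        rw [← padicPow_mul h1, Units.mul_inv]
        simpa using padicPow_natCast (p := p) h1 1
      · intro z hz
        have h1 := ((hZ z).1 hz).pow_eq_one
        rw [← padicPow_mul h1, Units.inv_mul]
        simpa using padicPow_natCast (p := p) h1 1
      · exact fun _ _ => rfl
    have hprod : ∏ z ∈ Z, x z = (p : K) ^ W.card := by
      apply (algebraMap K (KInf p Kbar t)).injective
      rw [map_prod, map_pow, map_natCast, Finset.prod_congr rfl fun z hz =>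
        hx z ((hZ z).1 hz).pow_eq_one]
      simp only [y]
      rw [Finset.prod_comm, Finset.prod_congr rfl fun w _ => hprodw w, Finset.prod_const]
    have hx0 : ∀ z ∈ Z, x z ≠ 0 := by
      have : ∏ z ∈ Z, x z ≠ 0 := by
        rw [hprod]; exact pow_ne_zero _ (by exact_mod_cast hp.out.ne_zero)
      exact Finset.prod_ne_zero_iff.1 this
    -- If `z' = z ^ k`, then `1 - z' ^ w` is a multiple of `1 - z ^ w` by an algebraic integer, so
    -- the quotient of the two elements of `K` is integral. By symmetry all norms coincide.
    have hle : ∀ z ∈ Z, ∀ z' ∈ Z, ‖x z'‖ ≤ ‖x z‖ := by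
      intro z hz z' hz'
      have h1 := ((hZ z).1 hz).pow_eq_one
      have h1' := ((hZ z').1 hz').pow_eq_one
      have : NeZero q := ⟨hqpos.ne'⟩
      obtain ⟨k, _, hk⟩ := ((hZ z).1 hz).eq_pow_of_pow_eq_one h1'
      set g : KInf p Kbar t := ∏ w ∈ W, ∑ i ∈ Finset.range k, padicPow (n + 1) z (w : ℤ_[p]) ^ i
      have hg : y (n + 1) z' = g * y (n + 1) z := by
        simp only [y, g]
        rw [← Finset.prod_mul_distrib]
        refine Finset.prod_congr rfl fun w _ => ?_
        rw [geom_sum_mul_neg]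
        congr 1
        rw [← hk, padicPow, padicPow, ← pow_mul, ← pow_mul, mul_comm]
      have hgint : IsIntegral ℤ g := IsIntegral.prod _ fun w _ => IsIntegral.sum _ fun i _ =>
        (hint (n + 1) _ (padicPow_pow_eq_one h1 _)).pow i
      have hgx : algebraMap K (KInf p Kbar t) (x z' / x z) = g := by
        rw [map_div₀, hx z h1, hx z' h1', hg, mul_div_cancel_right₀]
        rw [← hx z h1]
        exact (map_ne_zero _).2 (hx0 z hz)
      have h3 := hnorm _ (hgx ▸ hgint)
      rwa [norm_div, div_le_one (norm_pos_iff.2 (hx0 z hz))] at h3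
    have hnp : ∏ z ∈ Z, ‖x z‖ = (p : ℝ)⁻¹ ^ W.card := by
      rw [← norm_prod, hprod, norm_pow, norm_natCast_p]
    -- One norm at least `1` would make all of them at least `1`, against the product `p ^ (-|W|) <
    -- 1`.
    have hlt : ∀ z ∈ Z, ‖x z‖ ≤ r := by
      intro z hz
      refine hr _ ?_
      by_contra! h
      have h2 : ∏ _z ∈ Z, (1 : ℝ) ≤ ∏ z ∈ Z, ‖x z‖ := Finset.prod_le_prod
        (fun _ _ => zero_le_one) fun z' hz' => h.trans (hle z' hz' z hz)
      rw [Finset.prod_const_one] at h2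
      rw [hnp] at h2
      exact absurd h2 (not_le.2 (pow_lt_one₀ hp0.le hp1 hWpos))
    rw [← hnp, ← (R.ζ_prim (n + 1)).card_primitiveRoots, ← Finset.prod_const]
    exact Finset.prod_le_prod (fun _ _ => norm_nonneg _) hlt
  have hlim : Tendsto (fun n : ℕ => r ^ Nat.totient (p ^ (n + 1))) atTop (𝓝 0) := by
    refine squeeze_zero (fun n => by positivity) (fun n => ?_)
      (tendsto_pow_atTop_nhds_zero_of_lt_one hr0 hr1)
    refine pow_le_pow_of_le_one hr0 hr1.le ?_
    rw [Nat.totient_prime_pow_succ hp.out]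
    exact (Nat.lt_pow_self hp.out.one_lt).le.trans
      (Nat.le_mul_of_pos_right _ (Nat.sub_pos_of_lt hp.out.one_lt))
  have := ge_of_tendsto' hlim key
  exact absurd this (not_le.2 (pow_pos hp0 _))

end Ramification

/-! ### Independence of the Kummer cocycles modulo coboundaries. -/

section Independence
variable {p : ℕ} [hp : Fact p.Prime] {K : Type u} [NormedField K] [IsUltrametricDist K]
  {Kbar : Type v} [Field Kbar] [Algebra K Kbar] {d : ℕ}

theorem IsPBasis.ne_zero {k : Type u} [Field k] [CharP k p] {b : Fin d → k} (hb : IsPBasis p b)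
    (i : Fin d) : b i ≠ 0 := by
  intro h
  have h1 := hb.1.ne_zero (Pi.single i ⟨1, hp.out.one_lt⟩)
  refine h1 (Finset.prod_eq_zero (Finset.mem_univ i) ?_)
  simp [h]

/-- A monomial that is a `p`-th power would be a scalar multiple, over the field of `p`-th powers,
of the trivial monomial. -/
theorem IsPBasis.prod_ne_pow {k : Type u} [Field k] [CharP k p] {b : Fin d → k} (hb : IsPBasis p b)
    {a : Fin d → Fin p} (ha : ∃ i, (a i : ℕ) ≠ 0) (x : k) : x ^ p ≠ ∏ i, b i ^ (a i : ℕ) := by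
  intro h
  set a0 : Fin d → Fin p := fun _ => ⟨0, hp.out.pos⟩
  have hne : a ≠ a0 := by
    rintro rfl
    obtain ⟨i, hi⟩ := ha
    exact hi rfl
  classical
  have h1 := linearIndependent_iff'.1 hb.1 {a, a0}
    (fun c => if c = a then 1 else -⟨x ^ p, x, rfl⟩) (by
      rw [Finset.sum_pair hne, if_pos rfl, if_neg hne.symm, one_smul, Subfield.smul_def]
      simp [h, a0]) a (by simp)
  simp at h1

/-- Such a relation says that a `p`-th root of a monomial in the `t_j`, corrected by a root of
unity, is fixed by `Γ`. It then lies in the valuation ring of `K`, and its residue exhibits a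
nontrivial monomial in the `p`-basis as a `p`-th power. -/
theorem not_exists_kummer_relation [CharZero K] [IsAlgClosure K Kbar]
    [CharP (IsLocalRing.ResidueField (NormedField.valuation (K := K)).valuationSubring) p]
    {t : Fin d → (NormedField.valuation (K := K)).valuationSubring}
    (ht : IsPBasis p (fun j => IsLocalRing.residue _ (t j)))
    (R : RootSystem p Kbar (fun j => (t j : K))) (a : Fin d → ℤ_[p])
    (ha : ∃ j, PadicInt.toZMod (a j) ≠ 0) (N : ℕ) (c : ℤ_[p]) :
    ¬ ∀ γ, (p : ℤ_[p]) ^ N * ∑ j, a j * R.s j γ =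
      ((chi p Kbar (fun j => (t j : K)) γ : ℤ_[p]) - 1) * c := by
  intro hrel
  have : IsGalois K (KInf p Kbar (fun j => (t j : K))) := KInf.isGalois
  have hpn : NeZero p := ⟨hp.out.ne_zero⟩
  let b : Fin d → Fin p := fun j => ⟨(PadicInt.toZMod (a j)).val, ZMod.val_lt _⟩
  have hb : ∃ j, (b j : ℕ) ≠ 0 := by
    obtain ⟨j, hj⟩ := ha
    exact ⟨j, fun h => hj ((ZMod.val_eq_zero _).1 h)⟩
  have hab : ∀ j, (p : ℤ_[p]) ∣ a j - (b j : ℕ) := fun j => by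
    rw [← Ideal.mem_span_singleton, ← PadicInt.maximalIdeal_eq_span_p, ← PadicInt.ker_toZMod,
      RingHom.mem_ker, map_sub, map_natCast, ZMod.natCast_zmod_val, sub_self]
  set n := N + 1 with hn
  have hζ := R.ζ_pow n
  -- At level `n = N + 1` the product is `∏ t_j ^ (b_j / p)`, where `b j` is the digit of `a j`
  -- modulo `p`. The factor `ζ ^ (-c)` cancels the coboundary on the right of the relation.
  set z := (∏ j, R.root j n ^ (p ^ N * b j)) * padicPow n (R.ζ n) (-c) with hz
  have hprodpow : ∀ f : Fin d → ℤ_[p],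
      ∏ j, padicPow n (R.ζ n) (f j) = padicPow n (R.ζ n) (∑ j, f j) := fun f => by
    classical
    induction (Finset.univ : Finset (Fin d)) using Finset.induction_on with
    | empty => simp [padicPow]
    | insert j s hj ih => rw [Finset.prod_insert hj, Finset.sum_insert hj, padicPow_add hζ, ih]
  obtain ⟨x, hx⟩ : ∃ x : K, algebraMap K _ x = z := by
    refine (InfiniteGalois.mem_range_algebraMap_iff_fixed z).2 fun γ => ?_
    rw [hz, map_mul, map_prod, R.apply_padicPow γ hζ]
    simp only [map_pow, R.s_spec, mul_pow, Finset.prod_mul_distrib]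
    have h1 : ∏ j, padicPow n (R.ζ n) (R.s j γ) ^ (p ^ N * (b j : ℕ)) =
        padicPow n (R.ζ n)
          (((chi p Kbar (fun j => (t j : K)) γ : ℤ_[p]) - 1) * c) := by
      have h2 : ∀ j, padicPow n (R.ζ n) (R.s j γ) ^ (p ^ N * (b j : ℕ)) =
          padicPow n (R.ζ n) (R.s j γ * ((p ^ N * (b j : ℕ) : ℕ) : ℤ_[p])) := fun j => by
        rw [padicPow_mul hζ, padicPow_natCast (padicPow_pow_eq_one hζ _)]
      rw [Finset.prod_congr rfl fun j _ => h2 j, hprodpow, ← hrel γ]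
      unfold padicPow
      congr 2
      rw [← sub_eq_zero, ← map_sub, ← RingHom.mem_ker, PadicInt.ker_toZModPow,
        Ideal.mem_span_singleton, Finset.mul_sum, ← Finset.sum_sub_distrib]
      refine Finset.dvd_sum fun j _ => ?_
      obtain ⟨e, he⟩ := hab j
      refine ⟨-(R.s j γ * e), ?_⟩
      have : a j = (b j : ℕ) + p * e := by rw [← he]; ring
      rw [this, hn, pow_succ]; push_cast; ring
    rw [h1, mul_right_comm, ← padicPow_add hζ]
    rw [mul_comm]
    congr 2
    ring
  have hxp : x ^ p ^ n = ∏ j, (t j : K) ^ (p ^ N * (b j : ℕ)) := by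
    apply (algebraMap K (KInf p Kbar (fun j => (t j : K)))).injective
    rw [map_pow, hx, hz, mul_pow, padicPow_pow_eq_one hζ, mul_one, ← Finset.prod_pow, map_prod]
    refine Finset.prod_congr rfl fun j _ => ?_
    rw [← pow_mul, mul_comm, pow_mul, R.root_pow, map_pow]
  have hxn : ‖x‖ ≤ 1 := by
    have h1 : ‖x‖ ^ p ^ n ≤ 1 := by
      rw [← norm_pow, hxp, norm_prod]
      refine Finset.prod_le_one (fun _ _ => norm_nonneg _) fun j _ => ?_
      rw [norm_pow]
      exact pow_le_one₀ (norm_nonneg _) (mem_valuationSubring_iff.1 (t j).2)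
    exact (pow_le_one_iff_of_nonneg (norm_nonneg _) (pow_ne_zero _ hp.out.ne_zero)).1 h1
  set X : (NormedField.valuation (K := K)).valuationSubring := ⟨x, mem_valuationSubring_iff.2 hxn⟩
  have hX : X ^ p ^ n = ∏ j, t j ^ (p ^ N * (b j : ℕ)) := by
    apply Subtype.coe_injective
    push_cast
    exact hxp
  have hres := congrArg (IsLocalRing.residue _) hX
  rw [map_pow, map_prod, hn, pow_succ', pow_mul] at hres
  refine ht.prod_ne_pow hb (IsLocalRing.residue _ X) ?_
  -- Frobenius is injective on the residue field, which removes the exponent `p ^ N`.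
  apply iterateFrobenius_inj _ p N
  rw [iterateFrobenius_def, iterateFrobenius_def, hres, ← Finset.prod_pow]
  refine Finset.prod_congr rfl fun j _ => ?_
  rw [map_pow, ← pow_mul, mul_comm]

end Independence

/-! ### Openness of the image of `Γ`. -/

section Openness
variable {p : ℕ} [hp : Fact p.Prime]

/-- Closed additive subgroups of `ℤ_p ^ d` are `ℤ_p`-submodules. -/
theorem smul_mem_of_isClosed {d : ℕ} (L : AddSubgroup (Fin d → ℤ_[p]))
    (hL : IsClosed (L : Set (Fin d → ℤ_[p]))) (a : ℤ_[p]) {r : Fin d → ℤ_[p]} (hr : r ∈ L) :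
    a • r ∈ L := by
  have hc : IsClosed {a : ℤ_[p] | a • r ∈ L} :=
    hL.preimage (continuous_id.smul continuous_const : Continuous fun a : ℤ_[p] => a • r)
  have hd : DenseRange (Nat.cast : ℕ → ℤ_[p]) := PadicInt.denseRange_natCast
  have : closure (Set.range (Nat.cast : ℕ → ℤ_[p])) ⊆ {a : ℤ_[p] | a • r ∈ L} := by
    refine hc.closure_subset_iff.2 ?_
    rintro _ ⟨n, rfl⟩
    change (n : ℤ_[p]) • r ∈ L
    rw [Nat.cast_smul_eq_nsmul]
    exact L.nsmul_mem hr n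
  exact this (hd a)

/-- A closed subgroup of `ℤ_p ^ d` which is killed by no primitive linear form is open. -/
theorem exists_pow_mem_of_no_linear_form {d : ℕ} (L : AddSubgroup (Fin d → ℤ_[p]))
    (hL : IsClosed (L : Set (Fin d → ℤ_[p])))
    (h : ∀ a : Fin d → ℤ_[p], (∃ j, PadicInt.toZMod (a j) ≠ 0) →
      ∃ r ∈ L, ∑ j, a j * r j ≠ 0) :
    ∃ M : ℕ, ∀ r : Fin d → ℤ_[p], (∀ j, (p : ℤ_[p]) ^ M ∣ r j) → r ∈ L := by
  have hsmul := fun a r => smul_mem_of_isClosed L hL a (r := r)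
  let ι : (Fin d → ℤ_[p]) → (Fin d → ℚ_[p]) := fun r j => (r j : ℚ_[p])
  set E := Submodule.span ℚ_[p] (ι '' L)
  have hp0 : (p : ℚ_[p]) ≠ 0 := by exact_mod_cast hp.out.ne_zero
  have hE : E = ⊤ := by
    by_contra hne
    obtain ⟨f, hf0, hf⟩ := Submodule.exists_le_ker_of_lt_top E (lt_top_iff_ne_top.2 hne)
    have hfe : ∀ v, f v = ∑ j, f (Pi.single j 1) * v j := fun v => by
      conv_lhs => rw [← Finset.univ_sum_single v, map_sum]
      refine Finset.sum_congr rfl fun j _ => ?_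
      have : Pi.single j (v j) = v j • (Pi.single j 1 : Fin d → ℚ_[p]) := by
        rw [← Pi.single_smul, smul_eq_mul, mul_one]
      rw [this, map_smul, smul_eq_mul, mul_comm]
    obtain ⟨j1, hj1⟩ : ∃ j, f (Pi.single j 1) ≠ 0 := by
      by_contra! h0
      exact hf0 (LinearMap.ext fun v => by rw [hfe]; simp [h0])
    -- Dividing a functional that kills the span by its largest coefficient makes it integral with
    -- one coefficient equal to `1`, hence primitive.
    obtain ⟨j0, -, hj0⟩ := Finset.exists_max_image Finset.univ
      (fun j => ‖f (Pi.single j 1)‖) ⟨j1, Finset.mem_univ _⟩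
    have hne0 : f (Pi.single j0 1) ≠ 0 := by
      rw [← norm_pos_iff]
      exact (norm_pos_iff.2 hj1).trans_le (hj0 j1 (Finset.mem_univ _))
    let a : Fin d → ℤ_[p] := fun j => ⟨f (Pi.single j 1) / f (Pi.single j0 1), by
      rw [norm_div, div_le_one (norm_pos_iff.2 hne0)]; exact hj0 j (Finset.mem_univ _)⟩
    have ha0 : a j0 = 1 := Subtype.coe_injective (div_self hne0)
    obtain ⟨r, hr, hr'⟩ := h a ⟨j0, by rw [ha0, map_one]; exact one_ne_zero⟩
    refine hr' (Subtype.coe_injective ?_)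
    have h1 : f (ι r) = 0 := hf (Submodule.subset_span ⟨r, hr, rfl⟩)
    rw [hfe] at h1
    change PadicInt.Coe.ringHom (∑ j, a j * r j) = PadicInt.Coe.ringHom 0
    rw [map_sum, map_zero]
    have h2 : ∀ j, PadicInt.Coe.ringHom (a j * r j) =
        (f (Pi.single j0 1))⁻¹ * (f (Pi.single j 1) * ι r j) := fun j => by
      rw [map_mul]
      change (f (Pi.single j 1) / f (Pi.single j0 1)) * (r j : ℚ_[p]) = _
      rw [div_eq_mul_inv]; ring
    rw [Finset.sum_congr rfl fun j _ => h2 j, ← Finset.mul_sum, h1, mul_zero]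
  have hden : ∀ q : ℚ_[p], ∃ (k : ℕ) (b : ℤ_[p]), (p : ℚ_[p]) ^ k * q = b := by
    intro q
    have h1 := (tendsto_p_pow (p := p)).mul_const q
    rw [zero_mul] at h1
    have h2 := h1.norm
    rw [norm_zero] at h2
    obtain ⟨k, hk⟩ := (h2.eventually (eventually_le_nhds one_pos)).exists
    exact ⟨k, ⟨_, hk⟩, rfl⟩
  -- Denominators are cleared by powers of `p`; stability of `L` under `ℤ_p` keeps the result in
  -- `L`.
  have hspan : ∀ v ∈ E, ∃ M : ℕ, ∃ r ∈ L, (p : ℚ_[p]) ^ M • v = ι r := by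
    intro v hv
    induction hv using Submodule.span_induction with
    | mem x hx => obtain ⟨r, hr, rfl⟩ := hx; exact ⟨0, r, hr, by simp⟩
    | zero => exact ⟨0, 0, L.zero_mem, by simp [ι]; rfl⟩
    | add x y _ _ hx hy =>
      obtain ⟨M, r, hr, h1⟩ := hx
      obtain ⟨M', r', hr', h2⟩ := hy
      refine ⟨M + M', (p : ℤ_[p]) ^ M' • r + (p : ℤ_[p]) ^ M • r',
        L.add_mem (hsmul _ _ hr) (hsmul _ _ hr'), ?_⟩
      have e : (p : ℚ_[p]) ^ (M + M') • (x + y) =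
          (p : ℚ_[p]) ^ M' • ((p : ℚ_[p]) ^ M • x) + (p : ℚ_[p]) ^ M • ((p : ℚ_[p]) ^ M' • y) := by
        rw [smul_smul, smul_smul, smul_add, ← pow_add, ← pow_add, add_comm M' M]
      rw [e, h1, h2]
      funext j
      simp [ι]
    | smul q x _ hx =>
      obtain ⟨M, r, hr, h1⟩ := hx
      obtain ⟨k, b, hb⟩ := hden q
      refine ⟨M + k, b • r, hsmul _ _ hr, ?_⟩
      have e : (p : ℚ_[p]) ^ (M + k) • q • x =
          ((p : ℚ_[p]) ^ k * q) • ((p : ℚ_[p]) ^ M • x) := by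
        rw [smul_smul, smul_smul, pow_add]; congr 1; ring
      rw [e, h1, hb]
      funext j
      simp [ι]
  choose M r hr hMr using fun j : Fin d => hspan (Pi.single j 1) (hE ▸ Submodule.mem_top)
  -- The sum is a common bound for all the exponents `M j`.
  refine ⟨∑ j, M j, fun b hb => ?_⟩
  choose e he using hb
  have hb' : b = ∑ j, (e j * (p : ℤ_[p]) ^ (∑ i, M i - M j)) • r j := by
    have hinj : Function.Injective ι := fun x y hxy => funext fun j =>
      Subtype.coe_injective (congrFun hxy j)
    apply hinj
    have h1 : ι (∑ j, (e j * (p : ℤ_[p]) ^ (∑ i, M i - M j)) • r j) =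
        ∑ j, ((e j : ℚ_[p]) * (p : ℚ_[p]) ^ (∑ i, M i - M j)) • ι (r j) := by
      funext i
      change PadicInt.Coe.ringHom _ = _
      rw [Finset.sum_apply, map_sum, Finset.sum_apply]
      refine Finset.sum_congr rfl fun j _ => ?_
      change (((e j * (p : ℤ_[p]) ^ (∑ i, M i - M j)) * r j i : ℤ_[p]) : ℚ_[p]) = _
      push_cast; rfl
    rw [h1]
    have h2 : ∀ j, ((e j : ℚ_[p]) * (p : ℚ_[p]) ^ (∑ i, M i - M j)) • ι (r j) =
        Pi.single j (b j : ℚ_[p]) := fun j => by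
      have hle : M j ≤ ∑ i, M i :=
        Finset.single_le_sum (fun _ _ => Nat.zero_le _) (Finset.mem_univ j)
      rw [← hMr, smul_smul, mul_assoc, ← pow_add, Nat.sub_add_cancel hle, ← Pi.single_smul,
        smul_eq_mul, mul_one]
      congr 1
      rw [he j]; push_cast; ring
    rw [Finset.sum_congr rfl fun j _ => h2 j, Finset.univ_sum_single (fun j => (b j : ℚ_[p]))]
  rw [hb']
  exact L.sum_mem fun j _ => hsmul _ _ (hr j)

/-- A compact group with a character and cocycles has open image in `ℤ_p^× ⋉ ℤ_p^d` as soon as the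
character is infinite and the cocycles are independent modulo coboundaries. -/
theorem isAffineGroup_of_independent {G : Type*} [Group G] [TopologicalSpace G]
    [IsTopologicalGroup G] [CompactSpace G] {d : ℕ} {χ : G →* ℤ_[p]ˣ} {s : Fin d → G → ℤ_[p]}
    (hχ : Continuous χ) (hs : ∀ j, Continuous (s j))
    (hmul : ∀ j g h, s j (g * h) = s j g + (χ g : ℤ_[p]) * s j h)
    (hinj : ∀ g h, χ g = χ h → (∀ j, s j g = s j h) → g = h)
    (hinf : ∀ m : ℕ, m ≠ 0 → ∃ g, χ g ^ m ≠ 1)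
    (hind : ∀ (a : Fin d → ℤ_[p]), (∃ j, PadicInt.toZMod (a j) ≠ 0) → ∀ (N : ℕ) (c : ℤ_[p]),
      ¬ ∀ g, (p : ℤ_[p]) ^ N * ∑ j, a j * s j g = ((χ g : ℤ_[p]) - 1) * c) :
    IsAffineGroup χ s := by
  refine ⟨hχ, hs, hmul, hinj, ?_⟩
  have hs1 : ∀ j, s j 1 = 0 := fun j => by
    have := hmul j 1 1
    rw [mul_one, map_one, Units.val_one, one_mul] at this
    simpa using this
  -- The exponent `2 (p - 1)` moves `χ g1` into the domain of the logarithm without making it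
  -- trivial.
  obtain ⟨g1, hg1⟩ := hinf _ (two_mul_p_sub_one_ne_zero (p := p))
  have hχ1 : (χ g1 : ℤ_[p]) - 1 ≠ 0 := by
    intro h
    refine hg1 ?_
    have : χ g1 = 1 := Units.ext (sub_eq_zero.1 h)
    rw [this, one_pow]
  -- the translations contained in `G`
  let L : AddSubgroup (Fin d → ℤ_[p]) :=
    { carrier := {r | ∃ h : G, χ h = 1 ∧ ∀ j, s j h = r j}
      zero_mem' := ⟨1, map_one _, hs1⟩
      add_mem' := by
        rintro r r' ⟨h, h1, h2⟩ ⟨h', h1', h2'⟩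
        refine ⟨h * h', by rw [map_mul, h1, h1', one_mul], fun j => ?_⟩
        rw [hmul, h1, h2, h2', Units.val_one, one_mul]; rfl
      neg_mem' := by
        rintro r ⟨h, h1, h2⟩
        refine ⟨h⁻¹, by rw [map_inv, h1, inv_one], fun j => ?_⟩
        have := hmul j h h⁻¹
        rw [mul_inv_cancel, hs1, h1, h2, Units.val_one, one_mul] at this
        exact (neg_eq_of_add_eq_zero_right this.symm).symm }
  have hL : IsClosed (L : Set (Fin d → ℤ_[p])) := by
    have h1 : (L : Set (Fin d → ℤ_[p])) = (fun g j => s j g) '' {h | χ h = 1} := by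
      ext r
      constructor
      · rintro ⟨h, h1, h2⟩; exact ⟨h, h1, funext h2⟩
      · rintro ⟨h, h1, rfl⟩; exact ⟨h, h1, fun _ => rfl⟩
    rw [h1]
    exact ((isClosed_eq hχ continuous_const).isCompact.image (continuous_pi hs)).isClosed
  obtain ⟨M, hM⟩ := exists_pow_mem_of_no_linear_form L hL (fun a ha => by
    by_contra! hL0
    set f : G → ℤ_[p] := fun g => ∑ j, a j * s j g with hf
    have hfmul : ∀ g h, f (g * h) = f g + (χ g : ℤ_[p]) * f h := fun g h => by
      simp only [hf, hmul, mul_add, Finset.sum_add_distrib, Finset.mul_sum]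
      congr 1
      exact Finset.sum_congr rfl fun j _ => by ring
    have hf0 : ∀ h, χ h = 1 → f h = 0 := fun h hh => hL0 (fun j => s j h) ⟨h, hh, fun _ => rfl⟩
    -- The commutator of `g` and `g1` has trivial character, and `f` vanishes on such elements.
    -- Expanding both sides shows that `f` is a coboundary up to the scalar `χ(g1) - 1`.
    have hcomm : ∀ g, f (g * g1) = f (g1 * g) := fun g => by
      have h1 : g * g1 = (g * g1 * (g1 * g)⁻¹) * (g1 * g) := by group
      have h2 : χ (g * g1 * (g1 * g)⁻¹) = 1 := by
        rw [map_mul, map_inv, map_mul, map_mul, mul_comm (χ g1), mul_inv_cancel]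
      rw [h1, hfmul, hf0 _ h2, h2, Units.val_one, one_mul, zero_add]
    have hrel : ∀ g, ((χ g1 : ℤ_[p]) - 1) * f g = ((χ g : ℤ_[p]) - 1) * f g1 := fun g => by
      have := hcomm g
      rw [hfmul, hfmul] at this
      linear_combination -this
    set e := (χ g1 : ℤ_[p]) - 1
    have he := PadicInt.unitCoeff_spec hχ1
    -- Dividing by the unit part of `χ(g1) - 1` leaves the power of `p` required by `hind`.
    refine hind a ha e.valuation ((PadicInt.unitCoeff hχ1)⁻¹ * f g1) fun g => ?_
    have h3 : (p : ℤ_[p]) ^ e.valuation = ((PadicInt.unitCoeff hχ1)⁻¹ : ℤ_[p]ˣ) * e := by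
      have h4 := congrArg (fun z : ℤ_[p] => (((PadicInt.unitCoeff hχ1)⁻¹ : ℤ_[p]ˣ) : ℤ_[p]) * z) he
      simp only [Units.inv_mul_cancel_left] at h4
      exact h4.symm
    rw [h3]
    linear_combination ((PadicInt.unitCoeff hχ1)⁻¹ : ℤ_[p]ˣ) * hrel g)
  -- the subgroup of elements with small translation part
  have hdvd_closed : ∀ j, IsClosed {g : G | (p : ℤ_[p]) ^ M ∣ s j g} := fun j => by
    have h1 : {g : G | (p : ℤ_[p]) ^ M ∣ s j g} =
        s j ⁻¹' {x : ℤ_[p] | ‖x‖ ≤ (p : ℝ) ^ (-M : ℤ)} := by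
      ext g
      simp only [Set.mem_ofPred_eq, Set.mem_preimage, PadicInt.norm_le_pow_iff_mem_span_pow,
        Ideal.mem_span_singleton]
    rw [h1]
    exact (isClosed_le continuous_norm continuous_const).preimage (hs j)
  set C : Set G := ⋂ j, {g : G | (p : ℤ_[p]) ^ M ∣ s j g}
  have hC : IsClosed C := isClosed_iInter hdvd_closed
  have hCmem : ∀ g, g ∈ C ↔ ∀ j, (p : ℤ_[p]) ^ M ∣ s j g := fun g => Set.mem_iInter
  have hCpow : ∀ g ∈ C, ∀ k : ℕ, g ^ k ∈ C := by
    intro g hg k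
    induction k with
    | zero => rw [hCmem]; intro j; rw [pow_zero, hs1]; exact dvd_zero _
    | succ k ih =>
      rw [hCmem] at hg ih ⊢
      intro j
      rw [pow_succ, hmul]
      exact dvd_add (ih j) (dvd_mul_of_dvd_right (hg j) _)
  set g2 := g1 ^ (2 * (p - 1))
  have hg2 : ‖((χ g2 : ℤ_[p]) : ℚ_[p]) - 1‖ ≤ ‖(2 * p : ℚ_[p])‖ := by
    rw [map_pow]; exact norm_unit_pow_sub_one_le _
  have hg2s : ∀ (j : Fin d) (k : ℕ),
      s j (g2 ^ k) = (∑ i ∈ Finset.range k, (χ g2 : ℤ_[p]) ^ i) * s j g2 := by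
    intro j k
    induction k with
    | zero => simp [hs1]
    | succ k ih =>
      rw [pow_succ, hmul, ih, Finset.sum_range_succ, add_mul, map_pow χ g2 k, Units.val_pow_eq_pow_val]
  have hpdvd : (p : ℤ_[p]) ∣ (χ g2 : ℤ_[p]) - 1 :=
    (dvd_mul_left _ _).trans (norm_coe_sub_one_le_iff.1 hg2)
  obtain ⟨k, hk0, hk⟩ : ∃ k : ℕ, k ≠ 0 ∧ g2 ^ k ∈ C := by
    -- The cocycle on `g2 ^ k` is a geometric sum in `χ g2` times its value on `g2`. As `χ g2 ≡ 1`
    -- modulo `p`, passing from `p ^ n` to `p ^ (n + 1)` terms multiplies this sum by `p` terms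
    -- congruent to `1`, hence by a multiple of `p`.
    have hstep : ∀ n : ℕ, (p : ℤ_[p]) ^ n ∣ ∑ i ∈ Finset.range (p ^ n), (χ g2 : ℤ_[p]) ^ i := by
      intro n
      have h1 : ∀ n : ℕ, (p : ℤ_[p]) ^ (n + 1) ∣ (χ g2 : ℤ_[p]) ^ p ^ n - 1 := fun n => by
        have := dvd_sub_pow_of_dvd_sub hpdvd n
        simpa using this
      induction n with
      | zero => simp
      | succ n ih =>
        have h2 : ∑ i ∈ Finset.range (p ^ (n + 1)), (χ g2 : ℤ_[p]) ^ i =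
            (∑ i ∈ Finset.range (p ^ n), (χ g2 : ℤ_[p]) ^ i) *
              ∑ i ∈ Finset.range p, ((χ g2 : ℤ_[p]) ^ p ^ n) ^ i := by
          have hne : (χ g2 : ℤ_[p]) - 1 ≠ 0 := by
            intro h
            refine hg1 (Units.ext ?_)
            rw [← map_pow]; exact sub_eq_zero.1 h
          apply mul_right_cancel₀ hne
          rw [geom_sum_mul, mul_right_comm, geom_sum_mul, mul_comm, geom_sum_mul, ← pow_mul,
            pow_succ]
        rw [h2, pow_succ]
        refine mul_dvd_mul ih ?_
        have h3 : ∑ i ∈ Finset.range p, ((χ g2 : ℤ_[p]) ^ p ^ n) ^ i =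
            ∑ i ∈ Finset.range p, (((χ g2 : ℤ_[p]) ^ p ^ n) ^ i - 1) + p := by
          rw [Finset.sum_sub_distrib]; simp
        rw [h3]
        refine dvd_add (Finset.dvd_sum fun i _ => ?_) (dvd_refl _)
        exact ((dvd_pow_self _ n.succ_ne_zero).trans (h1 n)).trans
          (by simpa using sub_dvd_pow_sub_pow ((χ g2 : ℤ_[p]) ^ p ^ n) 1 i)
    refine ⟨p ^ M, pow_ne_zero _ hp.out.ne_zero, (hCmem _).2 fun j => ?_⟩
    rw [hg2s]
    exact (hstep M).mul_right _
  set g3 := g2 ^ k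
  have hg3 : ‖((χ g3 : ℤ_[p]) : ℚ_[p]) - 1‖ ≤ ‖(2 * p : ℚ_[p])‖ := by
    have := (plog_pow hg2 k).1
    rw [map_pow]
    push_cast
    exact this
  have hg3' : ((χ g3 : ℤ_[p]) : ℚ_[p]) - 1 ≠ 0 := by
    intro h
    have h1 := plog_pow hg2 k
    have h2 : ((χ g3 : ℤ_[p]) : ℚ_[p]) = ((χ g2 : ℤ_[p]) : ℚ_[p]) ^ k := by
      rw [map_pow]; push_cast; rfl
    rw [← h2, sub_eq_zero.1 h, plog_one] at h1
    have h3 : plog ((χ g2 : ℤ_[p]) : ℚ_[p]) = 0 :=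
      (mul_eq_zero.1 h1.2.symm).resolve_left (by exact_mod_cast hk0)
    have h4 := norm_plog hg2
    rw [h3, norm_zero] at h4
    refine hg1 (Units.ext (Subtype.coe_injective ?_))
    rw [← map_pow]
    exact sub_eq_zero.1 (norm_eq_zero.1 h4.symm)
  obtain ⟨M', hM'⟩ : ∃ M' : ℕ, ‖(p : ℚ_[p]) ^ M'‖ ≤ ‖((χ g3 : ℤ_[p]) : ℚ_[p]) - 1‖ := by
    have h2 := (tendsto_p_pow (p := p)).norm
    rw [norm_zero] at h2
    exact (h2.eventually (eventually_le_nhds (norm_pos_iff.2 hg3'))).exists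
  have hclosed : IsClosed (χ '' C) := (hC.isCompact.image hχ).isClosed
  -- The bound `M` controls translations; `M'` puts `x` at least as close to `1` as `χ g3`.
  refine ⟨max M M', fun x r hx hr => ?_⟩
  have hx' : ‖((x : ℤ_[p]) : ℚ_[p]) - 1‖ ≤ ‖((χ g3 : ℤ_[p]) : ℚ_[p]) - 1‖ := by
    refine le_trans ?_ hM'
    obtain ⟨y, hy⟩ := (pow_dvd_pow _ (le_max_right M M')).trans hx
    have : ((x : ℤ_[p]) : ℚ_[p]) - 1 = (p : ℚ_[p]) ^ M' * y := by
      have := congrArg (fun z : ℤ_[p] => (z : ℚ_[p])) hy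
      simpa using this
    rw [this, norm_mul]
    exact mul_le_of_le_one_right (norm_nonneg _) y.2
  -- The compact set `χ '' C` contains the powers of `χ g3` and so their limit `x`. A lift in `C`
  -- has small translation part, which is then corrected by an element of the kernel of `χ`.
  obtain ⟨a, ha⟩ := exists_tendsto_pow hg3 hx'
  obtain ⟨g, hgC, hg⟩ : x ∈ χ '' C := by
    refine hclosed.mem_of_tendsto ha (Eventually.of_forall fun n => ?_)
    exact ⟨g3 ^ a n, hCpow _ hk _, map_pow _ _ _⟩
  rw [hCmem] at hgC
  obtain ⟨h, hh1, hh2⟩ := hM (fun j => r j - s j g) fun j =>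
    dvd_sub ((pow_dvd_pow _ (le_max_left M M')).trans (hr j)) (hgC j)
  refine ⟨h * g, by rw [map_mul, hh1, one_mul, hg], fun j => ?_⟩
  rw [hmul, hh1, hh2, Units.val_one, one_mul, sub_add_cancel]

theorem RootSystem.isAffineGroup {K : Type u} [NormedField K] [IsUltrametricDist K]
    [NormedAlgebra ℚ_[p] K]
    [IsDiscreteValuationRing (NormedField.valuation (K := K)).valuationSubring]
    [CharP (IsLocalRing.ResidueField (NormedField.valuation (K := K)).valuationSubring) p]
    {Kbar : Type v} [Field Kbar] [Algebra K Kbar] [IsAlgClosure K Kbar] {d : ℕ}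
    {t : Fin d → (NormedField.valuation (K := K)).valuationSubring}
    (ht : IsPBasis p (fun j => IsLocalRing.residue _ (t j)))
    (R : RootSystem p Kbar (fun j => (t j : K))) :
    IsAffineGroup (chi p Kbar (fun j => (t j : K))) R.s := by
  have : CharZero K := charZero_of_normedAlgebra p K
  have : IsGalois K (KInf p Kbar (fun j => (t j : K))) := KInf.isGalois
  have ht0 : ∀ j, (t j : K) ≠ 0 := fun j h => ht.ne_zero j (by
    have : t j = 0 := Subtype.coe_injective h
    rw [this, map_zero])
  exact isAffineGroup_of_independent (cyclotomicCharacter.continuous p K _)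
    (R.continuous_s ht0) (R.s_mul ht0) (fun _ _ h1 h2 => R.injective ht0 h1 h2)
    (fun m hm => exists_chi_pow_ne_one R hm) (not_exists_kummer_relation ht R)

end Openness

/-- The Jordan decomposition of the operators of a representation: `X_0` acts as the sum of `S`
(diagonalizable with integral eigenvalues) and `N` (nilpotent), and `X_j` acts as `y j`. -/
structure SplitData (K : Type*) [Field K] (V : Type*) [AddCommGroup V] [Module K V] (d : ℕ) where
  S : Module.End K V
  N : Module.End K V
  y : Fin d → Module.End K V
  diag : IsIntDiag S
  nilp_N : IsNilpotent N
  nilp_y : ∀ j, IsNilpotent (y j)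
  comm_y : ∀ i j, Commute (y i) (y j)
  comm_SN : Commute S N
  comm_Ny : ∀ j, Commute N (y j)
  S_mul_y : ∀ j, S * y j = y j * S + y j

/-! ### Split data and the group law of their operators. -/

namespace SplitData
variable {K : Type*} [Field K] {V W : Type*} [AddCommGroup V] [Module K V]
  [AddCommGroup W] [Module K W] {d : ℕ}

/-- The operator of `∑ r_j X_j`. -/
def Y (D : SplitData K V d) (r : Fin d → K) : Module.End K V := ∑ j, r j • D.y j

theorem Y_add (D : SplitData K V d) (r r' : Fin d → K) : D.Y (r + r') = D.Y r + D.Y r' := by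
  simp only [Y, Pi.add_apply, add_smul, Finset.sum_add_distrib]

theorem Y_smul (D : SplitData K V d) (c : K) (r : Fin d → K) : D.Y (c • r) = c • D.Y r := by
  simp only [Y, Pi.smul_apply, smul_eq_mul, mul_smul, Finset.smul_sum]

theorem Y_zero (D : SplitData K V d) : D.Y 0 = 0 := by simp [Y]

theorem Y_single (D : SplitData K V d) (j : Fin d) (c : K) : D.Y (Pi.single j c) = c • D.y j := by
  rw [Y, Finset.sum_eq_single j]
  · rw [Pi.single_eq_same]
  · intro i _ hi; rw [Pi.single_eq_of_ne hi, zero_smul]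
  · exact fun h => absurd (Finset.mem_univ _) h

theorem Y_commute (D : SplitData K V d) (r r' : Fin d → K) : Commute (D.Y r) (D.Y r') :=
  Commute.sum_left _ _ _ fun i _ => Commute.sum_right _ _ _ fun j _ =>
    ((D.comm_y i j).smul_left _).smul_right _

theorem N_commute_Y (D : SplitData K V d) (r : Fin d → K) : Commute D.N (D.Y r) :=
  Commute.sum_right _ _ _ fun j _ => (D.comm_Ny j).smul_right _

theorem isNilpotent_sum_of_commute {A ι : Type*} [Ring A] (s : Finset ι) (a : ι → A)
    (ha : ∀ i, IsNilpotent (a i)) (hc : ∀ i j, Commute (a i) (a j)) :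
    IsNilpotent (∑ i ∈ s, a i) := by
  classical
  induction s using Finset.induction_on with
  | empty => exact ⟨1, by simp⟩
  | insert i s hi ih =>
    rw [Finset.sum_insert hi]
    exact (Commute.sum_right _ _ _ fun j _ => hc i j).isNilpotent_add (ha i) ih

theorem Y_nilpotent (D : SplitData K V d) (r : Fin d → K) : IsNilpotent (D.Y r) :=
  isNilpotent_sum_of_commute _ _ (fun j => (D.nilp_y j).smul (r j))
    fun i j => ((D.comm_y i j).smul_left _).smul_right _

theorem S_mul_Y (D : SplitData K V d) (r : Fin d → K) : D.S * D.Y r = D.Y r * D.S + D.Y r := by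
  simp only [Y, Finset.mul_sum, Finset.sum_mul, ← Finset.sum_add_distrib]
  refine Finset.sum_congr rfl fun j _ => ?_
  rw [mul_smul_comm, smul_mul_assoc, D.S_mul_y, smul_add]

theorem smulN_nilpotent (D : SplitData K V d) (l : K) : IsNilpotent (l • D.N) := D.nilp_N.smul l

variable [FiniteDimensional K V] [FiniteDimensional K W] [CharZero K]

/-- The operator `x ^ S`. -/
def pow (D : SplitData K V d) (x : Kˣ) : Module.End K V :=
  intFun D.S fun n => ((x ^ n : Kˣ) : K)

theorem pow_apply (D : SplitData K V d) (x : Kˣ) {n : ℤ} {v : V} (h : D.S v = (n : K) • v) :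
    D.pow x v = ((x ^ n : Kˣ) : K) • v := intFun_apply h _

theorem pow_mul (D : SplitData K V d) (x x' : Kˣ) : D.pow (x * x') = D.pow x * D.pow x' := by
  rw [pow, pow, pow, ← D.diag.intFun_mul]
  congr 1; funext n; rw [mul_zpow, Units.val_mul]

theorem pow_one (D : SplitData K V d) : D.pow 1 = 1 := by
  rw [pow, ← D.diag.intFun_one]
  congr 1; funext n; rw [one_zpow, Units.val_one]

theorem pow_mul_pow_inv (D : SplitData K V d) (x : Kˣ) : D.pow x * D.pow x⁻¹ = 1 := by
  rw [← D.pow_mul, mul_inv_cancel, D.pow_one]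

theorem pow_inv_mul_pow (D : SplitData K V d) (x : Kˣ) : D.pow x⁻¹ * D.pow x = 1 := by
  rw [← D.pow_mul, inv_mul_cancel, D.pow_one]

theorem pow_commute (D : SplitData K V d) (x : Kˣ) {T : Module.End K V} (h : Commute D.S T) :
    Commute (D.pow x) T := intFun_commute h _

/-- Since `Y` raises the eigenvalues of `S` by one, conjugation by `x ^ S` multiplies it by `x`. -/
theorem pow_mul_Y (D : SplitData K V d) (x : Kˣ) (r : Fin d → K) :
    D.pow x * D.Y r = D.Y ((x : K) • r) * D.pow x := by
  have h := D.diag.intFun_intertwine (S' := D.S) (f := D.Y r) 1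
    (by simpa [Module.End.mul_eq_comp] using D.S_mul_Y r) (fun n => ((x ^ n : Kˣ) : K))
  rw [Y_smul, smul_mul_assoc]
  change D.pow x * D.Y r = _ at h
  rw [h]
  change D.Y r * _ = _
  rw [← mul_smul_comm]
  congr 1
  exact D.diag.ext fun n v hv => by
    rw [intFun_apply hv, LinearMap.smul_apply, D.pow_apply x hv, smul_smul, zpow_add, zpow_one,
      mul_comm, Units.val_mul, mul_comm]

theorem pow_mul_nexp_Y (D : SplitData K V d) (x : Kˣ) (r : Fin d → K) :
    D.pow x * nexp K (D.Y r) = nexp K (D.Y ((x : K) • r)) * D.pow x :=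
  nexp_mul_of_mul_eq K (D.Y_nilpotent _) (D.Y_nilpotent _) (D.pow_mul_Y x r)

/-- The operator `exp (∑ r_j y_j) x ^ S exp (l N)`. -/
def op (D : SplitData K V d) (x : Kˣ) (r : Fin d → K) (l : K) : Module.End K V :=
  nexp K (D.Y r) * D.pow x * nexp K (l • D.N)

theorem op_one (D : SplitData K V d) : D.op 1 0 0 = 1 := by
  rw [op, Y_zero, zero_smul, nexp_zero, pow_one, one_mul, one_mul]

/-- The pair `(x, r)` obeys the semidirect product law because of `pow_mul_Y`. The factor in `N`
commutes with the others, so `l` is a free additive parameter, later set to the logarithm of `x`. -/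
theorem op_mul (D : SplitData K V d) (x x' : Kˣ) (r r' : Fin d → K) (l l' : K) :
    D.op x r l * D.op x' r' l' = D.op (x * x') (r + (x : K) • r') (l + l') := by
  have h1 : Commute (nexp K (l • D.N)) (nexp K (D.Y r')) :=
    nexp_commute K (D.Y_nilpotent _)
      (nexp_commute K (D.smulN_nilpotent l) ((D.N_commute_Y r').symm.smul_right l)).symm
  have h2 : Commute (nexp K (l • D.N)) (D.pow x') :=
    (D.pow_commute x' (nexp_commute K (D.smulN_nilpotent l) (D.comm_SN.smul_right l))).symm
  rw [op, op, op, D.Y_add, nexp_add K (D.Y_commute _ _) (D.Y_nilpotent _) (D.Y_nilpotent _),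
    D.pow_mul, add_smul, nexp_add K (((Commute.refl D.N).smul_left l).smul_right l')
      (D.smulN_nilpotent l) (D.smulN_nilpotent l')]
  calc nexp K (D.Y r) * D.pow x * nexp K (l • D.N) *
        (nexp K (D.Y r') * D.pow x' * nexp K (l' • D.N))
      = nexp K (D.Y r) * D.pow x * (nexp K (l • D.N) * nexp K (D.Y r')) * D.pow x' *
        nexp K (l' • D.N) := by simp only [mul_assoc]
    _ = nexp K (D.Y r) * (D.pow x * nexp K (D.Y r')) * (nexp K (l • D.N) * D.pow x') *
        nexp K (l' • D.N) := by rw [h1.eq]; simp only [mul_assoc]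
    _ = _ := by rw [h2.eq, D.pow_mul_nexp_Y]; simp only [mul_assoc]

/-- Maps that intertwine the data intertwine the operators. -/
theorem op_intertwine {D : SplitData K V d} {D' : SplitData K W d} {f : V →ₗ[K] W}
    (hS : D'.S ∘ₗ f = f ∘ₗ D.S) (hN : D'.N ∘ₗ f = f ∘ₗ D.N)
    (hy : ∀ j, D'.y j ∘ₗ f = f ∘ₗ D.y j) (x : Kˣ) (r : Fin d → K) (l : K) :
    D'.op x r l ∘ₗ f = f ∘ₗ D.op x r l := by
  have h1 : nexp K (D'.Y r) ∘ₗ f = f ∘ₗ nexp K (D.Y r) := by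
    refine nexp_intertwine K (D.Y_nilpotent r) (D'.Y_nilpotent r) (LinearMap.ext fun v => ?_)
    simp only [Y, LinearMap.comp_apply, LinearMap.sum_apply, LinearMap.smul_apply, map_sum,
      map_smul]
    exact Finset.sum_congr rfl fun j _ => congrArg _ (LinearMap.congr_fun (hy j) v)
  have h2 : D'.pow x ∘ₗ f = f ∘ₗ D.pow x := by
    have := D.diag.intFun_intertwine (S' := D'.S) (f := f) 0
      (by rw [Int.cast_zero, zero_smul, add_zero]; exact hS) (fun n => ((x ^ n : Kˣ) : K))
    simp only [add_zero] at this
    exact this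
  have h3 : nexp K (l • D'.N) ∘ₗ f = f ∘ₗ nexp K (l • D.N) :=
    nexp_intertwine K (D.smulN_nilpotent l) (D'.smulN_nilpotent l)
      (by rw [LinearMap.smul_comp, hN, LinearMap.comp_smul])
  refine LinearMap.ext fun v => ?_
  have e1 := fun v => LinearMap.congr_fun h1 v
  have e2 := fun v => LinearMap.congr_fun h2 v
  have e3 := fun v => LinearMap.congr_fun h3 v
  simp only [LinearMap.comp_apply] at e1 e2 e3
  simp only [op, Module.End.mul_apply, LinearMap.comp_apply]
  rw [e3, e2, e1]

/-- Data on the tensor product. -/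
def tensor (D : SplitData K V d) (D' : SplitData K W d) : SplitData K (V ⊗[K] W) d where
  S := D.S.rTensor W + D'.S.lTensor V
  N := D.N.rTensor W + D'.N.lTensor V
  y j := (D.y j).rTensor W + (D'.y j).lTensor V
  diag := D.diag.tensor D'.diag
  nilp_N := by
    refine Commute.isNilpotent_add ?_ (D.nilp_N.map (Module.End.rTensorAlgHom K V W))
      (D'.nilp_N.map (Module.End.lTensorAlgHom K W V))
    exact TensorProduct.ext' fun a b => by simp
  nilp_y j := by
    refine Commute.isNilpotent_add ?_ ((D.nilp_y j).map (Module.End.rTensorAlgHom K V W))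
      ((D'.nilp_y j).map (Module.End.lTensorAlgHom K W V))
    exact TensorProduct.ext' fun a b => by simp
  comm_y i j := TensorProduct.ext' fun a b => by
    have h1 := LinearMap.congr_fun (D.comm_y i j).eq a
    have h2 := LinearMap.congr_fun (D'.comm_y i j).eq b
    simp only [Module.End.mul_apply] at h1 h2
    simp [h1, h2]; abel
  comm_SN := TensorProduct.ext' fun a b => by
    have h1 := LinearMap.congr_fun D.comm_SN.eq a
    have h2 := LinearMap.congr_fun D'.comm_SN.eq b
    simp only [Module.End.mul_apply] at h1 h2
    simp [h1, h2]; abel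
  comm_Ny j := TensorProduct.ext' fun a b => by
    have h1 := LinearMap.congr_fun (D.comm_Ny j).eq a
    have h2 := LinearMap.congr_fun (D'.comm_Ny j).eq b
    simp only [Module.End.mul_apply] at h1 h2
    simp [h1, h2]; abel
  S_mul_y j := TensorProduct.ext' fun a b => by
    have h1 := LinearMap.congr_fun (D.S_mul_y j) a
    have h2 := LinearMap.congr_fun (D'.S_mul_y j) b
    simp only [Module.End.mul_apply, LinearMap.add_apply] at h1 h2
    simp [h1, h2, TensorProduct.add_tmul, TensorProduct.tmul_add]; abel

theorem nexp_tensor {a : Module.End K V} {b : Module.End K W} (ha : IsNilpotent a)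
    (hb : IsNilpotent b) :
    nexp K (a.rTensor W + b.lTensor V) = TensorProduct.map (nexp K a) (nexp K b) := by
  have h1 := nexp_map (Module.End.rTensorAlgHom K V W) ha
  have h2 := nexp_map (Module.End.lTensorAlgHom K W V) hb
  have hc : Commute (a.rTensor W) (b.lTensor V) := TensorProduct.ext' fun a b => by simp
  rw [nexp_add K hc (ha.map (Module.End.rTensorAlgHom K V W))
    (hb.map (Module.End.lTensorAlgHom K W V))]
  change (Module.End.rTensorAlgHom K V W) (nexp K a) = nexp K (a.rTensor W) at h1
  change (Module.End.lTensorAlgHom K W V) (nexp K b) = nexp K (b.lTensor V) at h2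
  rw [← h1, ← h2]
  exact TensorProduct.ext' fun a b => rfl

theorem tensor_op (D : SplitData K V d) (D' : SplitData K W d) (x : Kˣ) (r : Fin d → K) (l : K) :
    (D.tensor D').op x r l = TensorProduct.map (D.op x r l) (D'.op x r l) := by
  have h1 : (D.tensor D').Y r = (D.Y r).rTensor W + (D'.Y r).lTensor V :=
    TensorProduct.ext' fun a b => by
      simp [Y, tensor, LinearMap.sum_apply, TensorProduct.sum_tmul, TensorProduct.tmul_sum,
        Finset.sum_add_distrib, TensorProduct.smul_tmul']
  have h2 : (D.tensor D').pow x = TensorProduct.map (D.pow x) (D'.pow x) := by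
    refine TensorProduct.ext ?_
    refine D.diag.ext fun n a ha => ?_
    refine D'.diag.ext fun m b hb => ?_
    have hab : (D.tensor D').S (a ⊗ₜ b) = ((n + m : ℤ) : K) • (a ⊗ₜ[K] b) := by
      simp [tensor, ha, hb, TensorProduct.smul_tmul', add_smul]
    change (D.tensor D').pow x (a ⊗ₜ b) = TensorProduct.map _ _ (a ⊗ₜ b)
    rw [TensorProduct.map_tmul]
    rw [pow_apply _ _ hab, D.pow_apply x ha, D'.pow_apply x hb, TensorProduct.smul_tmul_smul,
      zpow_add, Units.val_mul]
  have h3 : l • (D.tensor D').N = (l • D.N).rTensor W + (l • D'.N).lTensor V := by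
    simp [tensor, LinearMap.rTensor_smul, LinearMap.lTensor_smul]
  rw [op, op, op, h1, h2, h3, nexp_tensor (D.Y_nilpotent r) (D'.Y_nilpotent r),
    nexp_tensor (D.smulN_nilpotent l) (D'.smulN_nilpotent l)]
  exact TensorProduct.ext' fun a b => by simp

variable (K V d) in
/-- The trivial data. -/
def trivial : SplitData K V d where
  S := 0
  N := 0
  y _ := 0
  diag := .zero
  nilp_N := ⟨1, by simp⟩
  nilp_y _ := ⟨1, by simp⟩
  comm_y _ _ := rfl
  comm_SN := rfl
  comm_Ny _ := rfl
  S_mul_y _ := by simp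

theorem trivial_op (x : Kˣ) (r : Fin d → K) (l : K) : (trivial K V d).op x r l = 1 := by
  have h1 : (trivial K V d).Y r = 0 := by simp [Y, trivial]
  have h2 : (trivial K V d).pow x = 1 := LinearMap.ext fun v => by
    rw [pow_apply (n := 0) _ _ (by simp [trivial])]; simp
  rw [op, h1, h2, show (trivial K V d).N = 0 from rfl, smul_zero]
  simp

end SplitData

/-! ### Generalized eigenspaces and subquotients of split data. -/

section Jordan
variable {K : Type*} [Field K] {V W : Type*} [AddCommGroup V] [Module K V]
  [AddCommGroup W] [Module K W]

theorem isIntDiag_of_iSup_maxGenEigenspace {A S : Module.End K V} {c : ℤ → K}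
    (htop : ⊤ ≤ ⨆ n, A.maxGenEigenspace (c n))
    (hS : ∀ n, ∀ v ∈ A.maxGenEigenspace (c n), S v = (n : K) • v) : IsIntDiag S :=
  top_le_iff.1 (htop.trans (iSup_le fun n v hv => Submodule.subset_span ⟨n, hS n v hv⟩))

theorem ext_maxGenEigenspace {A : Module.End K V} {c : ℤ → K}
    (htop : ⊤ ≤ ⨆ n, A.maxGenEigenspace (c n)) {f g : V →ₗ[K] W}
    (h : ∀ n, ∀ v ∈ A.maxGenEigenspace (c n), f v = g v) : f = g := by
  have : ⨆ n, A.maxGenEigenspace (c n) ≤ LinearMap.eqLocus f g := iSup_le h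
  exact LinearMap.ext fun v => this (htop trivial)

/-- If `b f = f a + ...` in the form `(b - β) f = z f (a - α)`, generalized eigenvectors are mapped
to generalized eigenvectors. -/
theorem map_mem_maxGenEigenspace {a : Module.End K V} {b : Module.End K W} {f : V →ₗ[K] W}
    {α β z : K} (h : ∀ v, b (f v) - β • f v = z • f (a v - α • v)) {v : V}
    (hv : v ∈ a.maxGenEigenspace α) : f v ∈ b.maxGenEigenspace β := by
  rw [Module.End.mem_maxGenEigenspace] at hv ⊢
  obtain ⟨k, hk⟩ := hv
  refine ⟨k, ?_⟩
  have : ∀ k v, ((b - β • (1 : Module.End K W)) ^ k) (f v) =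
      z ^ k • f (((a - α • (1 : Module.End K V)) ^ k) v) := by
    intro k
    induction k with
    | zero => intro v; simp
    | succ k ih =>
      intro v
      rw [pow_succ, Module.End.mul_apply, pow_succ z, pow_succ (a - _), Module.End.mul_apply]
      have h1 : (b - β • (1 : Module.End K W)) (f v) = f (z • (a - α • (1 : Module.End K V)) v) := by
        simpa using h v
      rw [h1, ih, map_smul, map_smul, smul_smul]
  rw [this, hk, map_zero, smul_zero]

/-- Composition of operators that are scalars on `B / A`. -/
theorem comp_sub_mem {A B : Submodule K V} (hAB : A ≤ B) {f g : Module.End K V} {a b : K}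
    (hf : ∀ v ∈ B, f v - a • v ∈ A) (hg : ∀ v ∈ B, g v - b • v ∈ A) :
    ∀ v ∈ B, (f * g) v - (a * b) • v ∈ A := by
  intro v hv
  have h1 := hg v hv
  have h2 : g v ∈ B := by simpa using B.add_mem (hAB h1) (B.smul_mem b hv)
  have h3 := A.add_mem (hf _ h2) (A.smul_mem a h1)
  rw [smul_sub, sub_add_sub_cancel, smul_smul] at h3
  exact h3

theorem nexp_sub_mem {A B : Submodule K V} (hAB : A ≤ B) {a : Module.End K V}
    (ha : IsNilpotent a) (h : ∀ v ∈ B, a v ∈ A) : ∀ v ∈ B, nexp K a v - (1 : K) • v ∈ A := by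
  obtain ⟨k, hk⟩ := ha
  have h1 : nexp K a = Polynomial.aeval a
      (∑ i ∈ Finset.range (k + 1), Polynomial.C ((i.factorial : K)⁻¹) * Polynomial.X ^ i) := by
    rw [nexp_eq_sum K (show a ^ (k + 1) = 0 by rw [pow_succ, hk, zero_mul])]
    simp only [map_sum, map_mul, Polynomial.aeval_C, map_pow, Polynomial.aeval_X,
      Algebra.smul_def]
  have h2 := aeval_sub_mem (μ := 0) hAB (by simpa using h)
    (∑ i ∈ Finset.range (k + 1), Polynomial.C ((i.factorial : K)⁻¹) * Polynomial.X ^ i)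
  rw [← h1] at h2
  have h3 : (∑ i ∈ Finset.range (k + 1),
      Polynomial.C ((i.factorial : K)⁻¹) * Polynomial.X ^ i).eval 0 = 1 := by
    rw [Finset.sum_range_succ']
    simp [Polynomial.eval_finsetSum]
  rwa [h3] at h2

variable [FiniteDimensional K V] [FiniteDimensional K W] [CharZero K] {d : ℕ}

namespace SplitData

theorem mem_maxGenEigenspace_of_eigen (D : SplitData K V d) {n : ℤ} {v : V}
    (hv : D.S v = (n : K) • v) : v ∈ (D.S + D.N).maxGenEigenspace (n : K) := by
  rw [Module.End.mem_maxGenEigenspace]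
  obtain ⟨k, hk⟩ := D.nilp_N
  have : ∀ k : ℕ, ((D.S + D.N - (n : K) • (1 : Module.End K V)) ^ k) v = (D.N ^ k) v := by
    intro k
    induction k with
    | zero => simp
    | succ k ih =>
      have h1 := LinearMap.congr_fun (D.comm_SN.pow_right k).eq v
      rw [Module.End.mul_apply, Module.End.mul_apply, hv, map_smul] at h1
      rw [pow_succ', Module.End.mul_apply, ih, pow_succ', Module.End.mul_apply]
      simp [h1]
  exact ⟨k, by rw [this, hk]; rfl⟩

/-- `S` is a polynomial in `S + N`. -/
theorem exists_aeval (D : SplitData K V d) : ∃ P : Polynomial K,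
    Polynomial.aeval (D.S + D.N) P = D.S ∧ ∀ (n : ℤ), ∀ v ∈ (D.S + D.N).maxGenEigenspace (n : K),
      Polynomial.aeval (D.S + D.N) P v = (n : K) • v := by
  obtain ⟨P, hP⟩ := exists_mem_adjoin_smul_on_maxGenEigenspace (D.S + D.N)
    (c := fun n : ℤ => (n : K)) Int.cast_injective
  refine ⟨P, ?_, hP⟩
  exact LinearMap.ext_on D.diag fun v ⟨n, hn⟩ => by
    rw [hP n v (D.mem_maxGenEigenspace_of_eigen hn), hn]

theorem mem_maxGenEigenspace_iff (D : SplitData K V d) {n : ℤ} {v : V} :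
    v ∈ (D.S + D.N).maxGenEigenspace (n : K) ↔ D.S v = (n : K) • v := by
  refine ⟨fun hv => ?_, D.mem_maxGenEigenspace_of_eigen⟩
  obtain ⟨P, hP, hP'⟩ := D.exists_aeval
  rw [← hP' n v hv, hP]

/-- Maps that intertwine `S + N` intertwine `S`. -/
theorem S_intertwine {D : SplitData K V d} {D' : SplitData K W d} {f : V →ₗ[K] W}
    (h : (D'.S + D'.N) ∘ₗ f = f ∘ₗ (D.S + D.N)) : D'.S ∘ₗ f = f ∘ₗ D.S :=
  D.diag.ext fun n v hv => by
    rw [LinearMap.comp_apply, LinearMap.comp_apply, hv, map_smul, ← mem_maxGenEigenspace_iff]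
    refine map_mem_maxGenEigenspace (z := 1) (fun v => ?_) (D.mem_maxGenEigenspace_of_eigen hv)
    have := LinearMap.congr_fun h v
    rw [LinearMap.comp_apply, LinearMap.comp_apply] at this
    rw [this, map_sub, map_smul, one_smul]

/-- On a subquotient where `S + N` acts as the integer `n` and the `y j` vanish, the group acts
through `x ^ n`. -/
theorem op_sub_mem (D : SplitData K V d) {A B : Submodule K V} (hAB : A ≤ B) {n : ℤ}
    (hSN : ∀ v ∈ B, (D.S + D.N) v - (n : K) • v ∈ A) (hy : ∀ j, ∀ v ∈ B, D.y j v ∈ A)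
    (x : Kˣ) (r : Fin d → K) (l : K) :
    ∀ v ∈ B, D.op x r l v - ((x ^ n : Kˣ) : K) • v ∈ A := by
  have hS : ∀ v ∈ B, D.S v - (n : K) • v ∈ A := by
    obtain ⟨P, hP, hP'⟩ := D.exists_aeval
    have := aeval_sub_mem_of_maxGenEigenspace hAB hSN (hP' n)
    rwa [hP] at this
  have hN : ∀ v ∈ B, D.N v ∈ A := fun v hv => by
    have := A.sub_mem (hSN v hv) (hS v hv)
    simpa using this
  have h1 := nexp_sub_mem hAB (D.smulN_nilpotent l) fun v hv => A.smul_mem l (hN v hv)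
  have h2 := nexp_sub_mem hAB (D.Y_nilpotent r) fun v hv => by
    rw [Y, LinearMap.sum_apply]
    exact A.sum_mem fun j _ => A.smul_mem _ (hy j v hv)
  have h3 : ∀ v ∈ B, D.pow x v - ((x ^ n : Kˣ) : K) • v ∈ A := by
    obtain ⟨P, hP⟩ := intFun_eq_aeval D.S fun n => ((x ^ n : Kˣ) : K)
    rw [pow, hP]
    refine aeval_sub_mem_of_maxGenEigenspace hAB hS fun v hv => ?_
    obtain ⟨k, hk⟩ := (Module.End.mem_maxGenEigenspace _ _ _).1 hv
    rw [← hP]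
    exact D.pow_apply x (D.diag.apply_eq_of_pow hk)
  have := comp_sub_mem hAB (comp_sub_mem hAB h2 h3) h1
  rwa [one_mul, mul_one] at this

end SplitData
end Jordan

/-! ### Coordinates on `𝔤_K` and its action through split data. -/

section LieSide
variable {p : ℕ} [Fact p.Prime] {d : ℕ}

variable (p d) in
/-- The `K`-linear form on `𝔤` which is the `i`-th entry of the first row. -/
def rowEntry (i : Unit ⊕ Fin d) : gLie p d →ₗ[ℚ_[p]] ℚ_[p] where
  toFun X := (X : Matrix (Unit ⊕ Fin d) (Unit ⊕ Fin d) ℚ_[p]) (Sum.inl ()) i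
  map_add' _ _ := rfl
  map_smul' _ _ := rfl

theorem gLie_ext {X Y : gLie p d} (h : ∀ i, rowEntry p d i X = rowEntry p d i Y) : X = Y := by
  refine Subtype.ext (Matrix.ext fun i j => ?_)
  cases i with
  | inl i => exact h j
  | inr i => rw [X.2 i j, Y.2 i j]

/-- A product of matrices supported on the first row is `X Y = X_00 Y`. -/
theorem rowEntry_lie (X Y : gLie p d) (i : Unit ⊕ Fin d) :
    rowEntry p d i ⁅X, Y⁆ = rowEntry p d (Sum.inl ()) X * rowEntry p d i Y -
      rowEntry p d (Sum.inl ()) Y * rowEntry p d i X := by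
  have h : ∀ X Y : gLie p d, ((X : Matrix (Unit ⊕ Fin d) (Unit ⊕ Fin d) ℚ_[p]) * Y) (Sum.inl ()) i =
      rowEntry p d (Sum.inl ()) X * rowEntry p d i Y := fun X Y => by
    rw [Matrix.mul_apply, Fintype.sum_sum_type, Finset.sum_eq_zero (s := (Finset.univ : Finset (Fin d)))
      fun a _ => by rw [Y.2 a i, mul_zero]]
    rw [Fintype.sum_unique, add_zero]; rfl
  rw [← h, ← h]; rfl

variable (p d) in
/-- The matrix units of the first row. -/
def matUnit (i : Unit ⊕ Fin d) : gLie p d :=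
  ⟨Matrix.single (Sum.inl ()) i 1, fun _ _ => Matrix.single_apply_of_row_ne (by simp) _ _ _⟩

theorem rowEntry_matUnit (i j : Unit ⊕ Fin d) :
    rowEntry p d i (matUnit p d j) = if i = j then 1 else 0 := by
  change Matrix.single (Sum.inl ()) j (1 : ℚ_[p]) (Sum.inl ()) i = _
  simp [Matrix.single_apply, eq_comm]

theorem sum_rowEntry_smul (X : gLie p d) : ∑ i, rowEntry p d i X • matUnit p d i = X :=
  gLie_ext fun j => by
    simp only [map_sum, map_smul, rowEntry_matUnit, smul_eq_mul, mul_ite, mul_one, mul_zero]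
    rw [Finset.sum_ite_eq, if_pos (Finset.mem_univ _)]

variable {K : Type u} [Field K] [Algebra ℚ_[p] K]

variable (p K d) in
/-- The scalar extension of `rowEntry`. -/
def rowEntryK (i : Unit ⊕ Fin d) : gK p K d →ₗ[K] K :=
  (TensorProduct.AlgebraTensorModule.rid ℚ_[p] K K).toLinearMap ∘ₗ
    LinearMap.baseChange K (rowEntry p d i)

theorem rowEntryK_inl : rowEntryK p d K (Sum.inl ()) = delta0 p K d := rfl

theorem rowEntryK_tmul (i : Unit ⊕ Fin d) (a : K) (X : gLie p d) :
    rowEntryK p d K i (a ⊗ₜ X) = a * algebraMap ℚ_[p] K (rowEntry p d i X) := by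
  rw [mul_comm, ← Algebra.smul_def]; rfl

theorem rowEntryK_lie (X Y : gK p K d) (i : Unit ⊕ Fin d) :
    rowEntryK p d K i ⁅X, Y⁆ = rowEntryK p d K (Sum.inl ()) X * rowEntryK p d K i Y -
      rowEntryK p d K (Sum.inl ()) Y * rowEntryK p d K i X := by
  induction X using TensorProduct.induction_on with
  | zero => simp
  | add X X' h h' => rw [add_lie, map_add, h, h', map_add, map_add]; ring
  | tmul a X =>
    induction Y using TensorProduct.induction_on with
    | zero =>
      refine (congrArg (rowEntryK p d K i) (lie_zero (L := gK p K d) (M := gK p K d) _)).trans ?_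
      simp
    | add X X' h h' =>
      refine (congrArg (rowEntryK p d K i)
        (lie_add (L := gK p K d) (M := gK p K d) _ _ _)).trans ?_
      rw [map_add, h, h', map_add, map_add]; ring
    | tmul b Y =>
      rw [LieAlgebra.ExtendScalars.bracket_tmul]
      simp only [rowEntryK_tmul, rowEntry_lie, map_sub, map_mul]
      ring

theorem sum_rowEntryK_smul (X : gK p K d) :
    ∑ i, rowEntryK p d K i X • ((1 : K) ⊗ₜ[ℚ_[p]] matUnit p d i) = X := by
  induction X using TensorProduct.induction_on with
  | zero => simp
  | add X X' h h' =>
    simp only [map_add, add_smul, Finset.sum_add_distrib, h, h']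
  | tmul a X =>
    conv_rhs => rw [← sum_rowEntry_smul X, TensorProduct.tmul_sum]
    refine Finset.sum_congr rfl fun i _ => ?_
    rw [rowEntryK_tmul, TensorProduct.smul_tmul', smul_eq_mul, mul_one, ← TensorProduct.smul_tmul,
      Algebra.smul_def, mul_comm]

namespace SplitData
variable {V W : Type*} [AddCommGroup V] [Module K V] [AddCommGroup W] [Module K W]

variable (p) in
/-- The action of `𝔤_K`. -/
def lieLin (D : SplitData K V d) : gK p K d →ₗ[K] Module.End K V :=
  (rowEntryK p d K (Sum.inl ())).smulRight (D.S + D.N) +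
    ∑ j, (rowEntryK p d K (Sum.inr j)).smulRight (D.y j)

theorem lieLin_apply (D : SplitData K V d) (X : gK p K d) :
    D.lieLin p X = rowEntryK p d K (Sum.inl ()) X • (D.S + D.N) +
      D.Y fun j => rowEntryK p d K (Sum.inr j) X := by
  simp [lieLin, Y, LinearMap.sum_apply]

theorem lieLin_zero (D : SplitData K V d) :
    D.lieLin p ((1 : K) ⊗ₜ matUnit p d (Sum.inl ())) = D.S + D.N := by
  simp [lieLin_apply, rowEntryK_tmul, rowEntry_matUnit, Y]

theorem lieLin_inr (D : SplitData K V d) (j : Fin d) :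
    D.lieLin p ((1 : K) ⊗ₜ matUnit p d (Sum.inr j)) = D.y j := by
  simp [lieLin_apply, rowEntryK_tmul, rowEntry_matUnit, Y, apply_ite (algebraMap ℚ_[p] K)]

variable (p) in
/-- The representation of `𝔤_K`. -/
def lie (D : SplitData K V d) : gK p K d →ₗ⁅K⁆ Module.End K V :=
  { D.lieLin p with
    map_lie' := by
      intro X X'
      change D.lieLin p _ = ⁅D.lieLin p X, D.lieLin p X'⁆
      set r : Fin d → K := fun j => rowEntryK p d K (Sum.inr j) X
      set r' : Fin d → K := fun j => rowEntryK p d K (Sum.inr j) X'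
      set a := rowEntryK p d K (Sum.inl ()) X with ha
      set a' := rowEntryK p d K (Sum.inl ()) X' with ha'
      have h1 : (fun j => rowEntryK p d K (Sum.inr j) ⁅X, X'⁆) = a • r' + (-a') • r := by
        funext j
        rw [rowEntryK_lie]; simp [r, r', sub_eq_add_neg, ha, ha']
      -- The bracket relation of `X_0` with the translations only needs `[S + N, Y] = Y`, to which
      -- `N` does not contribute.
      have h2 : ∀ r, (D.S + D.N) * D.Y r = D.Y r * (D.S + D.N) + D.Y r := fun r => by
        rw [add_mul, mul_add, D.S_mul_Y, (D.N_commute_Y r).eq]; abel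
      rw [Ring.lie_def, lieLin_apply, lieLin_apply, lieLin_apply, h1, rowEntryK_lie, D.Y_add,
        D.Y_smul, D.Y_smul]
      change (a * a' - a' * a) • _ + _ = (a • _ + D.Y r) * (a' • _ + D.Y r') -
        (a' • _ + D.Y r') * (a • _ + D.Y r)
      generalize D.S + D.N = T at h2
      simp only [add_mul, mul_add, smul_mul_assoc, mul_smul_comm, h2, smul_add, smul_smul,
        (D.Y_commute r r').eq, mul_comm a' a, sub_self, zero_smul, neg_smul]
      abel }

theorem lie_apply (D : SplitData K V d) (X : gK p K d) : D.lie p X = D.lieLin p X := rfl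

end SplitData
end LieSide

/-! ### From representations of `𝔤_K` to split data. -/

section Extraction
variable {K : Type*} [Field K] {V : Type*} [AddCommGroup V] [Module K V]
  [FiniteDimensional K V] [CharZero K] {d : ℕ}

/-- A polynomial in `A` which is diagonalizable with integral eigenvalues, and for which operators
that shift the generalized eigenspaces of `A` are of weight one. -/
theorem exists_aeval_isIntDiag (A : Module.End K V) {c : ℤ → K} (hc : Function.Injective c)
    (htop : ⊤ ≤ ⨆ n, A.maxGenEigenspace (c n)) :
    ∃ P : Polynomial K, IsIntDiag (Polynomial.aeval A P) ∧
      (∀ n, ∀ v ∈ A.maxGenEigenspace (c n), Polynomial.aeval A P v = (n : K) • v) ∧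
      ∀ y : Module.End K V,
        (∀ n, ∀ v ∈ A.maxGenEigenspace (c n), y v ∈ A.maxGenEigenspace (c (n + 1))) →
        Polynomial.aeval A P * y = y * Polynomial.aeval A P + y := by
  obtain ⟨P, hP⟩ := exists_mem_adjoin_smul_on_maxGenEigenspace A hc
  refine ⟨P, isIntDiag_of_iSup_maxGenEigenspace htop hP, hP, fun y hy => ?_⟩
  refine ext_maxGenEigenspace htop fun n v hv => ?_
  rw [Module.End.mul_apply, hP _ _ (hy n v hv), LinearMap.add_apply, Module.End.mul_apply,
    hP n v hv, map_smul, Int.cast_add, add_smul, Int.cast_one, one_smul]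

theorem aeval_commute_of_commute {A T : Module.End K V} (h : Commute A T) (P : Polynomial K) :
    Commute (Polynomial.aeval A P) T :=
  (Algebra.commute_of_mem_adjoin_singleton_of_commute
    (Polynomial.aeval_mem_adjoin_singleton K A) h.symm).symm

variable {p : ℕ} [Fact p.Prime] [Algebra ℚ_[p] K]

/-- Every object of `Rep^ℤ 𝔤_K` comes from data. -/
theorem exists_splitData_of_lie (φ : gK p K d →ₗ⁅K⁆ Module.End K V)
    (h : IsIteratedExtension (fun X => φ X) (fun n X => (n : K) * delta0 p K d X) ⊤) :
    ∃ D : SplitData K V d, ∀ X, φ X = D.lie p X := by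
  set X0 : gK p K d := (1 : K) ⊗ₜ matUnit p d (Sum.inl ()) with hX0
  set Xj : Fin d → gK p K d := fun j => (1 : K) ⊗ₜ matUnit p d (Sum.inr j) with hXj
  have hd0 : delta0 p K d X0 = 1 := by
    rw [← rowEntryK_inl, rowEntryK_tmul, rowEntry_matUnit, if_pos rfl, map_one, one_mul]
  have hdj : ∀ j, delta0 p K d (Xj j) = 0 := fun j => by
    rw [← rowEntryK_inl, rowEntryK_tmul, rowEntry_matUnit, if_neg (by simp), map_zero, mul_zero]
  have hbr : ∀ i j : Unit ⊕ Fin d, ⁅((1 : K) ⊗ₜ matUnit p d i : gK p K d),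
      ((1 : K) ⊗ₜ matUnit p d j : gK p K d)⁆ = (1 : K) ⊗ₜ ⁅matUnit p d i, matUnit p d j⁆ :=
    fun i j => by rw [LieAlgebra.ExtendScalars.bracket_tmul, one_mul]
  have hb0 : ∀ j, ⁅X0, Xj j⁆ = Xj j := fun j => by
    rw [hX0, hXj, hbr]
    congr 1
    exact gLie_ext fun i => by simp [rowEntry_lie, rowEntry_matUnit]
  have hbj : ∀ i j, ⁅Xj i, Xj j⁆ = 0 := fun i j => by
    rw [hXj, hbr]
    have : ⁅matUnit p d (Sum.inr i), matUnit p d (Sum.inr j)⁆ = 0 :=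
      gLie_ext fun i => by simp [rowEntry_lie, rowEntry_matUnit]
    rw [this, TensorProduct.tmul_zero]
  set A := φ X0
  have hAy : ∀ j, A * φ (Xj j) = φ (Xj j) * A + φ (Xj j) := fun j => by
    have := φ.map_lie X0 (Xj j)
    rw [hb0, Ring.lie_def] at this
    exact sub_eq_iff_eq_add'.1 this.symm
  -- On a step of weight `n` the element `X_0` acts as `n`, so the integral generalized eigenspaces
  -- fill the space.
  have htop : ⊤ ≤ ⨆ n : ℤ, A.maxGenEigenspace (n : K) := by
    have := h.iSup_maxGenEigenspace X0 (fun a b hab => by simpa [hd0] using hab)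
    simpa [hd0] using this
  obtain ⟨P, hP1, hP2, hP3⟩ := exists_aeval_isIntDiag A (c := fun n : ℤ => (n : K))
    Int.cast_injective htop
  -- The relation `[X_0, X_j] = X_j` moves the generalized eigenspace of `n` to that of `n + 1`, so
  -- the semisimple part of `X_0` satisfies the same relation.
  have hSy : ∀ j, Polynomial.aeval A P * φ (Xj j) =
      φ (Xj j) * Polynomial.aeval A P + φ (Xj j) := fun j => by
    refine hP3 _ fun n v hv => map_mem_maxGenEigenspace (z := 1) (fun v => ?_) hv
    have := LinearMap.congr_fun (hAy j) v
    simp only [Module.End.mul_apply, LinearMap.add_apply] at this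
    rw [this, map_sub, map_smul, Int.cast_add, add_smul, Int.cast_one, one_smul, one_smul]
    abel
  have hcomm : Commute (Polynomial.aeval A P) A := aeval_commute_of_commute (Commute.refl A) P
  refine ⟨⟨Polynomial.aeval A P, A - Polynomial.aeval A P, fun j => φ (Xj j), hP1, ?_, ?_, ?_,
    hcomm.sub_right (Commute.refl _), ?_, hSy⟩, ?_⟩
  -- Both `A` and its semisimple part act as `n` on a step of weight `n`, so their difference lowers
  -- the flag.
  · refine h.isNilpotent fun U W n hUW _ _ hn v hv => ?_
    have h1 := hn X0
    simp only [hd0, mul_one] at h1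
    have h2 := aeval_sub_mem_of_maxGenEigenspace hUW h1 (hP2 n) v hv
    have := U.sub_mem (h1 v hv) h2
    rwa [sub_sub_sub_cancel_right] at this
  · intro j
    refine h.isNilpotent fun U W n hUW _ _ hn v hv => ?_
    have := hn (Xj j) v hv
    rwa [hdj, mul_zero, zero_smul, sub_zero] at this
  · intro i j
    have := φ.map_lie (Xj i) (Xj j)
    rw [hbj, map_zero, Ring.lie_def] at this
    exact (sub_eq_zero.1 this.symm)
  · intro j
    change (A - _) * _ = _ * (A - _)
    rw [sub_mul, mul_sub, hAy, hSy]; abel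
  · intro X
    have h1 : φ X = ∑ i, rowEntryK p d K i X • φ ((1 : K) ⊗ₜ matUnit p d i) := by
      conv_lhs => rw [← sum_rowEntryK_smul X, map_sum]
      simp only [map_smul]
    rw [h1, SplitData.lie_apply, SplitData.lieLin_apply, Fintype.sum_sum_type,
      Fintype.sum_unique, add_sub_cancel]
    rfl

end Extraction

/-! ### The action of `ℤ_p^× ⋉ ℤ_p^d` attached to split data. -/

section GroupSide
variable {p : ℕ} [Fact p.Prime] {d : ℕ} {K : Type*} [Field K] [Algebra ℚ_[p] K] {V : Type*}
  [AddCommGroup V] [Module K V] [FiniteDimensional K V] [CharZero K]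

variable (p K) in
/-- The inclusion `ℤ_p^× → K^×`. -/
def unitK : ℤ_[p]ˣ →* Kˣ :=
  Units.map ((algebraMap ℚ_[p] K).comp (PadicInt.Coe.ringHom (p := p))).toMonoidHom

theorem coe_unitK (x : ℤ_[p]ˣ) : (unitK p K x : K) = algebraMap ℚ_[p] K ((x : ℤ_[p]) : ℚ_[p]) := rfl

namespace SplitData

/-- The action of `(x, r) ∈ ℤ_p^× ⋉ ℤ_p^d`. -/
def opZ (D : SplitData K V d) (x : ℤ_[p]ˣ) (r : Fin d → ℤ_[p]) : Module.End K V :=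
  D.op (unitK p K x) (fun j => algebraMap ℚ_[p] K (r j)) (algebraMap ℚ_[p] K (ulog x))

theorem opZ_mul (D : SplitData K V d) (x x' : ℤ_[p]ˣ) (r r' : Fin d → ℤ_[p]) :
    D.opZ x r * D.opZ x' r' = D.opZ (x * x') (r + (x : ℤ_[p]) • r') := by
  rw [opZ, opZ, opZ, op_mul, map_mul, ulog_mul, map_add]
  congr 1
  funext j
  simp [coe_unitK, Algebra.smul_def]

theorem opZ_one (D : SplitData K V d) : D.opZ (1 : ℤ_[p]ˣ) 0 = 1 := by
  rw [opZ, map_one, ulog_one, map_zero, ← D.op_one]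
  congr 1
  funext j
  simp

variable {G : Type*} [Group G] [TopologicalSpace G] {χ : G →* ℤ_[p]ˣ} {s : Fin d → G → ℤ_[p]}

/-- The representation of the group. -/
def rep (D : SplitData K V d) (hG : IsAffineGroup χ s) : G →* Module.End K V where
  toFun g := D.opZ (χ g) fun j => s j g
  map_one' := by
    rw [map_one, ← D.opZ_one (p := p)]
    congr 1
    funext j
    have := hG.s_mul j 1 1
    rw [mul_one, map_one, Units.val_one, one_mul] at this
    simpa using this
  map_mul' g h := by
    rw [opZ_mul, map_mul]
    congr 1
    funext j
    rw [hG.s_mul]; rfl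

theorem rep_apply (D : SplitData K V d) (hG : IsAffineGroup χ s) (g : G) :
    D.rep hG g = D.opZ (χ g) fun j => s j g := rfl

theorem isIteratedExtension_rep (D : SplitData K V d) (hG : IsAffineGroup χ s)
    (h : IsIteratedExtension (fun X => D.lie p X) (fun n X => (n : K) * delta0 p K d X) ⊤) :
    IsIteratedExtension (fun g => D.rep hG g) (fun n g => ((unitK p K (χ g) ^ n : Kˣ) : K)) ⊤ := by
  refine h.transfer fun A B n hAB _ _ hn g => ?_
  refine D.op_sub_mem hAB (fun v hv => ?_) (fun j v hv => ?_) _ _ _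
  · have := hn ((1 : K) ⊗ₜ matUnit p d (Sum.inl ())) v hv
    rw [← rowEntryK_inl, rowEntryK_tmul, rowEntry_matUnit, if_pos rfl, map_one, one_mul,
      mul_one] at this
    rwa [← D.lieLin_zero (p := p)]
  · have := hn ((1 : K) ⊗ₜ matUnit p d (Sum.inr j)) v hv
    rw [← rowEntryK_inl, rowEntryK_tmul, rowEntry_matUnit, if_neg (by simp), map_zero, mul_zero,
      mul_zero, zero_smul, sub_zero] at this
    rwa [← D.lieLin_inr (p := p)]

/-- The semisimple parts are recovered from `S + N`, so `f` respects `S`, `N` and all `y j`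
separately. With `f` the identity, the group action depends only on the Lie algebra action and not
on the chosen data. -/
theorem lie_intertwine {W : Type*} [AddCommGroup W] [Module K W] [FiniteDimensional K W]
    {D : SplitData K V d} {D' : SplitData K W d} {f : V →ₗ[K] W}
    (h : ∀ X, D'.lie p X ∘ₗ f = f ∘ₗ D.lie p X) (x : Kˣ) (r : Fin d → K) (l : K) :
    D'.op x r l ∘ₗ f = f ∘ₗ D.op x r l := by
  have h0 : (D'.S + D'.N) ∘ₗ f = f ∘ₗ (D.S + D.N) := by
    have := h ((1 : K) ⊗ₜ matUnit p d (Sum.inl ()))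
    rwa [lie_apply, lie_apply, lieLin_zero, lieLin_zero] at this
  have hS := S_intertwine h0
  refine op_intertwine hS ?_ (fun j => ?_) x r l
  · rw [LinearMap.add_comp, LinearMap.comp_add, hS] at h0
    exact add_left_cancel h0
  · have := h ((1 : K) ⊗ₜ matUnit p d (Sum.inr j))
    rwa [lie_apply, lie_apply, lieLin_inr, lieLin_inr] at this

end SplitData
end GroupSide

/-! ### Uniqueness of logarithms and roots of unipotent elements. -/

section NexpInjective
variable {K : Type*} [Field K] [CharZero K] {A : Type*} [Ring A] [Algebra K A]

/-- A logarithm of a unipotent element, as a polynomial. -/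
theorem exists_nexp_aeval_eq {n : A} (hn : IsNilpotent n) :
    ∃ P : Polynomial K, P.eval 0 = 0 ∧ IsNilpotent (Polynomial.aeval n P) ∧
      nexp K (Polynomial.aeval n P) = 1 + n := by
  obtain ⟨q, hq, h⟩ := exists_nexp_eq_one_add K hn
  rw [Algebra.adjoin_singleton_eq_range_aeval] at hq
  obtain ⟨Q, rfl⟩ := hq
  refine ⟨Polynomial.X * Q, by simp, ?_, ?_⟩
  · rw [map_mul, Polynomial.aeval_X]
    exact (Algebra.commute_of_mem_adjoin_self
      (Polynomial.aeval_mem_adjoin_singleton K n)).isNilpotent_mul_right hn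
  · rw [map_mul, Polynomial.aeval_X]; exact h

/-- No commutation of `a` and `b` is assumed. Each equals the same polynomial logarithm evaluated at
`exp a - 1 = exp b - 1`, by injectivity among commuting elements. -/
theorem nexp_injective {a b : A} (ha : IsNilpotent a) (hb : IsNilpotent b)
    (h : nexp K a = nexp K b) : a = b := by
  have key : ∀ {c : A}, IsNilpotent c → ∀ P : Polynomial K,
      IsNilpotent (Polynomial.aeval (nexp K c - 1) P) →
      nexp K (Polynomial.aeval (nexp K c - 1) P) = nexp K c →
      c = Polynomial.aeval (nexp K c - 1) P := by
    intro c hc P hP he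
    refine nexp_injective_of_commute K ?_ hc hP he.symm
    have h1 : Commute (nexp K c - 1) c :=
      ((nexp_commute K hc (Commute.refl c)).sub_right (Commute.one_right c)).symm
    exact (Algebra.commute_of_mem_adjoin_singleton_of_commute
      (Polynomial.aeval_mem_adjoin_singleton K _) h1.symm)
  obtain ⟨q, _, hq, hn⟩ := exists_nexp_sub_one K a ha
  have hnil : IsNilpotent (nexp K a - 1) := by
    obtain ⟨q, hq, h1, _⟩ := exists_nexp_sub_one K a ha
    rw [h1, add_sub_cancel_left]
    exact (Algebra.commute_of_mem_adjoin_self hq).isNilpotent_mul_right ha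
  obtain ⟨P, _, hP1, hP2⟩ := exists_nexp_aeval_eq (K := K) hnil
  rw [add_sub_cancel] at hP2
  rw [key ha P hP1 hP2]
  rw [h] at hP1 hP2 ⊢
  exact (key hb P hP1 hP2).symm

theorem nexp_nsmul {a : A} (ha : IsNilpotent a) (m : ℕ) : nexp K (m • a) = nexp K a ^ m := by
  induction m with
  | zero => simp
  | succ m ih =>
    rw [succ_nsmul, nexp_add K ((Commute.refl a).smul_left m) (ha.smul m) ha, ih, pow_succ]

/-- Roots of unipotent elements are unique. -/
theorem unipotent_pow_injective (K : Type*) [Field K] [CharZero K] {A : Type*} [Ring A]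
    [Algebra K A] {a b : A} (ha : IsNilpotent (a - 1)) (hb : IsNilpotent (b - 1))
    {m : ℕ} (hm : m ≠ 0) (h : a ^ m = b ^ m) : a = b := by
  obtain ⟨P, _, hP1, hP2⟩ := exists_nexp_aeval_eq (K := K) ha
  obtain ⟨Q, _, hQ1, hQ2⟩ := exists_nexp_aeval_eq (K := K) hb
  rw [add_sub_cancel] at hP2 hQ2
  rw [← hP2, ← hQ2, ← nexp_nsmul hP1, ← nexp_nsmul hQ1] at h
  have := nexp_injective (hP1.smul m) (hQ1.smul m) h
  rw [← hP2, ← hQ2]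
  congr 1
  rw [← Nat.cast_smul_eq_nsmul K, ← Nat.cast_smul_eq_nsmul K] at this
  exact smul_right_injective A (Nat.cast_ne_zero.2 hm : (m : K) ≠ 0) this

end NexpInjective

/-! ### Continuity of exponentials and of actions. -/

section Topology
variable {K : Type*} [Field K] {V : Type*} [AddCommGroup V] [Module K V]
  [FiniteDimensional K V]

/-- A cutoff independent of the nilpotent operator makes the exponential of a varying operator a
fixed polynomial, hence continuous. -/
theorem pow_finrank_eq_zero {a : Module.End K V} (ha : IsNilpotent a) :
    a ^ Module.finrank K V = 0 := by
  obtain ⟨k, hk⟩ := ha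
  refine LinearMap.ext fun v => ?_
  have h1 : v ∈ a.maxGenEigenspace 0 := (Module.End.mem_maxGenEigenspace _ _ _).2 ⟨k, by simp [hk]⟩
  rw [Module.End.maxGenEigenspace_eq_genEigenspace_finrank] at h1
  simpa [Module.End.mem_genEigenspace_nat] using h1

variable [TopologicalSpace K] [IsTopologicalRing K]

theorem continuous_nexp [TopologicalSpace (Module.End K V)] [IsModuleTopology K (Module.End K V)]
    {X : Type*} [TopologicalSpace X] {a : X → Module.End K V} (ha : Continuous a)
    (hn : ∀ x, IsNilpotent (a x)) : Continuous fun x => nexp K (a x) := by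
  have := IsModuleTopology.isTopologicalRing K (Module.End K V)
  have : (fun x => nexp K (a x)) =
      fun x => ∑ i ∈ Finset.range (Module.finrank K V), ((i.factorial : K)⁻¹) • a x ^ i :=
    funext fun x => nexp_eq_sum K (pow_finrank_eq_zero (hn x))
  rw [this]
  exact continuous_finsetSum _ fun i _ =>
    Continuous.smul (f := fun _ => (i.factorial : K)⁻¹) (g := fun x => a x ^ i) continuous_const
      (ha.pow i)

theorem isContinuousAction_of_continuous [TopologicalSpace (Module.End K V)]
    [IsModuleTopology K (Module.End K V)] {G : Type*} [TopologicalSpace G]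
    {ρ : G → Module.End K V} (h : Continuous ρ) : IsContinuousAction K ρ := by
  let _ : TopologicalSpace V := moduleTopology K V
  have : IsModuleTopology K V := ⟨rfl⟩
  have h1 : Continuous fun x : Module.End K V × V => x.1 x.2 :=
    IsModuleTopology.continuous_bilinear_of_finite_left
      (LinearMap.id : Module.End K V →ₗ[K] V →ₗ[K] V)
  exact h1.comp ((h.comp continuous_fst).prodMk continuous_snd)

theorem t2Space_of_isModuleTopology [T2Space K] [TopologicalSpace V] [IsModuleTopology K V] :
    T2Space V :=
  T2Space.of_injective_continuous (Module.finBasis K V).equivFun.injective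
    (IsModuleTopology.continuous_of_linearMap (Module.finBasis K V).equivFun.toLinearMap)

/-- Two continuous actions agree on a closed set. -/
theorem isClosed_setOf_action_eq [T2Space K] {G : Type*} [TopologicalSpace G]
    {ρ σ : G → Module.End K V} (hρ : IsContinuousAction K ρ) (hσ : IsContinuousAction K σ) :
    IsClosed {g | ρ g = σ g} := by
  let _ : TopologicalSpace V := moduleTopology K V
  have : IsModuleTopology K V := ⟨rfl⟩
  have : T2Space V := t2Space_of_isModuleTopology (K := K)
  have h : {g | ρ g = σ g} = ⋂ v, {g | ρ g v = σ g v} := by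
    ext g
    simp only [Set.mem_iInter]
    exact LinearMap.ext_iff
  rw [h]
  refine isClosed_iInter fun v => isClosed_eq ?_ ?_
  · exact Continuous.comp hρ (continuous_id.prodMk continuous_const)
  · exact Continuous.comp hσ (continuous_id.prodMk continuous_const)

end Topology

/-! ### Continuity of the representation attached to split data. -/

section Rep
variable {p : ℕ} [Fact p.Prime] {d : ℕ} {K : Type*} [NormedField K] [NormedAlgebra ℚ_[p] K]
  [CharZero K] {V : Type*} [AddCommGroup V] [Module K V] [FiniteDimensional K V]
  {G : Type*} [Group G] [TopologicalSpace G] {χ : G →* ℤ_[p]ˣ} {s : Fin d → G → ℤ_[p]}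

theorem continuous_algebraMap_coe : Continuous fun a : ℤ_[p] => algebraMap ℚ_[p] K a :=
  (continuous_algebraMap ℚ_[p] K).comp continuous_subtype_val

theorem continuous_unitK : Continuous (unitK p K) := by
  refine Continuous.units_map _ ?_
  exact continuous_algebraMap_coe

theorem SplitData.isContinuousAction_rep (D : SplitData K V d) (hG : IsAffineGroup χ s) :
    IsContinuousAction K (fun g => D.rep hG g) := by
  let _ : TopologicalSpace (Module.End K V) := moduleTopology K (Module.End K V)
  have : IsModuleTopology K (Module.End K V) := ⟨rfl⟩
  have := IsModuleTopology.isTopologicalRing K (Module.End K V)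
  refine isContinuousAction_of_continuous ?_
  refine ((continuous_nexp ?_ fun g => D.Y_nilpotent _).mul ?_).mul
    (continuous_nexp ?_ fun g => D.smulN_nilpotent _)
  · exact continuous_finsetSum _ fun j _ =>
      Continuous.smul (f := fun g => algebraMap ℚ_[p] K (s j g)) (g := fun _ => D.y j)
        (continuous_algebraMap_coe.comp (hG.continuous_s j)) continuous_const
  · refine continuous_finsetSum _ fun n _ => Continuous.smul
      (f := fun g => ((unitK p K (χ g) ^ n : Kˣ) : K)) (g := fun _ => intProj D.S n) ?_
      continuous_const
    exact Units.continuous_val.comp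
      ((continuous_unitK.comp hG.continuous_chi).zpow n)
  · exact ((continuous_algebraMap ℚ_[p] K).comp
      (continuous_ulog.comp hG.continuous_chi)).smul continuous_const

end Rep

/-! ### Congruence subgroups and their topological generators. -/

section Embedding
variable {p : ℕ} [hp : Fact p.Prime] {d : ℕ} {G : Type*} [Group G] [TopologicalSpace G]
  {χ : G →* ℤ_[p]ˣ} {s : Fin d → G → ℤ_[p]}

theorem IsAffineGroup.s_one (hG : IsAffineGroup χ s) (j : Fin d) : s j 1 = 0 := by
  have := hG.s_mul j 1 1
  rw [mul_one, map_one, Units.val_one, one_mul] at this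
  simpa using this

theorem IsAffineGroup.s_inv (hG : IsAffineGroup χ s) (j : Fin d) (g : G) :
    s j g⁻¹ = -((χ g⁻¹ : ℤ_[p]ˣ) : ℤ_[p]) * s j g := by
  have := hG.s_mul j g⁻¹ g
  rw [inv_mul_cancel, hG.s_one] at this
  linear_combination -this

theorem IsAffineGroup.isEmbedding [CompactSpace G] (hG : IsAffineGroup χ s) :
    IsEmbedding fun g => (χ g, fun j => s j g) := by
  refine (IsClosedEmbedding.of_continuous_injective_isClosedMap
    (hG.continuous_chi.prodMk (continuous_pi hG.continuous_s)) ?_ ?_).isEmbedding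
  · intro g h hgh
    exact hG.injective g h (congrArg Prod.fst hgh) fun j => congrFun (congrArg Prod.snd hgh) j
  · exact (hG.continuous_chi.prodMk (continuous_pi hG.continuous_s)).isClosedMap

variable (p) in
/-- The subgroup `χ ≡ 1`, `s ≡ 0` modulo `p ^ M`. -/
def IsAffineGroup.congr (hG : IsAffineGroup χ s) (M : ℕ) : Subgroup G where
  carrier := {g | (p : ℤ_[p]) ^ M ∣ (χ g : ℤ_[p]) - 1 ∧ ∀ j, (p : ℤ_[p]) ^ M ∣ s j g}
  one_mem' := by
    refine ⟨by simp, fun j => ?_⟩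
    rw [hG.s_one]; exact dvd_zero _
  mul_mem' := by
    rintro g h ⟨h1, h2⟩ ⟨h3, h4⟩
    refine ⟨?_, fun j => ?_⟩
    · rw [map_mul, Units.val_mul]
      have : (χ g : ℤ_[p]) * χ h - 1 = (χ g : ℤ_[p]) * (χ h - 1) + (χ g - 1) := by ring
      rw [this]
      exact dvd_add (h3.mul_left _) h1
    · rw [hG.s_mul]
      exact dvd_add (h2 j) ((h4 j).mul_left _)
  inv_mem' := by
    rintro g ⟨h1, h2⟩
    refine ⟨?_, fun j => ?_⟩
    · have : ((χ g⁻¹ : ℤ_[p]ˣ) : ℤ_[p]) - 1 = -((χ g⁻¹ : ℤ_[p]ˣ) : ℤ_[p]) * (χ g - 1) := by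
        have h : ((χ g⁻¹ : ℤ_[p]ˣ) : ℤ_[p]) * χ g = 1 := by
          rw [← Units.val_mul, ← map_mul, inv_mul_cancel, map_one, Units.val_one]
        linear_combination h
      rw [this]
      exact h1.mul_left _
    · rw [hG.s_inv]
      exact (h2 j).mul_left _

/-- Normality is needed to compare two extensions of a representation from the congruence subgroup
to the whole group. -/
theorem IsAffineGroup.conj_mem_congr (hG : IsAffineGroup χ s) {M : ℕ} (g : G) {h : G}
    (hh : h ∈ hG.congr p M) : g⁻¹ * h * g ∈ hG.congr p M := by
  refine ⟨?_, fun j => ?_⟩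
  · have : χ (g⁻¹ * h * g) = χ h := by
      rw [map_mul, map_mul, map_inv, mul_comm, mul_inv_cancel_left]
    rw [this]; exact hh.1
  · have : s j (g⁻¹ * h * g) =
        ((χ g⁻¹ : ℤ_[p]ˣ) : ℤ_[p]) * (s j h + ((χ h : ℤ_[p]) - 1) * s j g) := by
      rw [hG.s_mul, hG.s_mul, hG.s_inv, map_mul, Units.val_mul]; ring
    rw [this]
    exact (dvd_add (hh.2 j) (hh.1.mul_right _)).mul_left _

theorem isOpen_pow_dvd (M : ℕ) : IsOpen {x : ℤ_[p] | (p : ℤ_[p]) ^ M ∣ x} := by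
  have h1 : {x : ℤ_[p] | (p : ℤ_[p]) ^ M ∣ x} = {x : ℤ_[p] | ‖x‖ ≤ (p : ℝ) ^ (-M : ℤ)} := by
    ext g
    simp only [Set.mem_ofPred_eq, PadicInt.norm_le_pow_iff_mem_span_pow,
      Ideal.mem_span_singleton]
  rw [h1]
  have := IsUltrametricDist.isOpen_closedBall (0 : ℤ_[p]) (r := (p : ℝ) ^ (-M : ℤ))
    (zpow_pos (by exact_mod_cast hp.out.pos) _).ne'
  convert this using 1
  ext x; simp

theorem IsAffineGroup.isOpen_congr (hG : IsAffineGroup χ s) (M : ℕ) :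
    IsOpen (hG.congr p M : Set G) := by
  have : (hG.congr p M : Set G) = (fun g => (χ g : ℤ_[p]) - 1) ⁻¹' {x | (p : ℤ_[p]) ^ M ∣ x} ∩
      ⋂ j, s j ⁻¹' {x | (p : ℤ_[p]) ^ M ∣ x} := by
    ext g
    simp only [Set.mem_inter_iff, Set.mem_iInter]
    rfl
  rw [this]
  refine IsOpen.inter ?_ (isOpen_iInter_of_finite fun j =>
    (isOpen_pow_dvd M).preimage (hG.continuous_s j))
  exact (isOpen_pow_dvd M).preimage
    ((Units.continuous_val.comp hG.continuous_chi).sub continuous_const)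

/-- A closed subgroup contains `χ ≡ 1`, `s ≡ 0` modulo `p ^ M` if it contains topological
generators. -/
theorem IsAffineGroup.congr_le [CompactSpace G] (hG : IsAffineGroup χ s) {M : ℕ}
    (hM : ‖((p : ℚ_[p]) ^ M)‖ ≤ ‖(2 * p : ℚ_[p])‖)
    (hlift : ∀ (x : ℤ_[p]ˣ) (r : Fin d → ℤ_[p]), (p : ℤ_[p]) ^ M ∣ (x : ℤ_[p]) - 1 →
      (∀ j, (p : ℤ_[p]) ^ M ∣ r j) → ∃ g, χ g = x ∧ ∀ j, s j g = r j)
    {C : Subgroup G} (hC : IsClosed (C : Set G)) {g0 : G}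
    (hg0 : (χ g0 : ℤ_[p]) = 1 + (p : ℤ_[p]) ^ M) (hg0' : ∀ j, s j g0 = 0) (hg0C : g0 ∈ C)
    {τ : Fin d → G} (hτ : ∀ j, χ (τ j) = 1)
    (hτ' : ∀ i j, s i (τ j) = (Pi.single j ((p : ℤ_[p]) ^ M) : Fin d → ℤ_[p]) i)
    (hτC : ∀ j, τ j ∈ C) : hG.congr p M ≤ C := by
  have hemb := hG.isEmbedding
  -- translations
  have htrans : ∀ r : Fin d → ℤ_[p], ∃ g, χ g = 1 ∧ ∀ j, s j g = (p : ℤ_[p]) ^ M * r j := fun r =>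
    hlift 1 _ (by simp) fun j => dvd_mul_right _ _
  choose T hT1 hT2 using htrans
  have hTeq : ∀ g r, χ g = 1 → (∀ j, s j g = (p : ℤ_[p]) ^ M * r j) → g = T r := fun g r h1 h2 =>
    hG.injective _ _ (by rw [h1, hT1]) fun j => by rw [h2, hT2]
  have hTcont : Continuous T := by
    rw [hemb.continuous_iff]
    have : (fun g => (χ g, fun j => s j g)) ∘ T = fun r => (1, fun j => (p : ℤ_[p]) ^ M * r j) :=
      funext fun r => Prod.ext (hT1 r) (funext (hT2 r))
    rw [this]
    fun_prop
  -- The translations lying in `C` form a closed additive group, hence a `ℤ_p`-module, which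
  -- contains the standard basis by way of the `τ j`.
  let L : AddSubgroup (Fin d → ℤ_[p]) :=
    { carrier := {r | T r ∈ C}
      zero_mem' := by
        change T 0 ∈ C
        rw [← hTeq 1 0 (map_one χ) (fun j => by rw [hG.s_one]; simp)]
        exact C.one_mem
      add_mem' := by
        intro r r' h h'
        change T (r + r') ∈ C
        rw [← hTeq (T r * T r') (r + r') (by rw [map_mul, hT1, hT1, one_mul]) (fun j => by
          rw [hG.s_mul, hT1, hT2, hT2, Units.val_one, one_mul, Pi.add_apply, mul_add])]
        exact C.mul_mem h h'
      neg_mem' := by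
        intro r h
        change T (-r) ∈ C
        rw [← hTeq (T r)⁻¹ (-r) (by rw [map_inv, hT1, inv_one]) (fun j => by
          rw [hG.s_inv, map_inv, hT1, hT2, inv_one, Units.val_one, Pi.neg_apply]; ring)]
        exact C.inv_mem h }
  have hL : IsClosed (L : Set (Fin d → ℤ_[p])) := hC.preimage hTcont
  have hLtop : ∀ r, T r ∈ C := by
    intro r
    change r ∈ L
    have : r = ∑ j, r j • (Pi.single j 1 : Fin d → ℤ_[p]) := by
      simp only [← Pi.single_smul, smul_eq_mul, mul_one]
      exact (Finset.univ_sum_single r).symm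
    rw [this]
    refine L.sum_mem fun j _ => smul_mem_of_isClosed L hL _ ?_
    change T _ ∈ C
    rw [← hTeq (τ j) _ (hτ j) (fun i => by
      rw [hτ', Pi.single_apply, Pi.single_apply]; split_ifs <;> simp)]
    exact hτC j
  -- the powers of `g0`
  intro g hg
  obtain ⟨h, hh1, hh2⟩ := hlift (χ g) 0 hg.1 fun j => dvd_zero _
  have hhC : h ∈ C := by
    have e0 : ((χ g0 : ℤ_[p]) : ℚ_[p]) - 1 = (p : ℚ_[p]) ^ M := by
      rw [hg0]; push_cast; ring
    -- The element `h` has no translation part; it is a limit of powers of `g0`.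
    obtain ⟨a, ha⟩ := exists_tendsto_pow (x := χ g0) (y := χ g) (by rwa [e0]) (by
      rw [e0]
      obtain ⟨y, hy⟩ := hg.1
      have : ((χ g : ℤ_[p]) : ℚ_[p]) - 1 = (p : ℚ_[p]) ^ M * y := by
        have := congrArg (fun z : ℤ_[p] => (z : ℚ_[p])) hy
        simpa using this
      rw [this, norm_mul]
      exact mul_le_of_le_one_right (norm_nonneg _) y.2)
    have hspow : ∀ (n : ℕ) j, s j (g0 ^ n) = 0 := by
      intro n j
      induction n with
      | zero => rw [pow_zero, hG.s_one]
      | succ n ih => rw [pow_succ, hG.s_mul, ih, hg0', mul_zero, add_zero]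
    have hlim : Tendsto (fun n => g0 ^ a n) atTop (𝓝 h) := by
      rw [hemb.tendsto_nhds_iff]
      have e : (fun g => (χ g, fun j => s j g)) ∘ (fun n => g0 ^ a n) =
          fun n => (χ g0 ^ a n, fun _ => 0) :=
        funext fun n => Prod.ext (map_pow _ _ _) (funext fun j => hspow _ j)
      rw [e, hh1]
      have : (fun j => s j h) = fun _ => 0 := funext hh2
      rw [this]
      exact ha.prodMk_nhds tendsto_const_nhds
    exact hC.mem_of_tendsto hlim (Eventually.of_forall fun n => C.pow_mem hg0C _)
  choose r hr using hg.2
  have hgT : g = T r * h := by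
    refine hG.injective _ _ (by rw [map_mul, hT1, one_mul, hh1]) fun j => ?_
    rw [hG.s_mul, hT1, hT2, hh2, hr]; simp
  rw [hgT]
  exact C.mul_mem (hLtop r) hhC

end Embedding

/-! ### Reconstructing split data from an open subgroup, and uniqueness of the extension. -/

section
variable {p : ℕ} [hp : Fact p.Prime] {d : ℕ} {K : Type*} [NormedField K] [NormedAlgebra ℚ_[p] K]
  [CharZero K] {V : Type*} [AddCommGroup V] [Module K V] [FiniteDimensional K V]

theorem ulog_pow (x : ℤ_[p]ˣ) (n : ℕ) : ulog (x ^ n) = n * ulog x := by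
  induction n with
  | zero => simp [ulog_one]
  | succ n ih => rw [pow_succ, ulog_mul, ih]; push_cast; ring

theorem unitK_injective : Function.Injective (unitK p K) := fun x y h =>
  Units.ext (Subtype.coe_injective ((algebraMap ℚ_[p] K).injective (congrArg Units.val h)))

/-- A unit with nonzero logarithm is not a root of unity, so distinct weights give distinct
eigenvalues. -/
theorem unitK_zpow_injective {x : ℤ_[p]ˣ} (hx : ulog x ≠ 0) :
    Function.Injective fun n : ℤ => ((unitK p K x ^ n : Kˣ) : K) := by
  have h : ¬ IsOfFinOrder x := by
    rw [isOfFinOrder_iff_pow_eq_one]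
    rintro ⟨n, hn, h⟩
    have := ulog_pow x n
    rw [h, ulog_one] at this
    exact (mul_ne_zero (by exact_mod_cast hn.ne') hx) this.symm
  intro a b hab
  have h1 : unitK p K x ^ a = unitK p K x ^ b := Units.ext hab
  rw [← map_zpow, ← map_zpow] at h1
  exact injective_zpow_iff_not_isOfFinOrder.2 h (unitK_injective h1)

variable {G : Type*} [Group G] [TopologicalSpace G] {χ : G →* ℤ_[p]ˣ} {s : Fin d → G → ℤ_[p]}

/-- The data of a representation, from the action of topological generators of an open subgroup. -/
theorem exists_splitData_of_generators (ρ : G →* Module.End K V)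
    (hflag : IsIteratedExtension (fun g => ρ g)
      (fun n g => ((unitK p K (χ g) ^ n : Kˣ) : K)) ⊤)
    {M : ℕ} {g0 : G} (hg0 : (χ g0 : ℤ_[p]) = 1 + (p : ℤ_[p]) ^ M) (hlog : ulog (χ g0) ≠ 0)
    {τ : Fin d → G} (hτ : ∀ j, χ (τ j) = 1) (hτcomm : ∀ i j, τ i * τ j = τ j * τ i)
    (hgτ : ∀ j, g0 * τ j = τ j ^ (1 + p ^ M) * g0) :
    ∃ D : SplitData K V d, (∃ P : Polynomial K, Polynomial.aeval (ρ g0) P = D.S) ∧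
      ρ g0 = D.opZ (χ g0) 0 ∧
      (∀ j, ρ (τ j) = D.opZ (1 : ℤ_[p]ˣ) (Pi.single j ((p : ℤ_[p]) ^ M))) ∧
      ∀ (A B : Submodule K V) (n : ℤ), A ≤ B →
        (∀ g, ∀ v ∈ B, ρ g v - ((unitK p K (χ g) ^ n : Kˣ) : K) • v ∈ A) →
        (∀ v ∈ B, (D.S + D.N) v - (n : K) • v ∈ A) ∧ ∀ j, ∀ v ∈ B, D.y j v ∈ A := by
  set A := ρ g0 with hA
  set w : Kˣ := unitK p K (χ g0) with hw
  set q : K := ((p ^ M : ℕ) : K) with hq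
  have hq0 : q ≠ 0 := Nat.cast_ne_zero.2 (pow_ne_zero _ hp.out.ne_zero)
  have hwq : (w : K) = 1 + q := by
    rw [hw, coe_unitK, hg0, hq]; push_cast; simp
  have hinj := unitK_zpow_injective (K := K) hlog
  have htop : ⊤ ≤ ⨆ n : ℤ, A.maxGenEigenspace ((w ^ n : Kˣ) : K) :=
    hflag.iSup_maxGenEigenspace g0 hinj
  -- The polynomial in `A = ρ g0` is the integer `n` on the generalized eigenspace of `w ^ n`.
  obtain ⟨P, hP1, hP2, hP3⟩ := exists_aeval_isIntDiag A hinj htop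
  set S := Polynomial.aeval A P with hS
  have hSA : Commute S A := aeval_commute_of_commute (Commute.refl A) P
  -- the operators `y j`
  have hnil : ∀ j, IsNilpotent (ρ (τ j) - 1) := fun j =>
    hflag.isNilpotent fun U W n _ _ _ hn v hv => by
      have := hn (τ j) v hv
      rwa [hτ, map_one, one_zpow, Units.val_one, one_smul] at this
  choose Q hQ0 hQ1 hQ2 using fun j => exists_nexp_aeval_eq (K := K) (hnil j)
  -- This is the logarithm of the unipotent operator `ρ (τ j)`.
  set z : Fin d → Module.End K V := fun j => Polynomial.aeval (ρ (τ j) - 1) (Q j) with hz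
  have hzexp : ∀ j, nexp K (z j) = ρ (τ j) := fun j => by rw [hz, hQ2, add_sub_cancel]
  have hzcomm : ∀ i j, Commute (z i) (z j) := fun i j => by
    have h1 : Commute (ρ (τ i) - 1) (ρ (τ j) - 1) := by
      have : Commute (ρ (τ i)) (ρ (τ j)) := by
        change ρ (τ i) * ρ (τ j) = ρ (τ j) * ρ (τ i)
        rw [← map_mul, ← map_mul, hτcomm]
      exact (this.sub_left (Commute.one_left _)).sub_right
        ((Commute.one_right _).sub_left (Commute.one_left _))
    exact aeval_commute_of_commute (aeval_commute_of_commute h1.symm _).symm _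
  -- Conjugation by `g0` raises `τ j` to the power `1 + p ^ M = w`. So `A z A⁻¹` and `w z` have
  -- equal exponentials and coincide.
  have hAz : ∀ j, A * z j = ((w : K) • z j) * A := fun j => by
    set Ai := ρ g0⁻¹
    have hAi : A * Ai = 1 := by rw [hA, ← map_mul, mul_inv_cancel, map_one]
    have hAi' : Ai * A = 1 := by rw [hA, ← map_mul, inv_mul_cancel, map_one]
    have hpow : ∀ k, (A * z j * Ai) ^ k = A * z j ^ k * Ai := fun k => by
      induction k with
      | zero => simp [hAi]
      | succ k ih =>
        rw [pow_succ, ih, pow_succ]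
        calc A * z j ^ k * Ai * (A * z j * Ai) = A * z j ^ k * (Ai * A) * z j * Ai := by
              simp only [mul_assoc]
          _ = _ := by rw [hAi', mul_one]; simp only [mul_assoc]
    have hn1 : IsNilpotent (A * z j * Ai) := by
      obtain ⟨k, hk⟩ := hQ1 j
      exact ⟨k, by rw [hpow]; change A * Polynomial.aeval _ _ ^ k * _ = 0; rw [hk]; simp⟩
    have h1 : nexp K (A * z j * Ai) = nexp K ((1 + p ^ M) • z j) := by
      rw [nexp_nsmul (hQ1 j), hzexp, ← map_pow]
      have h2 : A * nexp K (z j) = nexp K (A * z j * Ai) * A :=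
        nexp_mul_of_mul_eq K (hQ1 j) hn1 (by rw [mul_assoc _ Ai, hAi', mul_one])
      rw [hzexp, hA, ← map_mul, hgτ, map_mul, ← hA] at h2
      calc nexp K (A * z j * Ai) = nexp K (A * z j * Ai) * (A * Ai) := by rw [hAi, mul_one]
        _ = ρ (τ j ^ (1 + p ^ M)) * A * Ai := by rw [h2]; simp only [mul_assoc]
        _ = _ := by rw [mul_assoc, hAi, mul_one]
    have h3 := nexp_injective hn1 ((hQ1 j).smul _) h1
    have h4 : (1 + p ^ M) • z j = (w : K) • z j := by
      rw [← Nat.cast_smul_eq_nsmul K, hwq, hq, Nat.cast_add, Nat.cast_one]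
    change A * z j * Ai = (1 + p ^ M) • z j at h3
    rw [← h4, ← h3, mul_assoc _ Ai, hAi', mul_one]
  -- By `hAz` the operator `z j` moves the generalized eigenspace of `w ^ n` to that of `w ^ (n +
  -- 1)`.
  have hSz : ∀ j, S * z j = z j * S + z j := fun j => by
    refine hP3 _ fun n v hv => map_mem_maxGenEigenspace (z := (w : K)) (fun v => ?_) hv
    have := LinearMap.congr_fun (hAz j) v
    simp only [Module.End.mul_apply, LinearMap.smul_apply] at this
    change A (z j v) - ((w ^ (n + 1) : Kˣ) : K) • z j v = (w : K) • z j (A v - _)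
    rw [this, map_sub, map_smul, smul_sub, smul_smul, zpow_add, zpow_one, mul_comm,
      Units.val_mul]
  -- the operator `N`
  set R := intFun S fun n => ((w⁻¹ ^ n : Kˣ) : K) with hR
  set R' := intFun S fun n => ((w ^ n : Kˣ) : K) with hR'
  have hRR' : R' * R = 1 := by
    rw [hR, hR', ← hP1.intFun_mul, ← hP1.intFun_one]
    congr 1; funext n
    rw [← Units.val_mul, ← mul_zpow, mul_inv_cancel, one_zpow, Units.val_one]
  have hSflag : ∀ (U W : Submodule K V) (n : ℤ), U ≤ W →
      (∀ g, ∀ v ∈ W, ρ g v - ((unitK p K (χ g) ^ n : Kˣ) : K) • v ∈ U) →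
      ∀ v ∈ W, S v - (n : K) • v ∈ U := fun U W n hUW hn =>
    aeval_sub_mem_of_maxGenEigenspace hUW (hn g0) (hP2 n)
  have hRflag : ∀ (U W : Submodule K V) (n : ℤ), U ≤ W →
      (∀ g, ∀ v ∈ W, ρ g v - ((unitK p K (χ g) ^ n : Kˣ) : K) • v ∈ U) →
      ∀ v ∈ W, (R * A - 1) v ∈ U := fun U W n hUW hn => by
    obtain ⟨T, hT⟩ := intFun_eq_aeval S fun n => ((w⁻¹ ^ n : Kˣ) : K)
    have h1 : ∀ v ∈ W, R v - ((w⁻¹ ^ n : Kˣ) : K) • v ∈ U := by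
      rw [hR, hT]
      refine aeval_sub_mem_of_maxGenEigenspace hUW (hSflag U W n hUW hn) fun v hv => ?_
      obtain ⟨k, hk⟩ := (Module.End.mem_maxGenEigenspace _ _ _).1 hv
      rw [← hT]
      exact intFun_apply (hP1.apply_eq_of_pow hk) _
    have h2 := comp_sub_mem hUW h1 (hn g0)
    rw [← hw, ← Units.val_mul, ← mul_zpow, inv_mul_cancel, one_zpow, Units.val_one] at h2
    exact fun v hv => by simpa using h2 v hv
  -- Here `R = w ^ (-S)`, so `R * A` is the unipotent part of `A`; its logarithm will be a multiple
  -- of `N`.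
  set m := R * A - 1 with hm
  have hmnil : IsNilpotent m := hflag.isNilpotent fun U W n hUW _ _ hn => hRflag U W n hUW hn
  obtain ⟨T, hT0, hT1, hT2⟩ := exists_nexp_aeval_eq (K := K) hmnil
  rw [hm, add_sub_cancel, ← hm] at hT2
  have hSR : Commute S R := (intFun_commute (Commute.refl S) _).symm
  have hSm : Commute S m := (hSR.mul_right hSA).sub_right (Commute.one_right _)
  have hmz : ∀ j, Commute m (z j) := fun j => by
    -- Auxiliary data with `N = 0`, used only to compute the conjugation by `R`; it cancels the
    -- conjugation by `A`.
    let D0 : SplitData K V d := ⟨S, 0, z, hP1, ⟨1, by simp⟩, hQ1, hzcomm, Commute.zero_right _,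
      fun _ => Commute.zero_left _, hSz⟩
    have h1 := D0.pow_mul_Y w⁻¹ (Pi.single j 1)
    rw [D0.Y_smul, D0.Y_single, one_smul] at h1
    change R * z j = ((w⁻¹ : Kˣ) : K) • z j * R at h1
    have h2 : Commute (R * A) (z j) := by
      change R * A * z j = z j * (R * A)
      rw [mul_assoc, hAz, smul_mul_assoc, mul_smul_comm, ← mul_assoc, h1, smul_mul_assoc,
        smul_mul_assoc, smul_smul, ← Units.val_mul, mul_inv_cancel, Units.val_one, one_smul,
        mul_assoc]
    exact h2.sub_left (Commute.one_left _)
  set l : K := algebraMap ℚ_[p] K (ulog (χ g0)) with hl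
  have hl0 : l ≠ 0 := (map_ne_zero _).2 hlog
  -- The factors `l⁻¹` and `q⁻¹` normalize the logarithms: `g0` must act through `exp (l N)` with `l
  -- = log χ(g0)`, and `τ j` is the translation by `q = p ^ M` along the `j`-th axis.
  let D : SplitData K V d := ⟨S, l⁻¹ • Polynomial.aeval m T, fun j => q⁻¹ • z j, hP1, hT1.smul _,
    fun j => (hQ1 j).smul _, fun i j => ((hzcomm i j).smul_left _).smul_right _,
    (aeval_commute_of_commute hSm.symm T).symm.smul_right _,
    fun j => ((aeval_commute_of_commute (hmz j) T).smul_left _).smul_right _,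
    fun j => by rw [mul_smul_comm, hSz, smul_mul_assoc, smul_add]⟩
  refine ⟨D, ⟨P, rfl⟩, ?_, fun j => ?_, fun U W n hUW hn => ⟨fun v hv => ?_, fun j v hv => ?_⟩⟩
  · have h0 : (fun j => algebraMap ℚ_[p] K ((0 : Fin d → ℤ_[p]) j)) = 0 := by funext j; simp
    have hlN : l • D.N = Polynomial.aeval m T := by
      change l • l⁻¹ • Polynomial.aeval m T = _
      rw [smul_smul, mul_inv_cancel₀ hl0, one_smul]
    rw [SplitData.opZ, h0, SplitData.op, D.Y_zero, nexp_zero, one_mul, ← hl, hlN, hT2]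
    change A = R' * (R * A)
    rw [← mul_assoc, hRR', one_mul]
  · have h0 : (fun i => algebraMap ℚ_[p] K
        ((Pi.single j ((p : ℤ_[p]) ^ M) : Fin d → ℤ_[p]) i)) = Pi.single j q := by
      funext i
      rw [Pi.single_apply, Pi.single_apply]
      split_ifs <;> simp [hq]
    have hqz : q • D.y j = z j := by
      change q • q⁻¹ • z j = _
      rw [smul_smul, mul_inv_cancel₀ hq0, one_smul]
    rw [SplitData.opZ, h0, SplitData.op, D.Y_single, hqz, hzexp, map_one, D.pow_one, ulog_one,
      map_zero, zero_smul, nexp_zero, mul_one, mul_one]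
  · have h1 := aeval_sub_mem (μ := 0) hUW
      (fun v hv => by simpa using hRflag U W n hUW hn v hv) T v hv
    rw [hT0, zero_smul, sub_zero] at h1
    change S v + l⁻¹ • Polynomial.aeval m T v - _ ∈ U
    rw [add_sub_right_comm]
    exact U.add_mem (hSflag U W n hUW hn v hv) (U.smul_mem _ h1)
  · have h1 := aeval_sub_mem (T := ρ (τ j) - 1) (μ := 0) hUW (fun v hv => by
      have := hn (τ j) v hv
      rw [hτ, map_one, one_zpow, Units.val_one] at this
      simpa using this) (Q j) v hv
    rw [hQ0, zero_smul, sub_zero] at h1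
    exact U.smul_mem _ h1

/-- A representation which agrees with that of the data on an open normal subgroup. -/
theorem SplitData.eq_rep_of_eq_on [CompactSpace G] [IsTopologicalGroup G] (hG : IsAffineGroup χ s)
    (ρ : G →* Module.End K V) (D : SplitData K V d)
    (hflag : IsIteratedExtension (fun g => ρ g)
      (fun n g => ((unitK p K (χ g) ^ n : Kˣ) : K)) ⊤)
    (hD : ∀ (A B : Submodule K V) (n : ℤ), A ≤ B →
        (∀ g, ∀ v ∈ B, ρ g v - ((unitK p K (χ g) ^ n : Kˣ) : K) • v ∈ A) →
        (∀ v ∈ B, (D.S + D.N) v - (n : K) • v ∈ A) ∧ ∀ j, ∀ v ∈ B, D.y j v ∈ A)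
    {M : ℕ} (heq : ∀ g ∈ hG.congr p M, ρ g = D.rep hG g) {P : Polynomial K} {g0 : G}
    (hP : Polynomial.aeval (ρ g0) P = D.S) (hg0 : g0 ∈ hG.congr p M) (g : G) :
    ρ g = D.rep hG g := by
  set w := unitK p K (χ g) with hw
  -- some power of `g` is in the open subgroup
  obtain ⟨m, hm, hgm⟩ : ∃ m : ℕ, m ≠ 0 ∧ g ^ m ∈ hG.congr p M := by
    have : Finite (G ⧸ hG.congr p M) := Subgroup.quotient_finite_of_isOpen _ (hG.isOpen_congr M)
    obtain ⟨m, hm, -, h⟩ := Subgroup.exists_pow_mem_of_index_ne_zero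
      (H := hG.congr p M) (Subgroup.index_ne_zero_of_finite) g
    exact ⟨m, hm.ne', h⟩
  -- With `c = x ^ S` for `x = χ g`, both `a c⁻¹` and `b c⁻¹` turn out to be unipotent with equal
  -- `m`-th powers, which forces `a = b`.
  set a := ρ g
  set b := D.rep hG g
  set b' := D.rep hG g⁻¹
  have hbb' : b * b' = 1 := by rw [← map_mul, mul_inv_cancel, map_one]
  have hb'b : b' * b = 1 := by rw [← map_mul, inv_mul_cancel, map_one]
  set c := D.pow w
  set c' := D.pow w⁻¹
  have hcc' : c * c' = 1 := D.pow_mul_pow_inv w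
  have hc'c : c' * c = 1 := D.pow_inv_mul_pow w
  have hunip : ∀ σ : Module.End K V, (∀ (A B : Submodule K V) (n : ℤ), A ≤ B →
      (∀ g, ∀ v ∈ B, ρ g v - ((unitK p K (χ g) ^ n : Kˣ) : K) • v ∈ A) →
      ∀ v ∈ B, σ v - ((w ^ n : Kˣ) : K) • v ∈ A) → IsNilpotent (σ * c' - 1) := by
    intro σ hσ
    refine hflag.isNilpotent fun U W n hUW _ _ hn v hv => ?_
    have h1 : ∀ v ∈ W, c' v - ((w⁻¹ ^ n : Kˣ) : K) • v ∈ U := by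
      have := D.op_sub_mem hUW (hD U W n hUW hn).1 (hD U W n hUW hn).2 w⁻¹ 0 0
      rwa [op, D.Y_zero, zero_smul, nexp_zero, one_mul, mul_one] at this
    have h2 := comp_sub_mem hUW (hσ U W n hUW hn) h1 v hv
    rw [← Units.val_mul, ← mul_zpow, mul_inv_cancel, one_zpow, Units.val_one] at h2
    simpa using h2
  have ha : IsNilpotent (a * c' - 1) := hunip a fun A B n _ hn => hn g
  have hb : IsNilpotent (b * c' - 1) := hunip b fun A B n hAB hn =>
    D.op_sub_mem hAB (hD A B n hAB hn).1 (hD A B n hAB hn).2 _ _ _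
  -- `a ^ k b ^ (-k)` commutes with the open subgroup
  have hcomm : ∀ k : ℕ, ∀ h ∈ hG.congr p M, Commute (ρ h) (a ^ k * b' ^ k) := by
    intro k
    induction k with
    | zero => intro h _; simp
    | succ k ih =>
      intro h hh
      have h' := hG.conj_mem_congr g hh
      have e1 : ρ h * a = a * ρ (g⁻¹ * h * g) := by
        rw [← map_mul, ← map_mul]; congr 1; group
      have e2 : ρ (g⁻¹ * h * g) * b' = b' * ρ h := by
        rw [heq _ h', heq _ hh, ← map_mul, ← map_mul]; congr 1; group
      change ρ h * (a ^ (k + 1) * b' ^ (k + 1)) = a ^ (k + 1) * b' ^ (k + 1) * ρ h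
      calc ρ h * (a ^ (k + 1) * b' ^ (k + 1)) = ρ h * a * (a ^ k * b' ^ k) * b' := by
            rw [pow_succ', pow_succ]; simp only [mul_assoc]
        _ = a * (ρ (g⁻¹ * h * g) * (a ^ k * b' ^ k)) * b' := by rw [e1]; simp only [mul_assoc]
        _ = a * (a ^ k * b' ^ k) * (ρ (g⁻¹ * h * g) * b') := by
            rw [(ih _ h').eq]; simp only [mul_assoc]
        _ = _ := by rw [e2, pow_succ', pow_succ]; simp only [mul_assoc]
  -- The product telescopes: `a ^ k b ^ (-k)` commutes with `ρ g0`, hence with `S`, which is a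
  -- polynomial in `ρ g0`, and hence with `c'`.
  have hpow : ∀ k : ℕ, (a * c') ^ k * (c * b') ^ k = a ^ k * b' ^ k := by
    intro k
    induction k with
    | zero => simp
    | succ k ih =>
      have h1 : Commute c' (a ^ k * b' ^ k) := D.pow_commute _ (by
        rw [← hP]; exact aeval_commute_of_commute (hcomm k g0 hg0) P)
      calc (a * c') ^ (k + 1) * (c * b') ^ (k + 1)
          = a * c' * ((a * c') ^ k * (c * b') ^ k) * (c * b') := by
            rw [pow_succ', pow_succ]; simp only [mul_assoc]
        _ = a * (a ^ k * b' ^ k) * (c' * c) * b' := by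
            rw [ih, mul_assoc a, h1.eq]; simp only [mul_assoc]
        _ = _ := by rw [hc'c, mul_one, pow_succ', pow_succ]; simp only [mul_assoc]
  have hinv : (b * c') * (c * b') = 1 := by
    rw [mul_assoc, ← mul_assoc c', hc'c, one_mul, hbb']
  have hinv' : (c * b') * (b * c') = 1 := by
    rw [mul_assoc, ← mul_assoc b', hb'b, one_mul, hcc']
  -- Since `g ^ m` lies in the open subgroup, `a ^ m = b ^ m`.
  have hone : (a * c') ^ m * (c * b') ^ m = 1 := by
    rw [hpow, ← map_pow, ← map_pow, heq _ hgm, ← map_mul, inv_pow, mul_inv_cancel, map_one]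
  have hpm : (a * c') ^ m = (b * c') ^ m := by
    have h1 : (c * b') ^ m * (b * c') ^ m = 1 := by
      rw [← (show Commute (c * b') (b * c') from hinv'.trans hinv.symm).mul_pow, hinv', one_pow]
    calc (a * c') ^ m = (a * c') ^ m * ((c * b') ^ m * (b * c') ^ m) := by rw [h1, mul_one]
      _ = _ := by rw [← mul_assoc, hone, one_mul]
  have := unipotent_pow_injective K ha hb hm hpm
  calc a = a * c' * c := by rw [mul_assoc, hc'c, mul_one]
    _ = b * c' * c := by rw [this]
    _ = b := by rw [mul_assoc, hc'c, mul_one]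

end

/-! ### From representations of the group to split data. -/

section
variable {p : ℕ} [hp : Fact p.Prime] {d : ℕ} {K : Type*} [NormedField K] [NormedAlgebra ℚ_[p] K]
  [CharZero K] {V : Type*} [AddCommGroup V] [Module K V] [FiniteDimensional K V]
  {G : Type*} [Group G] [TopologicalSpace G] {χ : G →* ℤ_[p]ˣ} {s : Fin d → G → ℤ_[p]}

theorem norm_p_pow_le {M : ℕ} (hM : 2 ≤ M) : ‖((p : ℚ_[p]) ^ M)‖ ≤ ‖(2 * p : ℚ_[p])‖ := by
  have hp2 : (2 : ℝ) ≤ p := by exact_mod_cast hp.out.two_le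
  have h1 : ‖((p : ℚ_[p]) ^ M)‖ ≤ ‖((p : ℚ_[p]) ^ 2)‖ := by
    rw [norm_pow, norm_pow]
    exact pow_le_pow_of_le_one (norm_nonneg _) Padic.norm_p_lt_one.le hM
  refine h1.trans ?_
  rw [norm_two_mul_p_eq, norm_pow, Padic.norm_p]
  split_ifs with h
  · subst h; norm_num
  · rw [pow_two]
    exact mul_le_of_le_one_left (by positivity) (inv_le_one_of_one_le₀ (by linarith))

/-- Every object of `Rep^ℤ_K G` comes from data. -/
theorem exists_splitData_of_rep [CompactSpace G] [IsTopologicalGroup G] (hG : IsAffineGroup χ s)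
    (ρ : G →* Module.End K V) (hcont : IsContinuousAction K fun g => ρ g)
    (hflag : IsIteratedExtension (fun g => ρ g)
      (fun n g => ((unitK p K (χ g) ^ n : Kˣ) : K)) ⊤) :
    ∃ D : SplitData K V d, (∀ g, ρ g = D.rep hG g) ∧
      IsIteratedExtension (fun X => D.lie p X) (fun n X => (n : K) * delta0 p K d X) ⊤ := by
  obtain ⟨M0, hM0⟩ := hG.exists_lift
  -- Two conditions are imposed: elements congruent to the identity modulo `p ^ M` lift to the
  -- group, and `p ^ M` lies in the disc of the logarithm.
  set M := max M0 2 with hM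
  have hlift : ∀ (x : ℤ_[p]ˣ) (r : Fin d → ℤ_[p]), (p : ℤ_[p]) ^ M ∣ (x : ℤ_[p]) - 1 →
      (∀ j, (p : ℤ_[p]) ^ M ∣ r j) → ∃ g, χ g = x ∧ ∀ j, s j g = r j := fun x r hx hr =>
    hM0 x r ((pow_dvd_pow _ (le_max_left _ _)).trans hx)
      fun j => (pow_dvd_pow _ (le_max_left _ _)).trans (hr j)
  have hMn : ‖((p : ℚ_[p]) ^ M)‖ ≤ ‖(2 * p : ℚ_[p])‖ := norm_p_pow_le (le_max_right _ _)
  have hu : IsUnit (1 + (p : ℤ_[p]) ^ M) := by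
    rw [PadicInt.isUnit_iff]
    have h1 : ‖(p : ℤ_[p]) ^ M‖ < 1 := by
      have := lt_one_of_le hMn
      rw [← PadicInt.padic_norm_e_of_padicInt]
      push_cast
      exact this
    have := IsUltrametricDist.norm_add_eq_max_of_norm_ne_norm (x := (1 : ℤ_[p]))
      (y := (p : ℤ_[p]) ^ M) (by rw [norm_one]; exact h1.ne')
    rw [this, norm_one, max_eq_left h1.le]
  obtain ⟨x, hx⟩ := hu
  obtain ⟨g0, hg0, hg0'⟩ := hlift x 0 (by rw [hx, add_sub_cancel_left]) fun j => dvd_zero _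
  have htau : ∀ j, ∃ g, χ g = 1 ∧
      ∀ i, s i g = (Pi.single j ((p : ℤ_[p]) ^ M) : Fin d → ℤ_[p]) i := fun j =>
    hlift 1 _ (by simp) fun i => by
      rw [Pi.single_apply]; split_ifs <;> simp
  choose τ hτ hτ' using htau
  have hx1 : ((χ g0 : ℤ_[p]) : ℚ_[p]) - 1 = (p : ℚ_[p]) ^ M := by
    rw [hg0, hx]; push_cast; ring
  have hlog : ulog (χ g0) ≠ 0 := by
    rw [← norm_ne_zero_iff, ulog_eq_plog (by rwa [hx1]), norm_plog (by rwa [hx1]), hx1]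
    exact norm_ne_zero_iff.2 (pow_ne_zero _ (by exact_mod_cast hp.out.ne_zero))
  have hτpow : ∀ (j i : Fin d) (k : ℕ), χ (τ j ^ k) = 1 ∧ s i (τ j ^ k) = k * s i (τ j) := by
    intro j i k
    have h1 : ∀ k : ℕ, χ (τ j ^ k) = 1 := fun k => by rw [map_pow, hτ, one_pow]
    refine ⟨h1 k, ?_⟩
    induction k with
    | zero => rw [pow_zero, hG.s_one]; simp
    | succ k ih => rw [pow_succ, hG.s_mul, ih, h1]; push_cast; ring
  obtain ⟨D, ⟨P, hP⟩, hD1, hD2, hD3⟩ := exists_splitData_of_generators ρ hflag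
    (g0 := g0) (τ := τ) (M := M)
    (by rw [hg0, hx]) hlog hτ
    (fun i j => hG.injective _ _ (by rw [map_mul, map_mul, mul_comm]) fun k => by
      rw [hG.s_mul, hG.s_mul, hτ, hτ, Units.val_one, one_mul, one_mul, add_comm])
    (fun j => hG.injective _ _ (by rw [map_mul, map_mul, (hτpow j j _).1, hτ, mul_comm])
      fun i => by
        rw [hG.s_mul, hG.s_mul, (hτpow j i _).1, (hτpow j i _).2, hg0', hg0, hx]
        push_cast
        simp)
  -- The two continuous actions agree on a closed subgroup, which contains the topological
  -- generators.
  have hle : hG.congr p M ≤ MonoidHom.eqLocus ρ (D.rep hG) := by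
    refine hG.congr_le hMn hlift ?_ (g0 := g0) (τ := τ) (by rw [hg0, hx]) hg0' ?_ hτ
      (fun i j => hτ' j i) fun j => ?_
    · exact isClosed_setOf_action_eq hcont (D.isContinuousAction_rep hG)
    · change ρ g0 = D.rep hG g0
      rw [hD1, D.rep_apply]
      congr 1
      exact (funext hg0').symm
    · change ρ (τ j) = D.rep hG (τ j)
      rw [hD2, D.rep_apply, hτ]
      congr 1
      exact (funext fun i => hτ' j i).symm
  refine ⟨D, D.eq_rep_of_eq_on hG ρ hflag hD3 (fun g hg => hle hg) hP ⟨?_, fun j => ?_⟩, ?_⟩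
  · rw [hg0, hx, add_sub_cancel_left]
  · rw [hg0']; exact dvd_zero _
  · refine hflag.transfer fun A B n hAB _ _ hn X v hv => ?_
    obtain ⟨h1, h2⟩ := hD3 A B n hAB hn
    rw [D.lie_apply, D.lieLin_apply, rowEntryK_inl, LinearMap.add_apply, LinearMap.smul_apply,
      mul_comm, mul_smul, add_sub_right_comm, ← smul_sub]
    refine A.add_mem (A.smul_mem _ (h1 v hv)) ?_
    rw [SplitData.Y, LinearMap.sum_apply]
    exact A.sum_mem fun j _ => A.smul_mem _ (h2 j v hv)

end

/-! ### Difference quotients at the unit element. -/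

section Derivative
variable {K : Type*} [NormedField K] {A : Type*} [Ring A] [Algebra K A] [TopologicalSpace A]
  [IsTopologicalRing A] [ContinuousSMul K A] {α : Type*} {l : Filter α} {c : α → K}

theorem tendsto_one_of_tendsto_smul_sub (hc : Tendsto c l (𝓝 0)) (h0 : ∀ᶠ i in l, c i ≠ 0)
    {F : α → A} {T : A} (hF : Tendsto (fun i => (c i)⁻¹ • (F i - 1)) l (𝓝 T)) :
    Tendsto F l (𝓝 1) := by
  have h1 := (hc.smul hF).add_const 1
  rw [zero_smul, zero_add] at h1
  refine h1.congr' ?_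
  filter_upwards [h0] with i hi
  rw [smul_smul, mul_inv_cancel₀ hi, one_smul, sub_add_cancel]

/-- The product rule at the unit element. -/
theorem tendsto_smul_mul_sub_one (hc : Tendsto c l (𝓝 0)) (h0 : ∀ᶠ i in l, c i ≠ 0)
    {F F' : α → A} {T T' : A} (hF : Tendsto (fun i => (c i)⁻¹ • (F i - 1)) l (𝓝 T))
    (hF' : Tendsto (fun i => (c i)⁻¹ • (F' i - 1)) l (𝓝 T')) :
    Tendsto (fun i => (c i)⁻¹ • (F i * F' i - 1)) l (𝓝 (T + T')) := by
  have h1 := (hF.mul (tendsto_one_of_tendsto_smul_sub hc h0 hF')).add hF'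
  rw [mul_one] at h1
  refine h1.congr fun i => ?_
  rw [smul_mul_assoc, ← smul_add]
  congr 1
  noncomm_ring

/-- The exponential is a finite sum, and its terms of degree at least two keep a factor `e i → 0`
after division by `c i`. -/
theorem tendsto_smul_nexp_sub_one {b : A} (hb : IsNilpotent b) {e : α → K} {τ : K}
    (he : Tendsto e l (𝓝 0)) (hce : Tendsto (fun i => (c i)⁻¹ * e i) l (𝓝 τ)) :
    Tendsto (fun i => (c i)⁻¹ • (nexp K (e i • b) - 1)) l (𝓝 (τ • b)) := by
  obtain ⟨k, hk⟩ := hb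
  have h1 : ∀ i, (c i)⁻¹ • (nexp K (e i • b) - 1) =
      (∑ m ∈ Finset.range k, (((m + 1 + 1).factorial : K)⁻¹ * (((c i)⁻¹ * e i) * e i ^ (m + 1))) •
        b ^ (m + 1 + 1)) + ((c i)⁻¹ * e i) • b := by
    intro i
    have h2 : (e i • b) ^ (k + 1 + 1) = 0 := by
      rw [smul_pow, pow_eq_zero_of_le (by omega) hk, smul_zero]
    rw [nexp_eq_sum K h2, Finset.sum_range_succ', Finset.sum_range_succ']
    simp only [smul_pow, pow_zero, Nat.factorial_zero, Nat.cast_one, inv_one, one_smul,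
      add_sub_cancel_right, zero_add, Nat.factorial_one, pow_one, smul_add, Finset.smul_sum,
      smul_smul, one_mul]
    congr 1
    refine Finset.sum_congr rfl fun m _ => ?_
    congr 1
    ring
  simp only [h1]
  have h3 : Tendsto (fun i => ∑ m ∈ Finset.range k,
      (((m + 1 + 1).factorial : K)⁻¹ * (((c i)⁻¹ * e i) * e i ^ (m + 1))) • b ^ (m + 1 + 1)) l
      (𝓝 (∑ m ∈ Finset.range k,
      (((m + 1 + 1).factorial : K)⁻¹ * (τ * 0 ^ (m + 1))) • b ^ (m + 1 + 1))) :=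
    tendsto_finsetSum _ fun m _ =>
      ((hce.mul (he.pow (m + 1))).const_mul _).smul tendsto_const_nhds
  have h4 := h3.add (hce.smul (tendsto_const_nhds (x := b)))
  simpa using h4

end Derivative

/-! ### Differentiating the action along a one-parameter subgroup. -/

section
variable {p : ℕ} [hp : Fact p.Prime]

theorem pexp_intCast_mul {z : ℚ_[p]} (hz : ‖z‖ ≤ ‖(2 * p : ℚ_[p])‖) (n : ℤ) :
    pexp ((n : ℚ_[p]) * z) = pexp z ^ n := by
  have hneg : ∀ y : ℚ_[p], ‖y‖ ≤ ‖(2 * p : ℚ_[p])‖ → pexp (-y) = (pexp y)⁻¹ := fun y hy => by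
    refine eq_inv_of_mul_eq_one_left ?_
    rw [← pexp_add (by rwa [norm_neg]) hy, neg_add_cancel, pexp_zero]
  obtain ⟨m, rfl | rfl⟩ := n.eq_nat_or_neg
  · rw [Int.cast_natCast, pexp_natCast_mul hz, zpow_natCast]
  · have : ‖(m : ℚ_[p]) * z‖ ≤ ‖(2 * p : ℚ_[p])‖ := by
      rw [norm_mul]
      refine (mul_le_of_le_one_left (norm_nonneg _) ?_).trans hz
      exact_mod_cast Padic.norm_int_le_one (p := p) (m : ℤ)
    rw [Int.cast_neg, Int.cast_natCast, neg_mul, hneg _ this, pexp_natCast_mul hz, zpow_neg,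
      zpow_natCast]

variable {d : ℕ} {K : Type*} [NormedField K] [NormedAlgebra ℚ_[p] K]
  [CharZero K] {V : Type*} [AddCommGroup V] [Module K V] [FiniteDimensional K V]

theorem coe_unitK_zpow (x : ℤ_[p]ˣ) (n : ℤ) :
    ((unitK p K x ^ n : Kˣ) : K) = algebraMap ℚ_[p] K (((x : ℤ_[p]) : ℚ_[p]) ^ n) := by
  rw [Units.val_zpow_eq_zpow_val, map_zpow₀]; rfl

/-- Differentiation of the group action. -/
theorem SplitData.tendsto_opZ (D : SplitData K V d) {α : Type*} {l : Filter α} {a g : α → ℚ_[p]}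
    (ha : Tendsto a l (𝓝 0)) (h0 : ∀ᶠ i in l, a i ≠ 0)
    (hg : Tendsto (fun i => (a i)⁻¹ * g i) l (𝓝 1)) {X : gLie p d} {x : α → ℤ_[p]ˣ}
    {r : α → Fin d → ℤ_[p]}
    (hx : ∀ᶠ i in l, ((x i : ℤ_[p]) : ℚ_[p]) = pexp (a i * rowEntry p d (Sum.inl ()) X))
    (hr : ∀ᶠ i in l, ∀ j, (r i j : ℚ_[p]) = g i * rowEntry p d (Sum.inr j) X) (v : V) :
    TendstoFD K (fun i => (algebraMap ℚ_[p] K (a i))⁻¹ • (D.opZ (x i) (r i) v - v)) l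
      (D.lie p ((1 : K) ⊗ₜ X) v) := by
  let _ : TopologicalSpace (Module.End K V) := moduleTopology K (Module.End K V)
  have : IsModuleTopology K (Module.End K V) := ⟨rfl⟩
  have := IsModuleTopology.isTopologicalRing K (Module.End K V)
  let _ : TopologicalSpace V := moduleTopology K V
  have : IsModuleTopology K V := ⟨rfl⟩
  have := IsModuleTopology.toContinuousAdd K V
  set z := rowEntry p d (Sum.inl ()) X with hz
  set e : Fin d → K := fun j => algebraMap ℚ_[p] K (rowEntry p d (Sum.inr j) X) with he
  have hι : Continuous (algebraMap ℚ_[p] K) := continuous_algebraMap ℚ_[p] K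
  have lim : ∀ {f : α → ℚ_[p]} {y : ℚ_[p]}, Tendsto f l (𝓝 y) →
      Tendsto (fun i => algebraMap ℚ_[p] K (f i)) l (𝓝 (algebraMap ℚ_[p] K y)) :=
    fun h => (hι.tendsto _).comp h
  set c : α → K := fun i => algebraMap ℚ_[p] K (a i) with hc
  have hc0 : Tendsto c l (𝓝 0) := by simpa using lim ha
  have hcne : ∀ᶠ i in l, c i ≠ 0 := h0.mono fun i hi => (map_ne_zero _).2 hi
  -- the three factors
  have h1 : Tendsto (fun i => (c i)⁻¹ • (nexp K (algebraMap ℚ_[p] K (g i) • D.Y e) - 1)) l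
      (𝓝 (D.Y e)) := by
    have hg0 : Tendsto g l (𝓝 0) := by
      have := ha.mul hg
      rw [zero_mul] at this
      refine this.congr' (h0.mono fun i hi => ?_)
      rw [mul_inv_cancel_left₀ hi]
    have := tendsto_smul_nexp_sub_one (c := c) (D.Y_nilpotent e) (by simpa using lim hg0)
      (τ := 1) (by simpa [hc] using lim hg)
    rwa [one_smul] at this
  have h2 : Tendsto (fun i => (c i)⁻¹ • (nexp K (algebraMap ℚ_[p] K (a i * z) • D.N) - 1)) l
      (𝓝 (algebraMap ℚ_[p] K z • D.N)) := by
    refine tendsto_smul_nexp_sub_one D.nilp_N ?_ ?_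
    · simpa using lim (ha.mul_const z)
    · refine tendsto_const_nhds.congr' (h0.mono fun i hi => ?_)
      change _ = (algebraMap ℚ_[p] K (a i))⁻¹ * _
      rw [← map_inv₀, ← map_mul, inv_mul_cancel_left₀ hi]
  have h3 : Tendsto (fun i => (c i)⁻¹ • (D.pow (unitK p K (x i)) - 1)) l
      (𝓝 (algebraMap ℚ_[p] K z • D.S)) := by
    have e1 : ∀ i, (c i)⁻¹ • (D.pow (unitK p K (x i)) - 1) = ∑ n ∈ intWeights D.S,
        ((c i)⁻¹ * (((unitK p K (x i) ^ n : Kˣ) : K) - 1)) • intProj D.S n := fun i => by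
      rw [← D.diag.intFun_one, pow, intFun, intFun, ← Finset.sum_sub_distrib, Finset.smul_sum]
      refine Finset.sum_congr rfl fun n _ => ?_
      rw [← sub_smul, smul_smul]
    have e2 : algebraMap ℚ_[p] K z • D.S = ∑ n ∈ intWeights D.S,
        (algebraMap ℚ_[p] K ((n : ℚ_[p]) * z)) • intProj D.S n := by
      conv_lhs => rw [← D.diag.intFun_cast, intFun, Finset.smul_sum]
      refine Finset.sum_congr rfl fun n _ => ?_
      rw [smul_smul, map_mul, map_intCast, mul_comm]
    simp only [e1]
    rw [e2]
    refine tendsto_finsetSum _ fun n _ => Tendsto.smul ?_ tendsto_const_nhds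
    -- On the weight `n` eigenspace the operator is `exp (a z) ^ n = exp (n a z)`, with derivative
    -- `n z`.
    have h4 := lim (tendsto_pexp_sub_one_div ha ((n : ℚ_[p]) * z) h0)
    refine h4.congr' ?_
    have hsmall : ∀ᶠ i in l, ‖a i * z‖ ≤ ‖(2 * p : ℚ_[p])‖ := by
      have := (ha.mul_const z).norm
      rw [zero_mul, norm_zero] at this
      exact this.eventually (eventually_le_nhds norm_two_mul_p_pos)
    filter_upwards [hx, hsmall] with i hi hi'
    rw [coe_unitK_zpow, hi, map_mul, map_sub, map_inv₀, map_one, ← pexp_intCast_mul hi',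
      mul_left_comm]
  have h5 := tendsto_smul_mul_sub_one hc0 hcne (tendsto_smul_mul_sub_one hc0 hcne h1 h3) h2
  have e3 : D.Y e + algebraMap ℚ_[p] K z • D.S + algebraMap ℚ_[p] K z • D.N =
      D.lie p ((1 : K) ⊗ₜ X) := by
    rw [lie_apply, lieLin_apply]
    simp only [rowEntryK_tmul, one_mul, smul_add]
    abel
  rw [e3] at h5
  have h6 := ((IsModuleTopology.continuous_of_linearMap
    (LinearMap.applyₗ v : Module.End K V →ₗ[K] V)).tendsto _).comp h5
  refine h6.congr' ?_
  have hsmall : ∀ᶠ i in l, ‖a i * z‖ ≤ ‖(2 * p : ℚ_[p])‖ := by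
    have := (ha.mul_const z).norm
    rw [zero_mul, norm_zero] at this
    exact this.eventually (eventually_le_nhds norm_two_mul_p_pos)
  filter_upwards [hx, hr, hsmall] with i hi hi' hi2
  have e4 : (fun j => algebraMap ℚ_[p] K (r i j)) = algebraMap ℚ_[p] K (g i) • e := by
    funext j
    rw [hi', map_mul]; rfl
  have e5 : ulog (x i) = a i * z := by
    rw [ulog_eq_plog (by rw [hi]; exact norm_pexp_sub_one_le hi2), hi, plog_pexp hi2]
  rw [opZ, op, e4, D.Y_smul, e5]
  rfl

end

/-! ### Conjugating the semisimple part by translations. -/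

namespace SplitData
variable {K : Type*} [Field K] [CharZero K] {V : Type*} [AddCommGroup V] [Module K V] {d : ℕ}

theorem S_mul_Y_pow (D : SplitData K V d) (r : Fin d → K) (k : ℕ) :
    D.S * D.Y r ^ k = D.Y r ^ k * D.S + (k : K) • D.Y r ^ k := by
  induction k with
  | zero => simp
  | succ k ih =>
    rw [pow_succ, ← mul_assoc, ih, add_mul, mul_assoc, D.S_mul_Y, mul_add, smul_mul_assoc,
      Nat.cast_succ, add_smul, one_smul, mul_assoc]
    abel

/-- The commutator `[S, Y] = Y` commutes with `Y`, so conjugating `S` by `exp Y` only adds the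
first-order term. -/
theorem S_mul_nexp_Y (D : SplitData K V d) (r : Fin d → K) :
    D.S * nexp K (D.Y r) = nexp K (D.Y r) * (D.S + D.Y r) := by
  obtain ⟨k, hk⟩ := D.Y_nilpotent r
  have hk' : D.Y r ^ (k + 1) = 0 := by rw [pow_succ, hk, zero_mul]
  have h1 : nexp K (D.Y r) * D.Y r =
      ∑ i ∈ Finset.range (k + 1), ((i.factorial : K)⁻¹) • (i : K) • D.Y r ^ i := by
    rw [nexp_eq_sum K hk, Finset.sum_range_succ', Finset.sum_mul]
    simp only [Nat.cast_zero, zero_smul, smul_zero, add_zero]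
    refine Finset.sum_congr rfl fun i _ => ?_
    rw [smul_mul_assoc, ← pow_succ, smul_smul]
    congr 1
    have h2 : ((i + 1 : ℕ) : K) ≠ 0 := Nat.cast_ne_zero.2 i.succ_ne_zero
    rw [Nat.factorial_succ, Nat.cast_mul, mul_inv, mul_right_comm, inv_mul_cancel₀ h2, one_mul]
  rw [mul_add, h1, nexp_eq_sum K hk', Finset.mul_sum, Finset.sum_mul, ← Finset.sum_add_distrib]
  refine Finset.sum_congr rfl fun i _ => ?_
  rw [mul_smul_comm, S_mul_Y_pow, smul_add, smul_mul_assoc]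

/-- Conjugation of `S + N` by a translation. -/
theorem nexp_Y_conj (D : SplitData K V d) (c : Fin d → K) (l : K) (n : ℕ) :
    (l • (D.S + D.N) + D.Y (-l • c)) ^ n * nexp K (D.Y c) =
      nexp K (D.Y c) * (l • (D.S + D.N)) ^ n := by
  have h0 : Commute D.N (nexp K (D.Y c)) := nexp_commute K (D.Y_nilpotent c) (D.N_commute_Y c)
  have h1 : (l • (D.S + D.N) + D.Y (-l • c)) * nexp K (D.Y c) =
      nexp K (D.Y c) * (l • (D.S + D.N)) := by
    have h2 : Commute (D.Y c) (nexp K (D.Y c)) := nexp_commute K (D.Y_nilpotent c) (Commute.refl _)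
    rw [D.Y_smul, add_mul, smul_mul_assoc, add_mul, D.S_mul_nexp_Y, h0.eq, smul_mul_assoc, h2.eq,
      mul_smul_comm, mul_add, mul_add, neg_smul, smul_add, smul_add, smul_add]
    abel
  induction n with
  | zero => simp
  | succ n ih => rw [pow_succ', mul_assoc, ih, ← mul_assoc, h1, mul_assoc, pow_succ']

end SplitData

/-! ### Summing the exponential series. -/

section Series
variable {p : ℕ} [hp : Fact p.Prime] {d : ℕ} {K : Type*} [NormedField K] [NormedAlgebra ℚ_[p] K]
  [CharZero K] {V : Type*} [AddCommGroup V] [Module K V]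

/-- The exponential series of a scalar plus a nilpotent operator. -/
theorem hasSumFD_scalar_add_nilpotent {a : K} {b : K}
    (hab : HasSum (fun n : ℕ => (n.factorial : K)⁻¹ * a ^ n) b) {M : Module.End K V}
    (hM : IsNilpotent M) (v : V) :
    HasSumFD K (fun n : ℕ => (n.factorial : K)⁻¹ • ((a • (1 : Module.End K V) + M) ^ n) v)
      (b • nexp K M v) := by
  let _ : TopologicalSpace V := moduleTopology K V
  have : IsModuleTopology K V := ⟨rfl⟩
  have := IsModuleTopology.toContinuousAdd K V
  obtain ⟨m, hm⟩ := hM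
  have hterm : ∀ n : ℕ, (n.factorial : K)⁻¹ • ((a • (1 : Module.End K V) + M) ^ n) v =
      ∑ k ∈ Finset.range m, ((n.factorial : K)⁻¹ * (n.choose k) * a ^ (n - k)) • (M ^ k) v := by
    intro n
    have hc : Commute M (a • (1 : Module.End K V)) := (Commute.one_right M).smul_right a
    rw [add_comm, hc.add_pow, LinearMap.sum_apply, Finset.smul_sum]
    have h1 : ∀ k, (n.factorial : K)⁻¹ • (M ^ k * (a • (1 : Module.End K V)) ^ (n - k) *
        (n.choose k : Module.End K V)) v =
        ((n.factorial : K)⁻¹ * (n.choose k) * a ^ (n - k)) • (M ^ k) v := fun k => by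
      have h2 : (n.choose k : Module.End K V) = (n.choose k : K) • 1 := by
        rw [Nat.cast_smul_eq_nsmul, nsmul_one]
      rw [h2, smul_pow, one_pow, mul_smul_comm, mul_smul_comm, mul_one, mul_one,
        LinearMap.smul_apply, LinearMap.smul_apply, smul_smul, smul_smul, mul_assoc]
    simp only [h1]
    -- The binomial sum stops at `n`, the wanted one at `m`; both are padded with zero terms up to
    -- the maximum.
    have h3 : ∀ (s : ℕ), (∀ k, s ≤ k →
        ((n.factorial : K)⁻¹ * (n.choose k) * a ^ (n - k)) • (M ^ k) v = 0) →
        ∑ k ∈ Finset.range s, ((n.factorial : K)⁻¹ * (n.choose k) * a ^ (n - k)) • (M ^ k) v =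
        ∑ k ∈ Finset.range (max (n + 1) m),
          ((n.factorial : K)⁻¹ * (n.choose k) * a ^ (n - k)) • (M ^ k) v ∨ max (n + 1) m < s := by
      intro s hs
      by_cases h : s ≤ max (n + 1) m
      · refine Or.inl (Finset.sum_subset (Finset.range_subset_range.2 h) fun k _ hk => hs k ?_)
        simpa using hk
      · exact Or.inr (not_le.1 h)
    rw [(h3 (n + 1) fun k hk => by rw [Nat.choose_eq_zero_of_lt hk]; simp).resolve_right
      (not_lt.2 (le_max_left _ _)),
      (h3 m fun k hk => by rw [pow_eq_zero_of_le hk hm]; simp).resolve_right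
      (not_lt.2 (le_max_right _ _))]
  -- Cancelling factorials and shifting by `k` identifies the coefficient of `M ^ k` with the
  -- exponential series divided by `k!`.
  have hcoef : ∀ k : ℕ, HasSum (fun n : ℕ => (n.factorial : K)⁻¹ * (n.choose k) * a ^ (n - k))
      ((k.factorial : K)⁻¹ * b) := by
    intro k
    refine ((add_left_injective k).hasSum_iff fun n hn => ?_).1 ?_
    · have : n < k := by
        by_contra h
        exact hn ⟨n - k, Nat.sub_add_cancel (not_lt.1 h)⟩
      rw [Nat.choose_eq_zero_of_lt this]; simp
    · have e : (fun n : ℕ => (n.factorial : K)⁻¹ * (n.choose k) * a ^ (n - k)) ∘ (fun j => j + k) =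
          fun j => (k.factorial : K)⁻¹ * ((j.factorial : K)⁻¹ * a ^ j) := funext fun j => by
        have h1 : ((j + k).choose k : K) * j.factorial * k.factorial = (j + k).factorial := by
          exact_mod_cast Nat.add_choose_mul_factorial_mul_factorial j k
        have hj : (j.factorial : K) ≠ 0 := Nat.cast_ne_zero.2 j.factorial_ne_zero
        have hk : (k.factorial : K) ≠ 0 := Nat.cast_ne_zero.2 k.factorial_ne_zero
        have hjk : ((j + k).factorial : K) ≠ 0 := Nat.cast_ne_zero.2 (j + k).factorial_ne_zero
        simp only [Function.comp_apply, Nat.add_sub_cancel]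
        field_simp
        rw [← h1]; ring
      rw [e]
      exact hab.mul_left _
  change HasSum _ _
  simp only [hterm]
  have : b • nexp K M v = ∑ k ∈ Finset.range m, ((k.factorial : K)⁻¹ * b) • (M ^ k) v := by
    rw [nexp_eq_sum K hm, LinearMap.sum_apply, Finset.smul_sum]
    refine Finset.sum_congr rfl fun k _ => ?_
    rw [LinearMap.smul_apply, smul_smul, mul_comm]
  rw [this]
  exact hasSum_sum fun k _ => (hcoef k).smul_const _

variable [FiniteDimensional K V]

/-- The exponential series of `l (S + N)` where `l = log x`. -/
theorem SplitData.hasSumFD_semisimple (D : SplitData K V d) {x : ℤ_[p]ˣ}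
    (hx : ‖((x : ℤ_[p]) : ℚ_[p]) - 1‖ ≤ ‖(2 * p : ℚ_[p])‖) (v : V) :
    HasSumFD K (fun n : ℕ => (n.factorial : K)⁻¹ •
      ((algebraMap ℚ_[p] K (ulog x) • (D.S + D.N)) ^ n) v)
      (D.op (unitK p K x) 0 (algebraMap ℚ_[p] K (ulog x)) v) := by
  let _ : TopologicalSpace V := moduleTopology K V
  have : IsModuleTopology K V := ⟨rfl⟩
  have := IsModuleTopology.toContinuousAdd K V
  set l := algebraMap ℚ_[p] K (ulog x) with hl
  have hop : D.op (unitK p K x) 0 l = D.pow (unitK p K x) * nexp K (l • D.N) := by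
    rw [op, D.Y_zero, nexp_zero, one_mul]
  have hv : v ∈ Submodule.span K {v | ∃ n : ℤ, D.S v = (n : K) • v} := by
    rw [show Submodule.span K _ = ⊤ from D.diag]; trivial
  change HasSum _ _
  -- Everything is linear in `v`, so `v` may be an eigenvector of `S`; there `S + N` is an integer
  -- plus a nilpotent.
  induction hv using Submodule.span_induction with
  | zero => simp
  | add v w _ _ hv hw => simpa only [map_add, smul_add] using hv.add hw
  | smul c v _ hv =>
    simp only [map_smul, smul_comm _ c]
    exact hv.const_smul c
  | mem v hv =>
    obtain ⟨m, hm⟩ := hv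
    have hNk : ∀ k : ℕ, D.S ((D.N ^ k) v) = (m : K) • (D.N ^ k) v := fun k => by
      have := LinearMap.congr_fun (D.comm_SN.pow_right k).eq v
      rw [Module.End.mul_apply, Module.End.mul_apply, hm, map_smul] at this
      exact this
    set a : K := algebraMap ℚ_[p] K ((m : ℚ_[p]) * ulog x) with ha
    have ha' : a = l * m := by rw [ha, map_mul, map_intCast, mul_comm]
    have hpow : ∀ n : ℕ, ((l • (D.S + D.N)) ^ n) v =
        ((a • (1 : Module.End K V) + l • D.N) ^ n) v ∧
        D.S (((a • (1 : Module.End K V) + l • D.N) ^ n) v) =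
          (m : K) • ((a • (1 : Module.End K V) + l • D.N) ^ n) v := by
      intro n
      have hcomm : Commute D.S ((a • (1 : Module.End K V) + l • D.N) ^ n) :=
        (((Commute.one_right _).smul_right a).add_right (D.comm_SN.smul_right l)).pow_right n
      have h2 := LinearMap.congr_fun hcomm.eq v
      rw [Module.End.mul_apply, Module.End.mul_apply, hm, map_smul] at h2
      refine ⟨?_, h2⟩
      clear h2 hcomm
      induction n with
      | zero => rfl
      | succ n ih =>
        have hcomm : Commute D.S ((a • (1 : Module.End K V) + l • D.N) ^ n) :=
          (((Commute.one_right _).smul_right a).add_right (D.comm_SN.smul_right l)).pow_right n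
        have h2 := LinearMap.congr_fun hcomm.eq v
        rw [Module.End.mul_apply, Module.End.mul_apply, hm, map_smul] at h2
        rw [pow_succ', Module.End.mul_apply, ih, pow_succ' (a • _ + _), Module.End.mul_apply,
          LinearMap.smul_apply, LinearMap.add_apply, h2, LinearMap.add_apply, LinearMap.smul_apply,
          LinearMap.smul_apply, Module.End.one_apply, smul_add, smul_smul, ha']
    simp only [fun n => (hpow n).1]
    -- Integrality of the weight `m` is what keeps `m log x` in the disc of convergence.
    have hz : ‖(m : ℚ_[p]) * ulog x‖ ≤ ‖(2 * p : ℚ_[p])‖ := by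
      rw [ulog_eq_plog hx, norm_mul, norm_plog hx]
      exact (mul_le_of_le_one_left (norm_nonneg _) (Padic.norm_int_le_one _)).trans hx
    have hsum : HasSum (fun n : ℕ => (n.factorial : K)⁻¹ * a ^ n)
        (((unitK p K x ^ m : Kˣ) : K)) := by
      have h1 := (hasSum_pexp hz).map (algebraMap ℚ_[p] K) (continuous_algebraMap ℚ_[p] K)
      have hl' : ‖ulog x‖ ≤ ‖(2 * p : ℚ_[p])‖ := by
        rwa [ulog_eq_plog hx, norm_plog hx]
      rw [pexp_intCast_mul hl', ulog_eq_plog hx, pexp_plog hx, ← coe_unitK_zpow] at h1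
      convert h1 using 1
      funext n
      simp [ha, ulog_eq_plog hx]
    have h2 := hasSumFD_scalar_add_nilpotent hsum (D.smulN_nilpotent l) v
    have h3 : D.op (unitK p K x) 0 l v =
        ((unitK p K x ^ m : Kˣ) : K) • nexp K (l • D.N) v := by
      rw [hop, Module.End.mul_apply, D.pow_apply _ _]
      have hcomm : Commute D.S (nexp K (l • D.N)) :=
        nexp_commute K (D.smulN_nilpotent l) (D.comm_SN.smul_right l)
      have h2 := LinearMap.congr_fun hcomm.eq v
      rw [Module.End.mul_apply, Module.End.mul_apply, hm, map_smul] at h2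
      exact h2
    rw [h3]
    exact h2

/-- The group action is given by the exponential series of the logarithm. -/
theorem SplitData.hasSumFD_opZ (D : SplitData K V d) {x : ℤ_[p]ˣ}
    (hx : ‖((x : ℤ_[p]) : ℚ_[p]) - 1‖ ≤ ‖(2 * p : ℚ_[p])‖) (r : Fin d → ℤ_[p]) {X : gLie p d}
    {L : ℚ_[p]} (hL : L * (((x : ℤ_[p]) : ℚ_[p]) - 1) = plog ((x : ℤ_[p]) : ℚ_[p]))
    (hL1 : x = 1 → L = 1) (hX0 : rowEntry p d (Sum.inl ()) X = plog ((x : ℤ_[p]) : ℚ_[p]))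
    (hXj : ∀ j, rowEntry p d (Sum.inr j) X = L * r j) (v : V) :
    HasSumFD K (fun n : ℕ => (n.factorial : K)⁻¹ • ((D.lie p ((1 : K) ⊗ₜ X)) ^ n) v)
      (D.opZ x r v) := by
  let _ : TopologicalSpace V := moduleTopology K V
  have : IsModuleTopology K V := ⟨rfl⟩
  have := IsModuleTopology.toContinuousAdd K V
  set l := algebraMap ℚ_[p] K (ulog x) with hl
  set e : Fin d → K := fun j => algebraMap ℚ_[p] K (r j) with he
  have hlie : D.lie p ((1 : K) ⊗ₜ X) = l • (D.S + D.N) + D.Y (algebraMap ℚ_[p] K L • e) := by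
    rw [lie_apply, lieLin_apply, rowEntryK_tmul, one_mul, hX0, ← ulog_eq_plog hx]
    congr 2
    funext j
    rw [rowEntryK_tmul, one_mul, hXj, map_mul]; rfl
  -- For `x = 1` the element is a pure translation, its logarithm is nilpotent and the series is
  -- finite.
  by_cases h1 : x = 1
  · have h2 : D.lie p ((1 : K) ⊗ₜ X) = D.Y e := by
      rw [hlie, hl, h1, ulog_one, map_zero, zero_smul, zero_add, hL1 h1, map_one, one_smul]
    obtain ⟨k, hk⟩ := D.Y_nilpotent e
    have h3 : D.opZ x r v = ∑ n ∈ Finset.range k, (n.factorial : K)⁻¹ • ((D.Y e) ^ n) v := by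
      rw [opZ, h1, map_one, ulog_one, map_zero, op, zero_smul, nexp_zero, D.pow_one, mul_one,
        mul_one, nexp_eq_sum K hk, LinearMap.sum_apply]
      rfl
    rw [h2, h3]
    refine hasSum_sum_of_ne_finset_zero fun n hn => ?_
    rw [pow_eq_zero_of_le (by simpa using hn) hk, LinearMap.zero_apply, smul_zero]
  · have hz : ((x : ℤ_[p]) : ℚ_[p]) - 1 ≠ 0 := fun h =>
      h1 (Units.ext (Subtype.coe_injective (sub_eq_zero.1 h)))
    set z : K := algebraMap ℚ_[p] K (((x : ℤ_[p]) : ℚ_[p]) - 1) with hz'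
    have hz0 : z ≠ 0 := (map_ne_zero _).2 hz
    -- This solves `c - x c = e`, so conjugation by the translation `c` carries `(x, 0)` to `(x,
    -- e)`.
    set c : Fin d → K := (-z⁻¹) • e with hc
    have hlL : l = algebraMap ℚ_[p] K L * z := by
      rw [hl, hz', ← map_mul, hL, ulog_eq_plog hx]
    have hcL : algebraMap ℚ_[p] K L • e = -l • c := by
      rw [hc, smul_smul, hlL]; congr 1; field_simp
    have hU : nexp K (D.Y c) * nexp K (D.Y (-c)) = 1 := by
      have : D.Y (-c) = -D.Y c := by rw [← neg_one_smul K c, D.Y_smul, neg_one_smul]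
      rw [this, nexp_mul_neg K (D.Y_nilpotent c)]
    have hpow : ∀ n : ℕ, (D.lie p ((1 : K) ⊗ₜ X)) ^ n =
        nexp K (D.Y c) * (l • (D.S + D.N)) ^ n * nexp K (D.Y (-c)) := fun n => by
      rw [hlie, hcL, ← D.nexp_Y_conj, mul_assoc, hU, mul_one]
    have hop : D.opZ x r = nexp K (D.Y c) * D.op (unitK p K x) 0 l * nexp K (D.Y (-c)) := by
      have e1 : ∀ c, nexp K (D.Y c) = D.op 1 c 0 := fun c => by
        rw [op, D.pow_one, zero_smul, nexp_zero, mul_one, mul_one]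
      rw [e1, e1, D.op_mul, D.op_mul, opZ]
      simp only [one_mul, mul_one, Units.val_one, zero_add, add_zero, smul_zero]
      congr 1
      have : (unitK p K x : K) = z + 1 := by rw [coe_unitK, hz', map_sub, map_one, sub_add_cancel]
      rw [this, hc, add_smul, one_smul, smul_neg, smul_smul, mul_neg,
        mul_inv_cancel₀ hz0, neg_one_smul, neg_neg]
      change e = _
      abel
    have h5 : HasSum _ _ := D.hasSumFD_semisimple hx (nexp K (D.Y (-c)) v)
    have h6 := h5.map (nexp K (D.Y c)) (IsModuleTopology.continuous_of_linearMap (nexp K (D.Y c)))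
    change HasSum _ _
    rw [hop]
    have h7 : (fun n : ℕ => (n.factorial : K)⁻¹ • ((D.lie p ((1 : K) ⊗ₜ X)) ^ n) v) =
        (fun w => nexp K (D.Y c) w) ∘ fun n : ℕ => (n.factorial : K)⁻¹ •
          ((algebraMap ℚ_[p] K (ulog x) • (D.S + D.N)) ^ n) (nexp K (D.Y (-c)) v) := by
      funext n
      rw [hpow, Function.comp_apply, map_smul, Module.End.mul_apply, Module.End.mul_apply]
    rw [h7]
    exact h6

end Series

theorem hasSum_of_eq {α : Type*} [AddCommMonoid α] [TopologicalSpace α] {f g : ℕ → α} {a : α}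
    (h : ∀ n, f n = g n) (hf : HasSum f a) : HasSum g a := funext h ▸ hf

/-! ### Matrix exponentials and logarithms in `𝔤`, and one-parameter subgroups of `Γ`. -/

section Matrices
variable {p : ℕ} [hp : Fact p.Prime] {d : ℕ}

/-- Because `X ^ 2 = X_00 X`, power series in `X` reduce to scalar series in `X_00`. -/
theorem gLie_pow_succ (X : gLie p d) (n : ℕ) :
    (X : Matrix (Unit ⊕ Fin d) (Unit ⊕ Fin d) ℚ_[p]) ^ (n + 1) =
      rowEntry p d (Sum.inl ()) X ^ n • (X : Matrix (Unit ⊕ Fin d) (Unit ⊕ Fin d) ℚ_[p]) := by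
  have h : (X : Matrix (Unit ⊕ Fin d) (Unit ⊕ Fin d) ℚ_[p]) * X =
      rowEntry p d (Sum.inl ()) X • (X : Matrix (Unit ⊕ Fin d) (Unit ⊕ Fin d) ℚ_[p]) := by
    refine Matrix.ext fun i j => ?_
    rw [Matrix.mul_apply, Fintype.sum_sum_type,
      Finset.sum_eq_zero (s := (Finset.univ : Finset (Fin d))) fun a _ => by rw [X.2 a j, mul_zero],
      Fintype.sum_unique, add_zero, Matrix.smul_apply]
    cases i with
    | inl i => rfl
    | inr i => rw [X.2 i, X.2 i, zero_mul, smul_zero]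
  induction n with
  | zero => rw [zero_add, pow_one, pow_zero, one_smul]
  | succ n ih => rw [pow_succ, ih, smul_mul_assoc, h, smul_smul, pow_succ]

open Classical in
/-- `(exp (a z) - 1) / z`, extended by `a` at `z = 0`. -/
def expQuot (z a : ℚ_[p]) : ℚ_[p] := if z = 0 then a else (pexp (a * z) - 1) / z

theorem expQuot_mul (z a : ℚ_[p]) : expQuot z a * z = pexp (a * z) - 1 := by
  by_cases hz : z = 0
  · rw [hz, mul_zero, mul_zero, pexp_zero, sub_self]
  · rw [expQuot, if_neg hz, div_mul_cancel₀ _ hz]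

theorem tendsto_expQuot {α : Type*} {l : Filter α} {a : α → ℚ_[p]} (ha : Tendsto a l (𝓝 0))
    (h0 : ∀ᶠ i in l, a i ≠ 0) (z : ℚ_[p]) :
    Tendsto (fun i => (a i)⁻¹ * expQuot z (a i)) l (𝓝 1) := by
  by_cases hz : z = 0
  · refine tendsto_const_nhds.congr' ?_
    filter_upwards [h0] with i hi
    rw [expQuot, if_pos hz, inv_mul_cancel₀ hi]
  · have := (tendsto_pexp_sub_one_div ha z h0).mul_const z⁻¹
    rw [mul_inv_cancel₀ hz] at this
    refine this.congr fun i => ?_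
    rw [expQuot, if_neg hz, div_eq_mul_inv, mul_assoc]

theorem hasSum_expQuot {z a : ℚ_[p]} (h : ‖a * z‖ ≤ ‖(2 * p : ℚ_[p])‖) :
    HasSum (fun n : ℕ => ((n + 1).factorial : ℚ_[p])⁻¹ * (a * (a * z) ^ n)) (expQuot z a) := by
  by_cases hz : z = 0
  · rw [expQuot, if_pos hz, hz]
    have := hasSum_single (f := fun n : ℕ =>
      ((n + 1).factorial : ℚ_[p])⁻¹ * (a * (a * 0) ^ n)) 0 (fun n hn => by simp [hn])
    simpa using this
  · have h1 := ((hasSum_nat_add_iff' 1).2 (hasSum_pexp h)).div_const z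
    rw [Finset.sum_range_one, Nat.factorial_zero, Nat.cast_one, inv_one, pow_zero, one_mul] at h1
    rw [expQuot, if_neg hz]
    refine hasSum_of_eq (fun n => ?_) h1
    rw [pow_succ]; field_simp

theorem exp_smul_gLie (X : gLie p d) {a : ℚ_[p]}
    (ha : ‖a * rowEntry p d (Sum.inl ()) X‖ ≤ ‖(2 * p : ℚ_[p])‖) :
    NormedSpace.exp (a • (X : Matrix (Unit ⊕ Fin d) (Unit ⊕ Fin d) ℚ_[p])) =
      1 + expQuot (rowEntry p d (Sum.inl ()) X) a •
        (X : Matrix (Unit ⊕ Fin d) (Unit ⊕ Fin d) ℚ_[p]) := by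
  rw [NormedSpace.exp_eq_tsum ℚ_[p]]
  refine HasSum.tsum_eq ((hasSum_nat_add_iff' 1).1 ?_)
  rw [Finset.sum_range_one, Nat.factorial_zero, Nat.cast_one, inv_one, pow_zero, one_smul,
    add_sub_cancel_left]
  refine hasSum_of_eq (fun n => Eq.symm ?_)
    ((hasSum_expQuot ha).smul_const (X : Matrix (Unit ⊕ Fin d) (Unit ⊕ Fin d) ℚ_[p]))
  rw [smul_pow, gLie_pow_succ, smul_smul, smul_smul, pow_succ, mul_pow]
  congr 1
  ring

variable {K : Type u} [Field K] {Kbar : Type v} [Field Kbar] [Algebra K Kbar] {t : Fin d → K}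
  (R : RootSystem p Kbar t)

/-- `γ - 1` as an element of the Lie algebra. -/
def RootSystem.subOne (γ : Gam p Kbar t) : gLie p d :=
  ⟨R.toMatrix γ - 1, by simpa using R.log_term_mem γ 0⟩

theorem RootSystem.rowEntry_subOne_inl (γ : Gam p Kbar t) :
    rowEntry p d (Sum.inl ()) (R.subOne γ) = ((chi p Kbar t γ : ℤ_[p]) : ℚ_[p]) - 1 := rfl

theorem RootSystem.rowEntry_subOne_inr (γ : Gam p Kbar t) (j : Fin d) :
    rowEntry p d (Sum.inr j) (R.subOne γ) = (R.s j γ : ℚ_[p]) := by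
  change (R.s j γ : ℚ_[p]) - (1 : Matrix (Unit ⊕ Fin d) (Unit ⊕ Fin d) ℚ_[p])
    (Sum.inl ()) (Sum.inr j) = _
  rw [Matrix.one_apply_ne (by simp), sub_zero]

theorem RootSystem.toMatrix_eq (γ : Gam p Kbar t) :
    R.toMatrix γ = 1 + (R.subOne γ : Matrix (Unit ⊕ Fin d) (Unit ⊕ Fin d) ℚ_[p]) :=
  (add_sub_cancel _ _).symm

/-- `log x / (x - 1)`, extended by `1` at `x = 1`. -/
def logQuot (x : ℚ_[p]) : ℚ_[p] := ∑' n : ℕ, (-1) ^ n / (n + 1 : ℚ_[p]) * (x - 1) ^ n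

theorem hasSum_logQuot {x : ℚ_[p]} (hx : ‖x - 1‖ ≤ ‖(2 * p : ℚ_[p])‖) :
    HasSum (fun n : ℕ => (-1) ^ n / (n + 1 : ℚ_[p]) * (x - 1) ^ n) (logQuot x) := by
  refine Summable.hasSum ?_
  by_cases h : x - 1 = 0
  · exact (hasSum_single 0 fun n hn => by simp [hn, h]).summable
  · refine ((hasSum_plog hx).summable.mul_right (x - 1)⁻¹).congr fun n => ?_
    rw [pow_succ, ← mul_assoc, mul_inv_cancel_right₀ h]

theorem logQuot_mul {x : ℚ_[p]} (hx : ‖x - 1‖ ≤ ‖(2 * p : ℚ_[p])‖) :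
    logQuot x * (x - 1) = plog x := by
  refine ((hasSum_logQuot hx).mul_right (x - 1)).unique ?_
  refine hasSum_of_eq (fun n => Eq.symm ?_) (hasSum_plog hx)
  rw [pow_succ, mul_assoc]

theorem logQuot_one : logQuot (1 : ℚ_[p]) = 1 := by
  rw [logQuot, tsum_eq_single 0 fun n hn => by simp [hn]]; simp

theorem RootSystem.log_eq {γ : Gam p Kbar t}
    (h : ‖((chi p Kbar t γ : ℤ_[p]) : ℚ_[p]) - 1‖ ≤ ‖(2 * p : ℚ_[p])‖) :
    R.log γ = logQuot ((chi p Kbar t γ : ℤ_[p]) : ℚ_[p]) • R.subOne γ := by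
  refine Subtype.ext (HasSum.tsum_eq ?_)
  refine hasSum_of_eq (fun n => Eq.symm ?_) ((hasSum_logQuot h).smul_const
    (R.subOne γ : Matrix (Unit ⊕ Fin d) (Unit ⊕ Fin d) ℚ_[p]))
  have := gLie_pow_succ (R.subOne γ) n
  rw [R.rowEntry_subOne_inl] at this
  rw [← smul_smul, ← this]
  rfl

/-- One-parameter subgroups exist near the identity. -/
theorem RootSystem.exists_exp (hG : IsAffineGroup (chi p Kbar t) R.s) (X : gLie p d) :
    ∃ γ : ℤ_[p] → Gam p Kbar t, ∀ᶠ a in 𝓝 (0 : ℤ_[p]),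
      ((chi p Kbar t (γ a) : ℤ_[p]) : ℚ_[p]) = pexp ((a : ℚ_[p]) * rowEntry p d (Sum.inl ()) X) ∧
      (∀ j, (R.s j (γ a) : ℚ_[p]) =
        expQuot (rowEntry p d (Sum.inl ()) X) a * rowEntry p d (Sum.inr j) X) ∧
      R.toMatrix (γ a) =
        NormedSpace.exp ((a : ℚ_[p]) • (X : Matrix (Unit ⊕ Fin d) (Unit ⊕ Fin d) ℚ_[p])) := by
  obtain ⟨M, hM⟩ := hG.exists_lift
  set x := fun i => rowEntry p d i X with hx
  have hp0 : (0 : ℝ) < (p : ℝ) ^ (-M : ℤ) := zpow_pos (by exact_mod_cast hp.out.pos) _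
  have hdvd : ∀ y : ℤ_[p], ‖y‖ ≤ (p : ℝ) ^ (-M : ℤ) → (p : ℤ_[p]) ^ M ∣ y := fun y hy =>
    Ideal.mem_span_singleton.1 ((PadicInt.norm_le_pow_iff_mem_span_pow y M).1 hy)
  have hsmall : ∀ (i : Unit ⊕ Fin d) (ε : ℝ), 0 < ε →
      ∀ᶠ a : ℤ_[p] in 𝓝 (0 : ℤ_[p]), ‖(a : ℚ_[p])‖ * ‖x i‖ ≤ ε := by
    intro i ε hε
    have h : Tendsto (fun a : ℤ_[p] => ‖(a : ℚ_[p])‖ * ‖x i‖) (𝓝 0) (𝓝 0) := by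
      have : Continuous (fun a : ℤ_[p] => ‖(a : ℚ_[p])‖ * ‖x i‖) := by fun_prop
      simpa using this.tendsto 0
    exact h.eventually (eventually_le_nhds hε)
  have hex : ∀ᶠ a : ℤ_[p] in 𝓝 (0 : ℤ_[p]), ∃ γ : Gam p Kbar t,
      ((chi p Kbar t γ : ℤ_[p]) : ℚ_[p]) = pexp ((a : ℚ_[p]) * x (Sum.inl ())) ∧
      (∀ j, (R.s j γ : ℚ_[p]) = expQuot (x (Sum.inl ())) a * x (Sum.inr j)) ∧
      R.toMatrix γ =
        NormedSpace.exp ((a : ℚ_[p]) • (X : Matrix (Unit ⊕ Fin d) (Unit ⊕ Fin d) ℚ_[p])) := by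
    -- Three kinds of smallness are needed: inside the disc of the exponential, close enough to the
    -- identity to lift to `Γ`, and with integral translation part.
    filter_upwards [hsmall (Sum.inl ()) _ (norm_two_mul_p_pos (p := p)), hsmall (Sum.inl ()) _ hp0,
      eventually_all.2 fun j => hsmall (Sum.inr j) _ (lt_min hp0 one_pos)] with a h1 h2 h3
    rw [← norm_mul] at h1 h2
    -- The exponential is isometric because its inverse, the logarithm, is.
    have h4 : ‖pexp ((a : ℚ_[p]) * x (Sum.inl ())) - 1‖ ≤ ‖(a : ℚ_[p]) * x (Sum.inl ())‖ :=
      (by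
      rw [← norm_plog (norm_pexp_sub_one_le h1), plog_pexp h1])
    have h5 : ‖pexp ((a : ℚ_[p]) * x (Sum.inl ())) - 1‖ < 1 := h4.trans_lt (lt_one_of_le h1)
    have h6 : ‖pexp ((a : ℚ_[p]) * x (Sum.inl ()))‖ = 1 := by
      have := IsUltrametricDist.norm_add_eq_max_of_norm_ne_norm
        (x := pexp ((a : ℚ_[p]) * x (Sum.inl ())) - 1) (y := 1) (by rw [norm_one]; exact h5.ne)
      rwa [sub_add_cancel, norm_one, max_eq_right h5.le] at this
    have h7 : ∀ j, ‖expQuot (x (Sum.inl ())) a * x (Sum.inr j)‖ ≤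
        ‖(a : ℚ_[p])‖ * ‖x (Sum.inr j)‖ := by
      intro j
      rw [norm_mul]
      refine mul_le_mul_of_nonneg_right ?_ (norm_nonneg _)
      by_cases h0 : x (Sum.inl ()) = 0
      · rw [expQuot, if_pos h0]
      · rw [expQuot, if_neg h0, norm_div, div_le_iff₀ (norm_pos_iff.2 h0), ← norm_mul]
        exact h4
    obtain ⟨γ, hγ, hγ'⟩ := hM (PadicInt.mkUnits h6)
      (fun j => ⟨_, (h7 j).trans ((h3 j).trans (min_le_right _ _))⟩)
      (hdvd _ (h4.trans h2)) (fun j => hdvd _ ((h7 j).trans ((h3 j).trans (min_le_left _ _))))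
    have e1 : ((chi p Kbar t γ : ℤ_[p]) : ℚ_[p]) = pexp ((a : ℚ_[p]) * x (Sum.inl ())) := by
      rw [hγ]; rfl
    have e2 : ∀ j, (R.s j γ : ℚ_[p]) = expQuot (x (Sum.inl ())) a * x (Sum.inr j) := fun j => by
      rw [hγ']
    refine ⟨γ, e1, e2, ?_⟩
    rw [exp_smul_gLie X h1, R.toMatrix_eq]
    congr 1
    refine congrArg Subtype.val (gLie_ext (X := R.subOne γ)
      (Y := expQuot (x (Sum.inl ())) a • X) fun i => ?_)
    rw [map_smul, smul_eq_mul]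
    rcases i with i | j
    · rw [R.rowEntry_subOne_inl, e1, expQuot_mul]
    · rw [R.rowEntry_subOne_inr, e2]
  -- The values of `γ` away from `0` are arbitrary.
  exact hex.choice

end Matrices

/-! ### Equivariance for `Γ` and for `𝔤_K` are the same condition. -/

section Comparison
variable {p : ℕ} [hp : Fact p.Prime] {d : ℕ} {K : Type u} [NormedField K] [NormedAlgebra ℚ_[p] K]
  [CharZero K] {Kbar : Type v} [Field Kbar] [Algebra K Kbar] {t : Fin d → K}
  {R : RootSystem p Kbar t} (hG : IsAffineGroup (chi p Kbar t) R.s)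
  {V : Type*} [AddCommGroup V] [Module K V] [FiniteDimensional K V]
  {W : Type*} [AddCommGroup W] [Module K W] [FiniteDimensional K W]

/-- Needed for the uniqueness of limits along punctured neighbourhoods of `0`. -/
theorem padicInt_nhdsNE_neBot : (𝓝[≠] (0 : ℤ_[p])).NeBot := by
  have h : Tendsto (fun n : ℕ => (p : ℤ_[p]) ^ n) atTop (𝓝 0) :=
    tendsto_pow_atTop_nhds_zero_of_norm_lt_one (by
      rw [PadicInt.norm_p]; exact inv_lt_one_of_one_lt₀ (by exact_mod_cast hp.out.one_lt))
  exact (tendsto_nhdsWithin_iff.2 ⟨h, Eventually.of_forall fun n =>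
    pow_ne_zero n (by exact_mod_cast hp.out.ne_zero)⟩).neBot

/-- Along the one-parameter subgroup of `X`, the difference quotients converge to the Lie algebra
action. -/
theorem SplitData.tendsto_rep (D : SplitData K V d) {X : gLie p d} {γ : ℤ_[p] → Gam p Kbar t}
    (hγ : ∀ᶠ a in 𝓝 (0 : ℤ_[p]),
      ((chi p Kbar t (γ a) : ℤ_[p]) : ℚ_[p]) = pexp ((a : ℚ_[p]) * rowEntry p d (Sum.inl ()) X) ∧
      (∀ j, (R.s j (γ a) : ℚ_[p]) =
        expQuot (rowEntry p d (Sum.inl ()) X) a * rowEntry p d (Sum.inr j) X)) (v : V) :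
    TendstoFD K (fun a : ℤ_[p] => (algebraMap ℚ_[p] K a)⁻¹ • (D.rep hG (γ a) v - v)) (𝓝[≠] 0)
      (D.lie p ((1 : K) ⊗ₜ X) v) := by
  have ha : Tendsto (fun a : ℤ_[p] => (a : ℚ_[p])) (𝓝[≠] 0) (𝓝 0) := by
    have : Continuous fun a : ℤ_[p] => (a : ℚ_[p]) := continuous_subtype_val
    exact (this.tendsto 0).mono_left nhdsWithin_le_nhds
  have h0 : ∀ᶠ a : ℤ_[p] in 𝓝[≠] (0 : ℤ_[p]), (a : ℚ_[p]) ≠ 0 := by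
    filter_upwards [self_mem_nhdsWithin] with a h
    exact fun h' => h (Subtype.coe_injective h')
  have h1 := hγ.filter_mono (nhdsWithin_le_nhds (s := {0}ᶜ))
  exact D.tendsto_opZ ha h0 (tendsto_expQuot ha h0 _) (h1.mono fun a h => h.1)
    (h1.mono fun a h => h.2) v

/-- Maps compatible with the group actions are compatible with the Lie algebra actions. -/
theorem SplitData.lie_intertwine_of_rep {D : SplitData K V d} {D' : SplitData K W d}
    {f : V →ₗ[K] W} (h : ∀ g v, f (D.rep hG g v) = D'.rep hG g (f v)) (X : gK p K d) (v : V) :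
    f (D.lie p X v) = D'.lie p X (f v) := by
  induction X using TensorProduct.induction_on with
  | zero => simp
  | add X Y hX hY => simp only [map_add, LinearMap.add_apply, hX, hY]
  | tmul c X =>
    have hc : c ⊗ₜ[ℚ_[p]] X = c • ((1 : K) ⊗ₜ[ℚ_[p]] X) := by
      rw [TensorProduct.smul_tmul', smul_eq_mul, mul_one]
    rw [hc, map_smul, map_smul, LinearMap.smul_apply, LinearMap.smul_apply, map_smul]
    congr 1
    obtain ⟨γ, hγ⟩ := R.exists_exp hG X
    have h1 := D.tendsto_rep hG (hγ.mono fun a h => ⟨h.1, h.2.1⟩) v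
    have h2 := D'.tendsto_rep hG (hγ.mono fun a h => ⟨h.1, h.2.1⟩) (f v)
    let _ : TopologicalSpace V := moduleTopology K V
    have : IsModuleTopology K V := ⟨rfl⟩
    let _ : TopologicalSpace W := moduleTopology K W
    have : IsModuleTopology K W := ⟨rfl⟩
    have := IsModuleTopology.toContinuousAdd K W
    have : T2Space W := t2Space_of_isModuleTopology (K := K)
    have := padicInt_nhdsNE_neBot (p := p)
    have h3 := ((IsModuleTopology.continuous_of_linearMap f).tendsto _).comp h1
    refine tendsto_nhds_unique (h3.congr fun a => ?_) h2
    rw [Function.comp_apply, map_smul, map_sub, h]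

/-- Maps compatible with the Lie algebra actions are compatible with the group actions. -/
theorem SplitData.rep_intertwine_of_lie {D : SplitData K V d} {D' : SplitData K W d}
    {f : V →ₗ[K] W} (h : ∀ X v, f (D.lie p X v) = D'.lie p X (f v)) (g : Gam p Kbar t) (v : V) :
    f (D.rep hG g v) = D'.rep hG g (f v) :=
  (LinearMap.congr_fun (lie_intertwine (fun X => LinearMap.ext fun v => (h X v).symm) _ _ _) v).symm

theorem SplitData.lie_tensor {V W : Type u} [AddCommGroup V] [Module K V] [FiniteDimensional K V]
    [AddCommGroup W] [Module K W] [FiniteDimensional K W]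
    (D : SplitData K V d) (D' : SplitData K W d) (X : gK p K d) :
    (D.tensor D').lie p X = LieRep.tensorAction (D.lie p) (D'.lie p) X := by
  refine TensorProduct.ext' fun v w => ?_
  rw [LieRep.tensorAction_tmul, lie_apply, lie_apply, lie_apply, lieLin_apply, lieLin_apply,
    lieLin_apply]
  simp only [Y, tensor, LinearMap.add_apply, LinearMap.smul_apply, LinearMap.sum_apply,
    LinearMap.rTensor_tmul, LinearMap.lTensor_tmul, TensorProduct.add_tmul, TensorProduct.tmul_add,
    TensorProduct.sum_tmul, TensorProduct.tmul_sum, smul_add, Finset.sum_add_distrib,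
    ← TensorProduct.smul_tmul', TensorProduct.tmul_smul]
  abel

theorem SplitData.lie_trivial : (trivial K V d).lie p = 0 := by
  ext X : 1
  rw [lie_apply, lieLin_apply]
  simp [Y, trivial]

theorem SplitData.rep_trivial (g : Gam p Kbar t) : (trivial K V d).rep hG g = 1 :=
  trivial_op _ _ _

theorem SplitData.rep_tensor (D : SplitData K V d) (D' : SplitData K W d) (g : Gam p Kbar t) :
    (D.tensor D').rep hG g = TensorProduct.map (D.rep hG g) (D'.rep hG g) :=
  D.tensor_op D' _ _ _

/-- The exponential series of `log γ`. -/
theorem SplitData.hasSumFD_rep (D : SplitData K V d) {γ : Gam p Kbar t}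
    (h : (2 * p : ℤ_[p]) ∣ (chi p Kbar t γ : ℤ_[p]) - 1) (v : V) :
    HasSumFD K (fun n : ℕ => (n.factorial : K)⁻¹ • ((D.lie p ((1 : K) ⊗ₜ R.log γ)) ^ n) v)
      (D.rep hG γ v) := by
  have h' := norm_coe_sub_one_le_iff.2 h
  rw [rep_apply]
  refine D.hasSumFD_opZ h' _ (logQuot_mul h') (fun h1 => ?_) ?_ (fun j => ?_) v
  · rw [h1]; exact logQuot_one
  · rw [R.log_eq h', map_smul, smul_eq_mul, R.rowEntry_subOne_inl, logQuot_mul h']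
  · rw [R.log_eq h', map_smul, smul_eq_mul, R.rowEntry_subOne_inr]

end Comparison

/-! ### Morphisms as equivariant linear maps. -/

section Morphisms
variable {p : ℕ} [Fact p.Prime] {d : ℕ} {K : Type u} [NormedField K] [NormedAlgebra ℚ_[p] K]
  {Kbar : Type v} [Field Kbar] [Algebra K Kbar] {t : Fin d → K}

/-- A linear map commuting with the action of `Γ` is a morphism. -/
def RepZGam.homMk {V W : RepZGam p Kbar t} (f : V.obj.V ⟶ W.obj.V)
    (h : ∀ g v, f.hom.hom (V.obj.ρ g v) = W.obj.ρ g (f.hom.hom v)) : V ⟶ W :=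
  ObjectProperty.homMk ⟨f, fun g => FGModuleCat.hom_ext (LinearMap.ext fun v => h g v)⟩

theorem RepZGam.comm {V W : RepZGam p Kbar t} (f : V ⟶ W) (g : Gam p Kbar t) (v : V.obj.V) :
    f.hom.hom.hom.hom (V.obj.ρ g v) = W.obj.ρ g (f.hom.hom.hom.hom v) :=
  LinearMap.congr_fun (congrArg (fun f => f.hom.hom) (f.hom.comm g)) v

/-- A linear map commuting with the action of `𝔤` is a morphism. -/
def RepZg.homMk {V W : RepZg p K d} (f : V.obj.V ⟶ W.obj.V)
    (h : ∀ X v, f.hom.hom (V.obj.φ X v) = W.obj.φ X (f.hom.hom v)) : V ⟶ W :=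
  ObjectProperty.homMk ⟨f, h⟩

@[ext]
theorem RepZg.hom_ext {V W : RepZg p K d} {f g : V ⟶ W} (h : f.hom.hom = g.hom.hom) : f = g :=
  (lieRepZ.forget (delta0 p K d)).map_injective h

@[ext]
theorem RepZGam.hom_ext {V W : RepZGam p Kbar t} {f g : V ⟶ W} (h : f.hom.hom = g.hom.hom) :
    f = g :=
  (repZ.forget (chiK p Kbar t)).map_injective h

end Morphisms

/-! ### The functors `∂` and `𝕍` and their mutual inversion. -/

section Equivalence
variable {p : ℕ} [hp : Fact p.Prime] {d : ℕ} {K : Type u} [NormedField K] [NormedAlgebra ℚ_[p] K]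
  [CharZero K] {Kbar : Type v} [Field Kbar] [Algebra K Kbar] {t : Fin d → K}
  {R : RootSystem p Kbar t} (hG : IsAffineGroup (chi p Kbar t) R.s)

section Inverse

/-- Splitting data inducing a representation of the Lie algebra. -/
def lieSplit (D : RepZg p K d) : SplitData K D.obj.V d :=
  (exists_splitData_of_lie D.obj.φ D.property).choose

theorem lieSplit_spec (D : RepZg p K d) (X : gK p K d) : D.obj.φ X = (lieSplit D).lie p X :=
  (exists_splitData_of_lie D.obj.φ D.property).choose_spec X

theorem lieSplit_flag (D : RepZg p K d) :
    IsIteratedExtension (fun X => (lieSplit D).lie p X) (fun n X => (n : K) * delta0 p K d X) ⊤ := by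
  have := D.property
  simp only [lieRepZ, lieSplit_spec] at this
  exact this

/-- The representation of `Γ` obtained by exponentiation. -/
def expRep (D : RepZg p K d) : RepZGam p Kbar t where
  obj := FDRep.of ((lieSplit D).rep hG)
  property := ⟨(lieSplit D).isContinuousAction_rep hG,
    (lieSplit D).isIteratedExtension_rep hG (lieSplit_flag D)⟩

theorem RepZg.comm {D E : RepZg p K d} (f : D ⟶ E) (X : gK p K d) (v : D.obj.V) :
    f.hom.hom.hom.hom ((lieSplit D).lie p X v) = (lieSplit E).lie p X (f.hom.hom.hom.hom v) := by
  rw [← lieSplit_spec, ← lieSplit_spec]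
  exact f.hom.comm X v

/-- The functor `𝕍`. -/
def expFunctor : RepZg p K d ⥤ RepZGam p Kbar t where
  obj := expRep hG
  -- The data of source and target are chosen independently; equivariance for `𝔤_K` alone gives
  -- equivariance for `Γ`.
  map {D E} f := RepZGam.homMk f.hom.hom fun g v =>
    SplitData.rep_intertwine_of_lie hG (D := lieSplit D) (D' := lieSplit E) (RepZg.comm f) g v

end Inverse

section Functor
variable [CompactSpace (Gam p Kbar t)]

theorem exists_repSplit (V : RepZGam p Kbar t) : ∃ D : SplitData K V.obj.V d,
    (∀ g, V.obj.ρ g = D.rep hG g) ∧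
      IsIteratedExtension (fun X => D.lie p X) (fun n X => (n : K) * delta0 p K d X) ⊤ :=
  exists_splitData_of_rep hG V.obj.ρ V.property.1 V.property.2

/-- Splitting data inducing a representation of `Γ`. -/
def repSplit (V : RepZGam p Kbar t) : SplitData K V.obj.V d := (exists_repSplit hG V).choose

theorem repSplit_spec (V : RepZGam p Kbar t) (g : Gam p Kbar t) :
    V.obj.ρ g = (repSplit hG V).rep hG g := (exists_repSplit hG V).choose_spec.1 g

/-- The representation of `𝔤_K` obtained by differentiation. -/
def diffRep (V : RepZGam p Kbar t) : RepZg p K d where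
  obj := ⟨V.obj.V, (repSplit hG V).lie p⟩
  property := (exists_repSplit hG V).choose_spec.2

theorem RepZGam.comm_rep {V W : RepZGam p Kbar t} (f : V ⟶ W) (g : Gam p Kbar t) (v : V.obj.V) :
    f.hom.hom.hom.hom ((repSplit hG V).rep hG g v) =
      (repSplit hG W).rep hG g (f.hom.hom.hom.hom v) := by
  rw [← repSplit_spec, ← repSplit_spec]
  exact RepZGam.comm f g v

/-- The functor `∂`. -/
def diffFunctor : RepZGam p Kbar t ⥤ RepZg p K d where
  obj := diffRep hG
  map {V W} f := RepZg.homMk f.hom.hom fun X v =>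
    SplitData.lie_intertwine_of_rep hG (D := repSplit hG V) (D' := repSplit hG W)
      (RepZGam.comm_rep hG f) X v

/-- Two sets of data with the same Lie action on one space have the same group action: the identity
intertwines them. -/
theorem lieSplit_diffRep_rep (V : RepZGam p Kbar t) (g : Gam p Kbar t) (v : V.obj.V) :
    (lieSplit (diffRep hG V)).rep hG g v = V.obj.ρ g v := by
  rw [repSplit_spec hG]
  exact SplitData.rep_intertwine_of_lie hG (D := lieSplit (diffRep hG V)) (D' := repSplit hG V)
    (f := LinearMap.id) (fun X v => by rw [← lieSplit_spec]; rfl) g v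

theorem repSplit_expRep_lie (D : RepZg p K d) (X : gK p K d) (v : D.obj.V) :
    (repSplit hG (expRep hG D)).lie p X v = D.obj.φ X v := by
  rw [lieSplit_spec]
  exact SplitData.lie_intertwine_of_rep hG (D := repSplit hG (expRep hG D)) (D' := lieSplit D)
    (f := LinearMap.id) (fun g v => by
      rw [← repSplit_spec]; rfl) X v

/-- Exponentiating a derivative gives back the representation of `Γ`. -/
def unitIsoApp (V : RepZGam p Kbar t) : V ≅ expRep hG (diffRep hG V) where
  hom := RepZGam.homMk (𝟙 V.obj.V) fun g v => (lieSplit_diffRep_rep hG V g v).symm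
  inv := RepZGam.homMk (𝟙 V.obj.V) fun g v => lieSplit_diffRep_rep hG V g v
  hom_inv_id := RepZGam.hom_ext (Category.id_comp _)
  inv_hom_id := RepZGam.hom_ext (Category.id_comp _)

/-- Differentiating an exponential gives back the representation of `𝔤`. -/
def counitIsoApp (D : RepZg p K d) : diffRep hG (expRep (t := t) hG D) ≅ D where
  hom := RepZg.homMk (𝟙 D.obj.V) fun X v => repSplit_expRep_lie hG D X v
  inv := RepZg.homMk (𝟙 D.obj.V) fun X v => (repSplit_expRep_lie hG D X v).symm
  hom_inv_id := RepZg.hom_ext (Category.id_comp _)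
  inv_hom_id := RepZg.hom_ext (Category.id_comp _)

/-- The equivalence given by differentiation and exponentiation. -/
def diffEquivalence : RepZGam p Kbar t ≌ RepZg p K d where
  functor := diffFunctor hG
  inverse := expFunctor hG
  unitIso := NatIso.ofComponents (unitIsoApp hG) fun f => RepZGam.hom_ext
    ((Category.comp_id f.hom.hom).trans (Category.id_comp f.hom.hom).symm)
  counitIso := NatIso.ofComponents (counitIsoApp hG) fun f => RepZg.hom_ext
    ((Category.comp_id f.hom.hom).trans (Category.id_comp f.hom.hom).symm)
  functor_unitIso_comp V := RepZg.hom_ext (Category.id_comp (𝟙 V.obj.V))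

end Functor
end Equivalence

/-! ### Tensor operations on underlying spaces. -/

section Structure
variable {p : ℕ} [Fact p.Prime] {d : ℕ} {K : Type u} [NormedField K] [NormedAlgebra ℚ_[p] K]
  {Kbar : Type v} [Field Kbar] [Algebra K Kbar] {t : Fin d → K}

theorem RepZGam.associator_hom (U V W : RepZGam p Kbar t) :
    (α_ U V W).hom.hom.hom = (α_ U.obj.V V.obj.V W.obj.V).hom :=
  Action.associator_hom_hom U.obj V.obj W.obj

theorem RepZGam.leftUnitor_hom (U : RepZGam p Kbar t) :
    (λ_ U).hom.hom.hom = (λ_ U.obj.V).hom :=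
  Action.leftUnitor_hom_hom U.obj

theorem RepZGam.rightUnitor_hom (U : RepZGam p Kbar t) :
    (ρ_ U).hom.hom.hom = (ρ_ U.obj.V).hom :=
  Action.rightUnitor_hom_hom U.obj

theorem RepZGam.tensor_ρ (V W : RepZGam p Kbar t) (g : Gam p Kbar t) (v : V.obj.V ⊗[K] W.obj.V) :
    (V ⊗ W).obj.ρ g v = TensorProduct.map (V.obj.ρ g) (W.obj.ρ g) v := rfl

theorem RepZGam.unit_ρ (g : Gam p Kbar t) (v : K) : (𝟙_ (RepZGam p Kbar t)).obj.ρ g v = v := rfl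

theorem RepZg.tensor_φ (V W : RepZg p K d) (X : gK p K d) (v : V.obj.V ⊗[K] W.obj.V) :
    (V ⊗ W).obj.φ X v = LieRep.tensorAction V.obj.φ W.obj.φ X v := rfl

theorem RepZg.unit_φ (X : gK p K d) (v : K) : (𝟙_ (RepZg p K d)).obj.φ X v = 0 := rfl

omit [NormedAlgebra ℚ_[p] K] in
-- Every comparison isomorphism below is an identity on underlying spaces; its equivariance amounts
-- to the equality of two actions.
theorem id_comm_of_eq (X : FGModuleCat.{u} K) (f g : X → X) (h : ∀ v, f v = g v) (v : X) :
    (𝟙 X : X ⟶ X).hom.hom (f v) = g ((𝟙 X : X ⟶ X).hom.hom v) := h v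

end Structure

/-! ### Compatibility with tensor products. -/

section Monoidal
variable {p : ℕ} [hp : Fact p.Prime] {d : ℕ} {K : Type u} [NormedField K] [NormedAlgebra ℚ_[p] K]
  [CharZero K] {Kbar : Type v} [Field Kbar] [Algebra K Kbar] {t : Fin d → K}
  {R : RootSystem p Kbar t} (hG : IsAffineGroup (chi p Kbar t) R.s)

/-- The data chosen for `D ⊗ E` need not be the tensor product of the chosen data, but both give the
same Lie action and therefore the same group action. -/
theorem lieSplit_rep_tensor (D E : RepZg p K d) (g : Gam p Kbar t) (v : D.obj.V ⊗[K] E.obj.V) :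
    (lieSplit (D ⊗ E)).rep hG g v =
      TensorProduct.map ((lieSplit D).rep hG g) ((lieSplit E).rep hG g) v := by
  rw [← SplitData.rep_tensor]
  refine SplitData.rep_intertwine_of_lie hG (D := lieSplit (D ⊗ E))
    (D' := (lieSplit D).tensor (lieSplit E)) (f := LinearMap.id) (fun X v => ?_) g v
  have h : ∀ D : RepZg p K d, D.obj.φ = (lieSplit D).lie p := fun D =>
    LieHom.ext fun X => lieSplit_spec D X
  have h1 : (lieSplit (D ⊗ E)).lie p X v = LieRep.tensorAction D.obj.φ E.obj.φ X v :=
    LinearMap.congr_fun (lieSplit_spec (D ⊗ E) X).symm v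
  rw [LinearMap.id_apply, LinearMap.id_apply, h1, SplitData.lie_tensor]
  exact congrArg₂ (fun φ ψ => LieRep.tensorAction φ ψ X v) (h D) (h E)

theorem lieSplit_rep_unit (g : Gam p Kbar t) (v : K) :
    (lieSplit (𝟙_ (RepZg p K d))).rep hG g v = v := by
  have := SplitData.rep_intertwine_of_lie hG (D := lieSplit (𝟙_ (RepZg p K d)))
    (D' := SplitData.trivial K K d) (f := LinearMap.id) (fun X v => by
      rw [← lieSplit_spec, SplitData.lie_trivial]; rfl) g v
  rw [SplitData.rep_trivial] at this
  exact this

/-- Compatibility of exponentiation with tensor products. -/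
def expTensorIso (D E : RepZg p K d) : expRep hG D ⊗ expRep hG E ≅ expRep hG (D ⊗ E) where
  hom := RepZGam.homMk (𝟙 (D.obj.V ⊗ E.obj.V : FGModuleCat K)) fun g =>
    id_comm_of_eq (D.obj.V ⊗ E.obj.V) (fun v => (expRep hG D ⊗ expRep hG E).obj.ρ g v)
      (fun v => (expRep hG (D ⊗ E)).obj.ρ g v) fun v =>
    (RepZGam.tensor_ρ (expRep hG D) (expRep hG E) g v).trans (lieSplit_rep_tensor hG D E g v).symm
  inv := RepZGam.homMk (𝟙 (D.obj.V ⊗ E.obj.V : FGModuleCat K)) fun g =>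
    id_comm_of_eq (D.obj.V ⊗ E.obj.V) (fun v => (expRep hG (D ⊗ E)).obj.ρ g v)
      (fun v => (expRep hG D ⊗ expRep hG E).obj.ρ g v) fun v =>
    (lieSplit_rep_tensor hG D E g v).trans (RepZGam.tensor_ρ (expRep hG D) (expRep hG E) g v).symm
  hom_inv_id := RepZGam.hom_ext (Category.id_comp (𝟙 (D.obj.V ⊗ E.obj.V : FGModuleCat K)))
  inv_hom_id := RepZGam.hom_ext (Category.id_comp (𝟙 (D.obj.V ⊗ E.obj.V : FGModuleCat K)))

/-- Compatibility of exponentiation with the unit. -/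
def expUnitIso : 𝟙_ (RepZGam p Kbar t) ≅ expRep hG (𝟙_ (RepZg p K d)) where
  hom := RepZGam.homMk (𝟙 (𝟙_ (FGModuleCat K))) fun g =>
    id_comm_of_eq (𝟙_ (FGModuleCat K)) (fun v => (𝟙_ (RepZGam p Kbar t)).obj.ρ g v)
      (fun v => (expRep hG (𝟙_ (RepZg p K d))).obj.ρ g v) fun v =>
    (RepZGam.unit_ρ g v).trans (lieSplit_rep_unit hG g v).symm
  inv := RepZGam.homMk (𝟙 (𝟙_ (FGModuleCat K))) fun g =>
    id_comm_of_eq (𝟙_ (FGModuleCat K)) (fun v => (expRep hG (𝟙_ (RepZg p K d))).obj.ρ g v)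
      (fun v => (𝟙_ (RepZGam p Kbar t)).obj.ρ g v) fun v =>
    (lieSplit_rep_unit hG g v).trans (RepZGam.unit_ρ g v).symm
  hom_inv_id := RepZGam.hom_ext (Category.id_comp (𝟙 (𝟙_ (FGModuleCat K))))
  inv_hom_id := RepZGam.hom_ext (Category.id_comp (𝟙 (𝟙_ (FGModuleCat K))))

/-- The monoidal structure of `𝕍`. -/
def expMonoidal : (expFunctor hG).CoreMonoidal where
  εIso := expUnitIso hG
  μIso := expTensorIso hG
  μIso_hom_natural_left {D D'} f E := RepZGam.hom_ext
    ((Category.comp_id (f.hom.hom ▷ E.obj.V)).trans (Category.id_comp (f.hom.hom ▷ E.obj.V)).symm)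
  μIso_hom_natural_right {D D'} E f := RepZGam.hom_ext
    ((Category.comp_id (E.obj.V ◁ f.hom.hom)).trans (Category.id_comp (E.obj.V ◁ f.hom.hom)).symm)
  -- All comparison maps are identities, so both sides collapse to the associator of vector spaces.
  associativity D E F := RepZGam.hom_ext (Eq.trans (b :=
      (𝟙 (D.obj.V ⊗ E.obj.V : FGModuleCat K) ▷ F.obj.V) ≫
        𝟙 ((D.obj.V ⊗ E.obj.V) ⊗ F.obj.V : FGModuleCat K) ≫
        (α_ D.obj.V E.obj.V F.obj.V).hom) rfl
    (Eq.trans (b := (α_ D.obj.V E.obj.V F.obj.V).hom ≫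
        (D.obj.V ◁ 𝟙 (E.obj.V ⊗ F.obj.V : FGModuleCat K)) ≫
        𝟙 (D.obj.V ⊗ E.obj.V ⊗ F.obj.V : FGModuleCat K))
      (by rw [id_whiskerRight, whiskerLeft_id, Category.id_comp, Category.id_comp,
        Category.comp_id, Category.comp_id]) (congrArg
        (fun z => z ≫ (D.obj.V ◁ 𝟙 (E.obj.V ⊗ F.obj.V : FGModuleCat K)) ≫
      𝟙 (D.obj.V ⊗ E.obj.V ⊗ F.obj.V : FGModuleCat K))
      (RepZGam.associator_hom (expRep hG D) (expRep hG E) (expRep hG F)).symm)))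
  left_unitality D := RepZGam.hom_ext ((RepZGam.leftUnitor_hom (expRep hG D)).trans
    (Eq.trans (a := (λ_ D.obj.V).hom) (b := (𝟙 (𝟙_ (FGModuleCat K)) ▷ D.obj.V) ≫
      𝟙 (𝟙_ (FGModuleCat K) ⊗ D.obj.V : FGModuleCat K) ≫ (λ_ D.obj.V).hom)
      (by rw [id_whiskerRight, Category.id_comp, Category.id_comp]) rfl))
  right_unitality D := RepZGam.hom_ext ((RepZGam.rightUnitor_hom (expRep hG D)).trans
    (Eq.trans (a := (ρ_ D.obj.V).hom) (b := (D.obj.V ◁ 𝟙 (𝟙_ (FGModuleCat K))) ≫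
      𝟙 (D.obj.V ⊗ 𝟙_ (FGModuleCat K) : FGModuleCat K) ≫ (ρ_ D.obj.V).hom)
      (by rw [whiskerLeft_id, Category.id_comp, Category.id_comp]) rfl))

/-- The braided structure of `𝕍`. -/
abbrev expBraided : (expFunctor hG).Braided where
  toMonoidal := (expMonoidal hG).toMonoidal
  braided D E := RepZGam.hom_ext (by
    change 𝟙 (D.obj.V ⊗ E.obj.V : FGModuleCat K) ≫ (β_ D.obj.V E.obj.V).hom =
      (β_ D.obj.V E.obj.V).hom ≫ 𝟙 (E.obj.V ⊗ D.obj.V : FGModuleCat K)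
    rw [Category.comp_id, Category.id_comp])

variable [CompactSpace (Gam p Kbar t)]

/-- Both sets of data give the same group action on the tensor product, hence the same derivative.
-/
theorem repSplit_lie_tensor (V W : RepZGam p Kbar t) (X : gK p K d) (v : V.obj.V ⊗[K] W.obj.V) :
    (repSplit hG (V ⊗ W)).lie p X v =
      LieRep.tensorAction ((repSplit hG V).lie p) ((repSplit hG W).lie p) X v := by
  rw [← SplitData.lie_tensor]
  refine SplitData.lie_intertwine_of_rep hG (D := repSplit hG (V ⊗ W))
    (D' := (repSplit hG V).tensor (repSplit hG W)) (f := LinearMap.id) (fun g v => ?_) X v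
  rw [← repSplit_spec, SplitData.rep_tensor, ← repSplit_spec, ← repSplit_spec]
  rfl

theorem repSplit_lie_unit (X : gK p K d) (v : K) :
    (repSplit hG (𝟙_ (RepZGam p Kbar t))).lie p X v = 0 := by
  have := SplitData.lie_intertwine_of_rep hG (D := repSplit hG (𝟙_ (RepZGam p Kbar t)))
    (D' := SplitData.trivial K K d) (f := LinearMap.id) (fun g v => by
      rw [← repSplit_spec, SplitData.rep_trivial]; rfl) X v
  rw [SplitData.lie_trivial] at this
  exact this

/-- Compatibility of differentiation with tensor products. -/
def diffTensorIso (V W : RepZGam p Kbar t) : diffRep hG V ⊗ diffRep hG W ≅ diffRep hG (V ⊗ W) where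
  hom := RepZg.homMk (𝟙 (V.obj.V ⊗ W.obj.V : FGModuleCat K)) fun X =>
    id_comm_of_eq (V.obj.V ⊗ W.obj.V) (fun v => (diffRep hG V ⊗ diffRep hG W).obj.φ X v)
      (fun v => (diffRep hG (V ⊗ W)).obj.φ X v) fun v =>
    (RepZg.tensor_φ (diffRep hG V) (diffRep hG W) X v).trans (repSplit_lie_tensor hG V W X v).symm
  inv := RepZg.homMk (𝟙 (V.obj.V ⊗ W.obj.V : FGModuleCat K)) fun X =>
    id_comm_of_eq (V.obj.V ⊗ W.obj.V) (fun v => (diffRep hG (V ⊗ W)).obj.φ X v)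
      (fun v => (diffRep hG V ⊗ diffRep hG W).obj.φ X v) fun v =>
    (repSplit_lie_tensor hG V W X v).trans (RepZg.tensor_φ (diffRep hG V) (diffRep hG W) X v).symm
  hom_inv_id := RepZg.hom_ext (Category.id_comp (𝟙 (V.obj.V ⊗ W.obj.V : FGModuleCat K)))
  inv_hom_id := RepZg.hom_ext (Category.id_comp (𝟙 (V.obj.V ⊗ W.obj.V : FGModuleCat K)))

/-- Compatibility of differentiation with the unit. -/
def diffUnitIso : 𝟙_ (RepZg p K d) ≅ diffRep hG (𝟙_ (RepZGam p Kbar t)) where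
  hom := RepZg.homMk (𝟙 (𝟙_ (FGModuleCat K))) fun X =>
    id_comm_of_eq (𝟙_ (FGModuleCat K)) (fun v => (𝟙_ (RepZg p K d)).obj.φ X v)
      (fun v => (diffRep hG (𝟙_ (RepZGam p Kbar t))).obj.φ X v) fun v =>
    (RepZg.unit_φ X v).trans (repSplit_lie_unit hG X v).symm
  inv := RepZg.homMk (𝟙 (𝟙_ (FGModuleCat K))) fun X =>
    id_comm_of_eq (𝟙_ (FGModuleCat K)) (fun v => (diffRep hG (𝟙_ (RepZGam p Kbar t))).obj.φ X v)
      (fun v => (𝟙_ (RepZg p K d)).obj.φ X v) fun v =>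
    (repSplit_lie_unit hG X v).trans (RepZg.unit_φ X v).symm
  hom_inv_id := RepZg.hom_ext (Category.id_comp (𝟙 (𝟙_ (FGModuleCat K))))
  inv_hom_id := RepZg.hom_ext (Category.id_comp (𝟙 (𝟙_ (FGModuleCat K))))

/-- The monoidal structure of `∂`. -/
def diffMonoidal : (diffFunctor hG).CoreMonoidal where
  εIso := diffUnitIso hG
  μIso := diffTensorIso hG
  μIso_hom_natural_left {V V'} f W := RepZg.hom_ext
    ((Category.comp_id (f.hom.hom ▷ W.obj.V)).trans (Category.id_comp (f.hom.hom ▷ W.obj.V)).symm)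
  μIso_hom_natural_right {V V'} W f := RepZg.hom_ext
    ((Category.comp_id (W.obj.V ◁ f.hom.hom)).trans (Category.id_comp (W.obj.V ◁ f.hom.hom)).symm)
  associativity U V W := RepZg.hom_ext (Eq.trans (b :=
      (𝟙 (U.obj.V ⊗ V.obj.V : FGModuleCat K) ▷ W.obj.V) ≫
        𝟙 ((U.obj.V ⊗ V.obj.V) ⊗ W.obj.V : FGModuleCat K) ≫ (α_ U V W).hom.hom.hom) rfl
    (Eq.trans (b := (α_ U.obj.V V.obj.V W.obj.V).hom ≫
        (U.obj.V ◁ 𝟙 (V.obj.V ⊗ W.obj.V : FGModuleCat K)) ≫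
        𝟙 (U.obj.V ⊗ V.obj.V ⊗ W.obj.V : FGModuleCat K))
      (by rw [id_whiskerRight, whiskerLeft_id, Category.id_comp, Category.id_comp,
        Category.comp_id, Category.comp_id, RepZGam.associator_hom]) rfl))
  left_unitality V := RepZg.hom_ext (Eq.trans (b := (λ_ V.obj.V).hom) rfl
    (Eq.trans (b := (𝟙 (𝟙_ (FGModuleCat K)) ▷ V.obj.V) ≫
      𝟙 (𝟙_ (FGModuleCat K) ⊗ V.obj.V : FGModuleCat K) ≫ (λ_ V).hom.hom.hom)
      (by rw [id_whiskerRight, Category.id_comp, Category.id_comp, RepZGam.leftUnitor_hom]) rfl))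
  right_unitality V := RepZg.hom_ext (Eq.trans (b := (ρ_ V.obj.V).hom) rfl
    (Eq.trans (b := (V.obj.V ◁ 𝟙 (𝟙_ (FGModuleCat K))) ≫
      𝟙 (V.obj.V ⊗ 𝟙_ (FGModuleCat K) : FGModuleCat K) ≫ (ρ_ V).hom.hom.hom)
      (by rw [whiskerLeft_id, Category.id_comp, Category.id_comp, RepZGam.rightUnitor_hom]) rfl))

/-- The braided structure of `∂`. -/
abbrev diffBraided : (diffFunctor hG).Braided where
  toMonoidal := (diffMonoidal hG).toMonoidal
  braided D E := RepZg.hom_ext (by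
    change 𝟙 (D.obj.V ⊗ E.obj.V : FGModuleCat K) ≫ (β_ D.obj.V E.obj.V).hom =
      (β_ D.obj.V E.obj.V).hom ≫ 𝟙 (E.obj.V ⊗ D.obj.V : FGModuleCat K)
    rw [Category.comp_id, Category.id_comp])

theorem diffEquivalence_isMonoidal :
    letI : (diffEquivalence hG).functor.Monoidal := (diffBraided hG).toMonoidal
    letI : (diffEquivalence hG).inverse.Monoidal := (expBraided hG).toMonoidal
    (diffEquivalence hG).IsMonoidal := by
  let _ : (diffEquivalence hG).functor.Monoidal := (diffBraided hG).toMonoidal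
  let _ : (diffEquivalence hG).inverse.Monoidal := (expBraided hG).toMonoidal
  refine ⟨RepZGam.hom_ext ?_, fun D E => RepZGam.hom_ext ?_⟩
  · change 𝟙 (𝟙_ (FGModuleCat K)) = 𝟙 (𝟙_ (FGModuleCat K)) ≫ 𝟙 (𝟙_ (FGModuleCat K))
    rw [Category.comp_id]
  · change 𝟙 (D.obj.V ⊗ E.obj.V : FGModuleCat K) = 𝟙 (D.obj.V ⊗ E.obj.V : FGModuleCat K) ≫
      𝟙 (D.obj.V ⊗ E.obj.V : FGModuleCat K) ≫ (𝟙 D.obj.V ⊗ₘ 𝟙 E.obj.V)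
    simp

/-- The identity of underlying vector spaces exhibits `∂` as differentiation. -/
theorem isDifferentiation_diffFunctor :
    letI : (diffFunctor hG).Monoidal := (diffBraided hG).toMonoidal
    IsDifferentiation R (diffFunctor hG) := by
  let _ : (diffFunctor hG).Monoidal := (diffBraided hG).toMonoidal
  refine ⟨NatIso.ofComponents (fun V => Iso.refl V.obj.V) fun f =>
    (Category.comp_id f.hom.hom).trans (Category.id_comp f.hom.hom).symm, ⟨?_, fun V W => ?_⟩,
    fun X => ?_⟩
  · exact FGModuleCat.hom_ext (LinearMap.ext fun v => rfl)
  · exact FGModuleCat.hom_ext (TensorProduct.ext' fun a b => rfl)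
  · obtain ⟨γ, hγ⟩ := R.exists_exp hG X
    refine ⟨γ, hγ.mono fun a h => h.2.2, fun V v => ?_⟩
    have := (repSplit hG V).tendsto_rep hG (hγ.mono fun a h => ⟨h.1, h.2.1⟩) v
    simp only [← repSplit_spec] at this
    exact this

/-- The identity of underlying vector spaces exhibits `𝕍` as exponentiation. -/
theorem isExponentiation_expFunctor :
    letI : (expFunctor hG).Monoidal := (expBraided hG).toMonoidal
    IsExponentiation R (expFunctor hG) := by
  let _ : (expFunctor hG).Monoidal := (expBraided hG).toMonoidal
  refine ⟨NatIso.ofComponents (fun V => Iso.refl V.obj.V) fun f =>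
    (Category.comp_id f.hom.hom).trans (Category.id_comp f.hom.hom).symm, ⟨?_, fun V W => ?_⟩,
    fun γ hγ D v => ?_⟩
  · exact FGModuleCat.hom_ext (LinearMap.ext fun v => rfl)
  · exact FGModuleCat.hom_ext (TensorProduct.ext' fun a b => rfl)
  · have := (lieSplit D).hasSumFD_rep hG hγ v
    simp only [← lieSplit_spec] at this
    exact this

end Monoidal

/-! ### Contragredient representations. -/

section Dual

/-- The flag on the dual space. -/
theorem IsIteratedExtension.dual {K : Type u} [Field K] {V : Type v} [AddCommGroup V] [Module K V]
    {S : Type w} {act : S → Module.End K V} {act' : S → Module.End K (Module.Dual K V)}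
    {c : ℤ → S → K}
    (h' : ∀ (s : S) (n : ℤ), ∃ (s' : S) (k : K), ∀ (f : Module.Dual K V) (v : V),
      (act' s f - c (-n) s • f) v = k * f (act s' v - c n s' • v))
    (hV : IsIteratedExtension act c ⊤) : IsIteratedExtension act' c ⊤ := by
  -- The dual flag consists of the annihilators in reverse order: the quotient of the annihilators
  -- of `A` and `B` is dual to `B / A` and has weight `-n`.
  have key : ∀ A : Submodule K V, IsIteratedExtension act c A →
      IsIteratedExtension act' c A.dualAnnihilator → IsIteratedExtension act' c ⊤ := by
    intro A hA
    induction hA with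
    | bot => rw [Submodule.dualAnnihilator_bot]; exact id
    | @step A B n hA hAB h ih =>
      refine fun hB => ih (.step (-n) hB (Submodule.dualAnnihilator_anti hAB) fun s f hf => ?_)
      rw [Submodule.mem_dualAnnihilator] at hf ⊢
      intro v hv
      obtain ⟨s', k, hs⟩ := h' s n
      rw [hs, hf _ (h s' v hv), mul_zero]
  refine key ⊤ hV ?_
  rw [Submodule.dualAnnihilator_top]
  exact .bot

namespace LieRep
variable {K : Type u} [Field K] {L : Type w} [LieRing L] [LieAlgebra K L]

/-- The contragredient action. -/
def dualAction {V : Type u} [AddCommGroup V] [Module K V] (φ : L →ₗ⁅K⁆ Module.End K V) :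
    L →ₗ⁅K⁆ Module.End K (Module.Dual K V) where
  toFun x := -(φ x).dualMap
  map_add' x y := by
    refine LinearMap.ext fun f => LinearMap.ext fun v => ?_
    simp only [map_add, LinearMap.neg_apply, LinearMap.dualMap_apply, LinearMap.add_apply]
    abel
  map_smul' c x := by
    refine LinearMap.ext fun f => LinearMap.ext fun v => ?_
    simp
  map_lie' {x y} := by
    refine LinearMap.ext fun f => LinearMap.ext fun v => ?_
    simp only [LieHom.map_lie, Ring.lie_def, LinearMap.neg_apply, LinearMap.dualMap_apply,
      LinearMap.sub_apply, Module.End.mul_apply, map_sub, map_neg]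
    abel

theorem dualAction_apply {V : Type u} [AddCommGroup V] [Module K V] (φ : L →ₗ⁅K⁆ Module.End K V)
    (x : L) (f : Module.Dual K V) (v : V) : dualAction φ x f v = -f (φ x v) := rfl

/-- The contragredient representation. -/
def dual (D : LieRep K L) : LieRep K L where
  V := FGModuleCat.FGModuleCatDual K D.V
  φ := dualAction (V := D.V) D.φ

theorem contractLeft_comm {V : Type u} [AddCommGroup V] [Module K V] (φ : L →ₗ⁅K⁆ Module.End K V)
    (x : L) (v : Module.Dual K V ⊗[K] V) :
    contractLeft K V (tensorAction (dualAction φ) φ x v) = 0 := by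
  induction v using TensorProduct.induction_on with
  | zero => simp only [map_zero]
  | add a b ha hb => rw [map_add, map_add, ha, hb, add_zero]
  | tmul f a =>
    rw [tensorAction_tmul, map_add, contractLeft_apply, contractLeft_apply, dualAction_apply,
      neg_add_cancel]

/-- The coevaluation corresponds to the identity endomorphism of `V`, on which `x` acts by a
commutator, hence as zero. -/
theorem coevaluation_comm {V : Type u} [AddCommGroup V] [Module K V] [FiniteDimensional K V]
    (φ : L →ₗ⁅K⁆ Module.End K V) (x : L) (c : K) :
    tensorAction φ (dualAction φ) x (coevaluation K V c) = 0 := by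
  have hinj : Function.Injective
      ((dualTensorHom K V V) ∘ₗ (TensorProduct.comm K V (Module.Dual K V)).toLinearMap) :=
    (dualTensorHomEquivOfBasis (Module.finBasis K V)).injective.comp
      (TensorProduct.comm K V (Module.Dual K V)).injective
  refine hinj ?_
  have hc : coevaluation K V c = c • coevaluation K V 1 := by
    rw [← map_smul, smul_eq_mul, mul_one]
  rw [hc, map_smul, map_smul, map_zero, coevaluation_apply_one]
  convert smul_zero c
  refine LinearMap.ext fun w => ?_
  set b := Module.Basis.ofVectorSpace K V
  have h1 : ∀ w, ∑ i, b.coord i w • b i = w := fun w => b.sum_repr w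
  simp only [map_sum, tensorAction_tmul, map_add, LinearMap.comp_apply, LinearEquiv.coe_coe,
    TensorProduct.comm_tmul, LinearMap.sum_apply, LinearMap.add_apply, dualTensorHom_apply,
    dualAction_apply, neg_smul, LinearMap.zero_apply, Finset.sum_add_distrib,
    Finset.sum_neg_distrib]
  have h2 : ∑ i, b.coord i w • φ x (b i) = φ x w := by
    simp_rw [← map_smul, ← map_sum, h1]
  rw [h1, h2, add_neg_cancel]

/-- The evaluation pairing. -/
def dualEval (D : LieRep K L) : D.dual ⊗ D ⟶ 𝟙_ (LieRep K L) :=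
  ⟨FGModuleCat.FGModuleCatEvaluation K D.V, fun x v => contractLeft_comm D.φ x v⟩

/-- The coevaluation. -/
def dualCoeval (D : LieRep K L) : 𝟙_ (LieRep K L) ⟶ D ⊗ D.dual :=
  ⟨FGModuleCat.FGModuleCatCoevaluation K D.V, fun x v =>
    (map_zero (coevaluation K D.V)).trans (coevaluation_comm D.φ x v).symm⟩

/-- The contragredient representation is a dual. -/
abbrev dualPairing (D : LieRep K L) : ExactPairing D D.dual :=
  letI : ExactPairing ((forget K L).obj D) ((forget K L).obj D.dual) :=
    FGModuleCat.exactPairing K D.V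
  ExactPairing.ofFaithful (forget K L) D.dualEval D.dualCoeval
    ((Category.id_comp _).trans
      (Category.comp_id (FGModuleCat.FGModuleCatEvaluation K D.V))).symm
    ((Category.id_comp _).trans
      (Category.comp_id (FGModuleCat.FGModuleCatCoevaluation K D.V))).symm

end LieRep

theorem exists_exactPairing_lieRepZ {K : Type u} [Field K] {L : Type w} [LieRing L] [LieAlgebra K L]
    (δ : L →ₗ[K] K) (D : (lieRepZ δ).FullSubcategory) :
    ∃ E : (lieRepZ δ).FullSubcategory, Nonempty (ExactPairing D E) := by
  have h : lieRepZ δ D.obj.dual := by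
    refine IsIteratedExtension.dual (fun x n => ⟨x, -1, fun f v => ?_⟩) D.property
    rw [LinearMap.sub_apply, LinearMap.smul_apply]
    change -f (D.obj.φ x v) - _ = _
    rw [map_sub, map_smul, smul_eq_mul, smul_eq_mul]
    push_cast
    ring
  refine ⟨⟨D.obj.dual, h⟩, ⟨?_⟩⟩
  let _ : ExactPairing ((lieRepZ δ).ι.obj D) ((lieRepZ δ).ι.obj ⟨D.obj.dual, h⟩) :=
    LieRep.dualPairing D.obj
  exact ExactPairing.ofFullyFaithful (lieRepZ δ).ι _ _

end Dual

/-! ### Transport of duals and exactness through an equivalence. -/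

section Tannakian
variable {K : Type u} [Field K] {C : Type v} {D : Type w} [Category.{u} C]
    [Category.{u} D] [Preadditive C] [Preadditive D] [Linear K C] [Linear K D]
    [MonoidalCategory C] [MonoidalCategory D] [SymmetricCategory C] [SymmetricCategory D]

/-- Equivalences are exact, and fully faithful monoidal functors reflect exact pairings, so duals
are needed only in the target category. -/
theorem isTannakianFunctor_functor (E : C ≌ D) [E.functor.Braided] (h1 : E.functor.Additive)
    (h2 : E.functor.Linear K) (h : ∀ X : D, ∃ Y : D, Nonempty (ExactPairing X Y)) :
    IsTannakianFunctor K E.functor where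
  additive := h1
  linear := h2
  exact_left := inferInstance
  exact_right := inferInstance
  dual X := by
    obtain ⟨Y, ⟨hY⟩⟩ := h (E.functor.obj X)
    let i : ExactPairing (E.functor.obj X) (E.functor.obj (E.inverse.obj Y)) :=
      exactPairingCongrRight (Y' := Y) (E.counitIso.app Y)
    exact ⟨E.inverse.obj Y, ⟨ExactPairing.ofFullyFaithful E.functor X _⟩, ⟨i⟩⟩

theorem isTannakianFunctor_inverse (E : C ≌ D) [E.functor.Braided] [E.inverse.Braided]
    (h1 : E.inverse.Additive)
    (h2 : E.inverse.Linear K) (h : ∀ X : D, ∃ Y : D, Nonempty (ExactPairing X Y)) :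
    IsTannakianFunctor K E.inverse where
  additive := h1
  linear := h2
  exact_left := inferInstance
  exact_right := inferInstance
  dual X := by
    obtain ⟨Y, ⟨hY⟩⟩ := h X
    let i : ExactPairing (E.functor.obj (E.inverse.obj X)) (E.functor.obj (E.inverse.obj Y)) :=
      exactPairingCongr (X' := X) (Y' := Y) (E.counitIso.app X) (E.counitIso.app Y)
    exact ⟨Y, ⟨hY⟩, ⟨ExactPairing.ofFullyFaithful E.functor _ _⟩⟩

end Tannakian
end SenTheory
end

theorem mainTheorem6 (p : ℕ) [Fact p.Prime]
    (K : Type u) [NormedField K] [IsUltrametricDist K] [CompleteSpace K] [NormedAlgebra ℚ_[p] K]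
    [IsDiscreteValuationRing (NormedField.valuation (K := K)).valuationSubring]
    [CharP (IsLocalRing.ResidueField (NormedField.valuation (K := K)).valuationSubring) p]
    (Kbar : Type v) [Field Kbar] [Algebra K Kbar] [IsAlgClosure K Kbar]
    (d : ℕ) (t : Fin d → (NormedField.valuation (K := K)).valuationSubring)
    (ht : IsPBasis p (fun j => IsLocalRing.residue _ (t j)))
    (R : RootSystem p Kbar (fun j => (t j : K))) :
    ∃ (E : RepZGam p Kbar (fun j => (t j : K)) ≌ RepZg p K d)
      (_ : E.functor.Braided) (_ : E.inverse.Braided),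
      E.IsMonoidal ∧ IsTannakianFunctor K E.functor ∧ IsTannakianFunctor K E.inverse ∧
        IsDifferentiation R E.functor ∧ IsExponentiation R E.inverse := by
  have : CharZero K := charZero_of_normedAlgebra p K
  -- This supplies the compactness of `Γ` on which the construction of `∂` relies.
  have : IsGalois K (KInf p Kbar (fun j => (t j : K))) := KInf.isGalois
  have hG := R.isAffineGroup ht
  let _ : (diffEquivalence hG).functor.Braided := diffBraided hG
  let _ : (diffEquivalence hG).inverse.Braided := expBraided hG
  exact ⟨diffEquivalence hG, diffBraided hG, expBraided hG, diffEquivalence_isMonoidal hG,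
    isTannakianFunctor_functor _ ⟨fun {_ _ _ _} => rfl⟩ ⟨fun {_ _} _ _ => rfl⟩
      (exists_exactPairing_lieRepZ _),
    isTannakianFunctor_inverse _ ⟨fun {_ _ _ _} => rfl⟩ ⟨fun {_ _} _ _ => rfl⟩
      (exists_exactPairing_lieRepZ _),
    isDifferentiation_diffFunctor hG, isExponentiation_expFunctor hG⟩
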